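/- A rooted graph $(G,H)$ consists of a finite graph $H$ and an induced subgraph $G\subseteq H$ whose vertices (the roots) are labelled $V(G)=\{1,\dots,v_G\}$; write $v_F,e_F$ for the numbers of vertices and edges of a graph $F$, and assume $e_H>e_G$. For $G\subsetneq J\subseteq H$ put $d(G,J)=\frac{e_J-e_G}{v_J-v_G}$, and let $m(G,H)=\max_{G\subsetneq J\subseteq H}d(G,J)$; a subgraph $J$ with $G\subsetneq J\subseteq H$ is primal if $d(G,J)=m(G,H)$. The rooted graph $(G,J)$ is grounded if some edge of $J$ joins a root to a vertex of $V(J)\setminus V(G)$. For a tuple $\mathbf{x}=(x_1,\dots,x_{v_G})$ of distinct vertices of $[n]=\{1,\dots,n\}$, let $X_{\mathbf{x}}=X_{G,H}(\mathbf{x})$ be the number of subgraphs of the binomial random graph $G_{n,p}$ that are copies of $(V(H),E(H)\setminus E(G))$ in which each root $j$ is mapped to $x_j$, and let $\mu=\mu_{G,H}=\mathbb{E}X_{\mathbf{x}}$, which does not depend on $\mathbf{x}$. Let $$\Phi=\Phi_{G,H}=\min_{G\subseteq J\subseteq H:\ e_J>e_G}\mu_{G,J}.$$ Theorem. Let $(G,H)$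 be a rooted graph with a unique primal subgraph $J$. If $(G,J)$ is grounded, then there are constants $c,C,\alpha>0$ (depending only on $(G,H)$) such that, for all $p=p(n)\in[0,1]$ and $\varepsilon=\varepsilon(n)\in[n^{-\alpha},1]$, $$\lim_{n\to\infty}\mathbb{P}\Bigl(\max_{\mathbf{x}}|X_{\mathbf{x}}-\mu|<\varepsilon\mu\Bigr)=\begin{cases}0&\text{if }\varepsilon^2\Phi\le c\log n,\\1&\text{if }\varepsilon^2\Phi\ge C\log n,\end{cases}$$ where the maximum is over all tuples $\mathbf{x}$ of $v_G$ distinct vertices of $[n]$, and each of the two conditions is required for all sufficiently large $n$. -/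

import Mathlib

open Filter Topology MeasureTheory
open scoped SimpleGraph

universe u

/-- A rooted graph `(G, H)` with `k` root vertices: a finite graph `H` with an injective labelling
of the roots. `G` is the subgraph of `H` induced by the roots, see `RootedGraph.rootGraph`. -/
structure RootedGraph (k : ℕ) where
  /-- the vertex set of `H` -/
  V : Type u
  finite : Finite V
  /-- the graph `H` -/
  graph : SimpleGraph V
  /-- the labelled root vertices -/
  root : Fin k ↪ V

namespace RootedGraph

variable {k : ℕ}

instance (R : RootedGraph.{u} k) : Finite R.V := R.finite

/-- The graph `G`: the subgraph of `H` induced by the set of roots. -/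
def rootGraph (R : RootedGraph.{u} k) : R.graph.Subgraph :=
  (⊤ : R.graph.Subgraph).induce (Set.range R.root)

/-- The rooted graph `(G, J)` for a subgraph `G ⊆ J ⊆ H`. -/
def sub (R : RootedGraph.{u} k) (J : R.graph.Subgraph) (hJ : R.rootGraph ≤ J) :
    RootedGraph.{u} k where
  V := J.verts
  finite := inferInstance
  graph := J.coe
  root := ⟨fun j => ⟨R.root j, hJ.1 ⟨j, rfl⟩⟩, fun _ _ h => R.root.injective (congrArg Subtype.val h)⟩

/-- `(G, H)` is grounded if some root is adjacent in `H` to a vertex that is not a root. -/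
def Grounded (R : RootedGraph.{u} k) : Prop :=
  ∃ (j : Fin k) (w : R.V), w ∉ Set.range R.root ∧ R.graph.Adj (R.root j) w

/-- The density `d(G, J) = (e_J - e_G) / (v_J - v_G)`; it is only used for `G ⊊ J ⊆ H`, and then
the denominator is positive because `G` is an induced subgraph of `H`. -/
noncomputable def density (R : RootedGraph.{u} k) (J : R.graph.Subgraph) : ℝ :=
  ((J.edgeSet.ncard : ℝ) - (R.rootGraph.edgeSet.ncard : ℝ)) /
    ((J.verts.ncard : ℝ) - (R.rootGraph.verts.ncard : ℝ))

/-- `m(G, H)`, the maximum of `d(G, J)` over the finitely many `J` with `G ⊊ J ⊆ H`. -/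
noncomputable def maxDensity (R : RootedGraph.{u} k) : ℝ :=
  sSup {d : ℝ | ∃ J : R.graph.Subgraph, R.rootGraph < J ∧ d = R.density J}

/-- `J` is a primal subgraph of `(G, H)`: `G ⊊ J ⊆ H` and `d(G, J) = m(G, H)`. -/
def IsPrimal (R : RootedGraph.{u} k) (J : R.graph.Subgraph) : Prop :=
  R.rootGraph < J ∧ R.density J = R.maxDensity

/-- The graph `H_G = (V(H), E(H) \ E(G))`. -/
def extGraph (R : RootedGraph.{u} k) : SimpleGraph R.V :=
  R.graph.deleteEdges R.rootGraph.edgeSet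

/-- `X_x = X_{G,H}(x)`: the number of `(G, H)`-extensions of the tuple `x` in the graph `Γ`, that
is, of the subgraphs `S` of `Γ` that are copies of `H_G` with the `j`-th root at `x j`. -/
noncomputable def extCount (R : RootedGraph.{u} k) {n : ℕ} (x : Fin k ↪ Fin n)
    (Γ : SimpleGraph (Fin n)) : ℕ :=
  {S : Γ.Subgraph |
    ∃ φ : R.extGraph ≃g S.coe, ∀ j : Fin k, (φ (R.root j) : Fin n) = x j}.ncard

/-- `μ_{G,H}`, the expectation of `X_x` in `G(n, p)`. It does not depend on the tuple `x` (see
`integral_extCount_eq_mean`), which is taken to be `(1, …, k)` here. If `n < k`, there is no such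
tuple, and the value `0` is a convention. -/
noncomputable def mean (R : RootedGraph.{u} k) (n : ℕ) (p : unitInterval) : ℝ :=
  if h : k ≤ n then
    ∫ Γ, (R.extCount (Fin.castLEEmb h) Γ : ℝ) ∂(SimpleGraph.binomialRandom (Fin n) p)
  else 0

/-- `Φ_{G,H}`, the minimum of `μ_{G,J}` over the finitely many `G ⊆ J ⊆ H` with `e_J > e_G`. -/
noncomputable def minMean (R : RootedGraph.{u} k) (n : ℕ) (p : unitInterval) : ℝ :=
  sInf {m : ℝ | ∃ (J : R.graph.Subgraph) (hJ : R.rootGraph ≤ J),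
    R.rootGraph.edgeSet.ncard < J.edgeSet.ncard ∧ m = (R.sub J hJ).mean n p}

/-- The probability that `|X_x - μ| < ε μ` for all tuples `x` of `k` distinct vertices, that is,
`P(max_x |X_x - μ| < ε μ)`, in the binomial random graph `G(n, p)`. -/
noncomputable def concProb (R : RootedGraph.{u} k) (n : ℕ) (p : unitInterval) (ε : ℝ) : ℝ :=
  (SimpleGraph.binomialRandom (Fin n) p).real
    {Γ | ∀ x : Fin k ↪ Fin n, |(R.extCount x Γ : ℝ) - R.mean n p| < ε * R.mean n p}

theorem extCount_le_of_iso (R : RootedGraph.{u} k) {n : ℕ} (x : Fin k ↪ Fin n)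
    {Γ Γ' : SimpleGraph (Fin n)} (f : Γ ≃g Γ') :
    R.extCount x Γ ≤ R.extCount (x.trans f.toEquiv.toEmbedding) Γ' := by
  unfold extCount
  refine Set.ncard_le_ncard_of_injOn (fun S => S.map f.toHom) ?_ ?_ (Set.toFinite _)
  · rintro S ⟨φ, hφ⟩
    let e : S.verts ≃ (S.map f.toHom).verts := f.toEquiv.image S.verts
    have he : ∀ a, (e a : Fin n) = f a := fun a => rfl
    let ψ : S.coe ≃g (S.map f.toHom).coe :=
      { toEquiv := e
        map_rel_iff' := by
          intro a b
          simp only [SimpleGraph.Subgraph.coe_adj, he, SimpleGraph.Subgraph.map_adj,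
            Relation.Map]
          constructor
          · rintro ⟨a', b', h, ha, hb⟩
            have h1 : a' = a := f.injective ha
            have h2 : b' = b := f.injective hb
            rwa [← h1, ← h2]
          · intro h
            exact ⟨a, b, h, rfl, rfl⟩ }
    refine ⟨φ.trans ψ, fun j => ?_⟩
    have : ((φ.trans ψ) (R.root j) : Fin n) = f (φ (R.root j) : Fin n) := rfl
    rw [this, hφ]
    rfl
  · intro S _ T _ h
    have key : ∀ U : Γ.Subgraph, (U.map f.toHom).comap f.toHom = U := by
      intro U
      ext a b
      · simp
      · have hc : ((U.map f.toHom).comap f.toHom).Adj a b ↔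
            Γ.Adj a b ∧ Relation.Map U.Adj f f (f a) (f b) := Iff.rfl
        rw [hc]
        constructor
        · rintro ⟨_, a', b', h, ha, hb⟩
          have h1 : a' = a := f.injective ha
          have h2 : b' = b := f.injective hb
          rwa [← h1, ← h2]
        · intro h
          exact ⟨h.adj_sub, a, b, h, rfl, rfl⟩
    rw [← key S, ← key T]
    exact congrArg _ h

theorem extCount_iso (R : RootedGraph.{u} k) {n : ℕ} (x : Fin k ↪ Fin n)
    {Γ Γ' : SimpleGraph (Fin n)} (f : Γ ≃g Γ') :
    R.extCount (x.trans f.toEquiv.toEmbedding) Γ' = R.extCount x Γ := by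
  refine le_antisymm ?_ (R.extCount_le_of_iso x f)
  have h := R.extCount_le_of_iso (x.trans f.toEquiv.toEmbedding) f.symm
  have hx : (x.trans f.toEquiv.toEmbedding).trans f.symm.toEquiv.toEmbedding = x :=
    Function.Embedding.ext fun j => f.symm_apply_apply (x j)
  rwa [hx] at h

/-- The expectation of `X_x` is `μ_{G,H}` for every tuple `x`. -/
theorem integral_extCount_eq_mean (R : RootedGraph.{u} k) {n : ℕ} (p : unitInterval)
    (x : Fin k ↪ Fin n) :
    ∫ Γ, (R.extCount x Γ : ℝ) ∂(SimpleGraph.binomialRandom (Fin n) p) = R.mean n p := by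
  classical
  have hk : k ≤ n := by simpa using Fintype.card_le_of_embedding x
  obtain ⟨s, hs⟩ : ∃ s : Equiv.Perm (Fin n), (Fin.castLEEmb hk).trans s.toEmbedding = x := by
    obtain ⟨s, hs⟩ := Equiv.Perm.exists_extending_pair (Fin.castLEEmb hk) x
      (Fin.castLEEmb hk).injective x.injective
    exact ⟨s, Function.Embedding.ext hs⟩
  have hms : MeasurableSingletonClass (SimpleGraph (Fin n)) :=
    ⟨fun Γ => by
      have h := SimpleGraph.measurable_edgeSet (measurableSet_singleton Γ.edgeSet)
      rwa [show SimpleGraph.edgeSet ⁻¹' {Γ.edgeSet} = {Γ} by ext; simp] at h⟩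
  rw [mean, dif_pos hk, integral_fintype .of_finite, integral_fintype .of_finite]
  refine (Equiv.sum_comp s.simpleGraph _).symm.trans (Finset.sum_congr rfl fun Γ _ => ?_)
  have hf : ∃ f : Γ ≃g s.simpleGraph Γ, f.toEquiv = s :=
    ⟨{ toEquiv := s, map_rel_iff' := by simp [Equiv.simpleGraph] }, rfl⟩
  obtain ⟨f, hf⟩ := hf
  have hX : R.extCount x (s.simpleGraph Γ) = R.extCount (Fin.castLEEmb hk) Γ := by
    rw [← R.extCount_iso _ f, hf, hs]
  have hE : (s.simpleGraph Γ).edgeSet.ncard = Γ.edgeSet.ncard :=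
    (Nat.card_congr f.mapEdgeSet).symm
  rw [hX, measureReal_def, measureReal_def, SimpleGraph.binomialRandom_singleton,
    SimpleGraph.binomialRandom_singleton, hE]

end RootedGraph

/-! Let `J` be the primal subgraph, with v non-root vertices and e edges outside `G`. Everything is
done for embeddings of `H` extending x instead of subgraphs; the two counts differ by the constant
factor `aut`. An embedding of `H` consists of an embedding of the core `J` at x and an extension of
it from `J` to `H` (`embCount_eq_sum`), and the mean factorises accordingly.

By uniqueness of `J`, any other nonempty set A of non-roots spanning f edges satisfies v·f < e·|A|,
and these are integers. Hence, once n^v p^e is at least n^(-τ) for a small constant τ, every such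
n^|A| p^f exceeds a fixed power of n (`IsUniquePrimal.rpow_gap_le`). So only `J` can bring Φ near
the critical order log n / ε², and the number of extensions from `J` to `H` is concentrated at all
embeddings of `J` at once, with an error that is a small fraction of ε. What remains is the number
of copies of `J` at x, which behaves like a Poisson variable when n^v p^e is at most a small power
of n.

Concentration (`IsUniquePrimal.eventually_concentrated`). The lower tail is Janson's inequality
(`lower_tail`) and a union bound over tuples. For the upper tail, if all partial extensions are
polynomially abundant, a moment of polynomially large order suffices (`upper_tail_of_abundant`).
Otherwise only `J` fails to be abundant. Then, outside an event of polynomially small probability,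
all but boundedly many copies of `J` at x are edge-disjoint, and counting sequences of disjoint
copies gives a Poisson-type tail (`upper_tail_copies`). The almost constant number of extensions of
each copy of `J` completes the estimate.

Failure of concentration (`IsUniquePrimal.eventually_not_concentrated`). If n^v p^e < n^(-τ), a
fixed tuple typically has no copy of `J`, so its count is 0. Otherwise a given tuple has at least
(1+3ε) times the expected number of copies of `J` with probability at least n^(-20τ)
(`eventually_le_bprob_copyCount`); this sums the probabilities that exactly a given family of
vertex-disjoint copies is present. If `J` is grounded, changing the grounded root changes the
copies: for tuples that differ there, the van den Berg–Kesten inequality makes the counts nearly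
negatively correlated (`bprob_two_copyCounts_le`). The second moment method over n^(22τ) tuples
yields one with too many copies of `J`, hence of `H`. -/

namespace BernoulliSubset

open Finset

/-! ### Expectation and probability for a Bernoulli random subset -/

variable {α ι : Type*}

/-- The indicator of a proposition, as a real number. -/
noncomputable def ind (P : Prop) : ℝ := by
  classical exact if P then 1 else 0

theorem ind_of {P : Prop} (h : P) : ind P = 1 := if_pos h

theorem ind_of_not {P : Prop} (h : ¬P) : ind P = 0 := if_neg h

theorem ind_nonneg (P : Prop) : 0 ≤ ind P := by
  by_cases h : P <;> simp [ind_of, ind_of_not, h]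

theorem ind_le_one (P : Prop) : ind P ≤ 1 := by
  by_cases h : P <;> simp [ind_of, ind_of_not, h]

theorem ind_mono {P Q : Prop} (h : P → Q) : ind P ≤ ind Q := by
  by_cases hP : P
  · rw [ind_of hP, ind_of (h hP)]
  · rw [ind_of_not hP]; exact ind_nonneg _

theorem ind_congr {P Q : Prop} (h : P ↔ Q) : ind P = ind Q := by rw [propext h]

theorem ind_and (P Q : Prop) : ind (P ∧ Q) = ind P * ind Q := by
  by_cases hP : P <;> by_cases hQ : Q <;> simp [ind_of, ind_of_not, hP, hQ]

theorem ind_not (P : Prop) : ind (¬P) = 1 - ind P := by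
  by_cases h : P <;> simp [ind_of, ind_of_not, h]

theorem sum_ind (I : Finset ι) (P : ι → Prop) [DecidablePred P] :
    ∑ i ∈ I, ind (P i) = #(I.filter P) := by
  rw [card_filter]
  push_cast
  refine sum_congr rfl fun i _ => ?_
  by_cases h : P i <;> simp [ind_of, ind_of_not, h]

theorem ind_exists_le (I : Finset ι) (P : ι → Prop) :
    ind (∃ i ∈ I, P i) ≤ ∑ i ∈ I, ind (P i) := by
  by_cases h : ∃ i ∈ I, P i
  · obtain ⟨i, hi, hP⟩ := h
    calc ind _ ≤ 1 := ind_le_one _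
      _ = ind (P i) := (ind_of hP).symm
      _ ≤ _ := single_le_sum (f := fun i => ind (P i)) (fun j _ => ind_nonneg _) hi
  · rw [ind_of_not h]; exact sum_nonneg fun j _ => ind_nonneg _

/-- The expectation of `f s` for a random subset `s` of `T` that contains each element of `T`
independently with probability `p`. -/
noncomputable def bexp (p : ℝ) (T : Finset α) (f : Finset α → ℝ) : ℝ :=
  ∑ s ∈ T.powerset, p ^ #s * (1 - p) ^ (#T - #s) * f s

/-- The probability of an event for a random subset of `T` that contains each element of `T`
independently with probability `p`. -/
noncomputable def bprob (p : ℝ) (T : Finset α) (A : Finset α → Prop) : ℝ :=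
  bexp p T fun s => ind (A s)

variable {p : ℝ} {T : Finset α} {f g : Finset α → ℝ}

theorem bexp_congr (h : ∀ s ⊆ T, f s = g s) : bexp p T f = bexp p T g :=
  sum_congr rfl fun s hs => by rw [h s (mem_powerset.1 hs)]

theorem bexp_mono (hp0 : 0 ≤ p) (hp1 : p ≤ 1) (h : ∀ s ⊆ T, f s ≤ g s) :
    bexp p T f ≤ bexp p T g :=
  sum_le_sum fun s hs => mul_le_mul_of_nonneg_left (h s (mem_powerset.1 hs))
    (mul_nonneg (pow_nonneg hp0 _) (pow_nonneg (sub_nonneg.2 hp1) _))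

theorem bexp_add : bexp p T (fun s => f s + g s) = bexp p T f + bexp p T g := by
  simp [bexp, mul_add, sum_add_distrib]

theorem bexp_const_mul (c : ℝ) : bexp p T (fun s => c * f s) = c * bexp p T f := by
  simp only [bexp, mul_sum]
  exact sum_congr rfl fun s _ => by ring

theorem bexp_sub : bexp p T (fun s => f s - g s) = bexp p T f - bexp p T g := by
  simp [bexp, mul_sub, sum_sub_distrib]

theorem bexp_sum (I : Finset ι) (F : ι → Finset α → ℝ) :
    bexp p T (fun s => ∑ i ∈ I, F i s) = ∑ i ∈ I, bexp p T (F i) := by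
  simp only [bexp, mul_sum]
  exact sum_comm

theorem bexp_one : bexp p T (fun _ => 1) = 1 := by
  have h := Finset.sum_pow_mul_eq_add_pow p (1 - p) T
  simpa [bexp] using h

theorem bexp_const (c : ℝ) : bexp p T (fun _ => c) = c := by
  have h := bexp_const_mul (p := p) (T := T) (f := fun _ => 1) c
  simpa [bexp_one] using h

theorem bexp_nonneg (hp0 : 0 ≤ p) (hp1 : p ≤ 1) (h : ∀ s ⊆ T, 0 ≤ f s) : 0 ≤ bexp p T f := by
  have := bexp_mono (f := fun _ => 0) hp0 hp1 h
  rwa [bexp_const] at this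

theorem bprob_nonneg (hp0 : 0 ≤ p) (hp1 : p ≤ 1) (A : Finset α → Prop) : 0 ≤ bprob p T A :=
  bexp_nonneg hp0 hp1 fun _ _ => ind_nonneg _

theorem bprob_mono (hp0 : 0 ≤ p) (hp1 : p ≤ 1) {A B : Finset α → Prop}
    (h : ∀ s ⊆ T, A s → B s) : bprob p T A ≤ bprob p T B :=
  bexp_mono hp0 hp1 fun s hs => ind_mono (h s hs)

theorem bprob_not (A : Finset α → Prop) : bprob p T (fun s => ¬A s) = 1 - bprob p T A := by
  simp only [bprob, ind_not, bexp_sub, bexp_one]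

theorem bprob_eq_zero {A : Finset α → Prop} (h : ∀ s ⊆ T, ¬A s) : bprob p T A = 0 := by
  rw [bprob, bexp_congr (g := fun _ => 0) fun s hs => ind_of_not (h s hs), bexp_const]

theorem bprob_or_le (hp0 : 0 ≤ p) (hp1 : p ≤ 1) (A B : Finset α → Prop) :
    bprob p T (fun s => A s ∨ B s) ≤ bprob p T A + bprob p T B := by
  rw [bprob, bprob, bprob, ← bexp_add]
  refine bexp_mono hp0 hp1 fun s _ => ?_
  by_cases hA : A s <;> by_cases hB : B s <;> simp [ind_of, ind_of_not, hA, hB]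

theorem bprob_exists_le (hp0 : 0 ≤ p) (hp1 : p ≤ 1) (I : Finset ι) (A : ι → Finset α → Prop) :
    bprob p T (fun s => ∃ i ∈ I, A i s) ≤ ∑ i ∈ I, bprob p T (A i) := by
  simp only [bprob]
  rw [← bexp_sum]
  exact bexp_mono hp0 hp1 fun s _ => ind_exists_le I fun i => A i s

theorem bprob_exists_le_card_mul (hp0 : 0 ≤ p) (hp1 : p ≤ 1) (I : Finset ι)
    (A : ι → Finset α → Prop) {b : ℝ} (h : ∀ i ∈ I, bprob p T (A i) ≤ b) :
    bprob p T (fun s => ∃ i ∈ I, A i s) ≤ #I * b := by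
  refine (bprob_exists_le hp0 hp1 I A).trans ?_
  simpa using sum_le_card_nsmul I (fun i => bprob p T (A i)) b h

/-- Markov's inequality. -/
theorem bprob_le_div (hp0 : 0 ≤ p) (hp1 : p ≤ 1) (hf : ∀ s ⊆ T, 0 ≤ f s) {t : ℝ} (ht : 0 < t) :
    bprob p T (fun s => t ≤ f s) ≤ bexp p T f / t := by
  rw [le_div_iff₀ ht, mul_comm, bprob, ← bexp_const_mul]
  refine bexp_mono hp0 hp1 fun s hs => ?_
  by_cases h : t ≤ f s
  · simpa [ind_of h] using h
  · simpa [ind_of_not h] using hf s hs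

variable [DecidableEq α]

/-- Condition on whether `a` is present. Harris' inequality, the van den Berg–Kesten inequality and
conditioning on a subset are all inductions over the ground set through this recursion. -/
theorem bexp_insert {a : α} (ha : a ∉ T) (f : Finset α → ℝ) :
    bexp p (insert a T) f = (1 - p) * bexp p T f + p * bexp p T fun s => f (insert a s) := by
  rw [bexp, sum_powerset_insert ha, bexp, bexp, mul_sum, mul_sum]
  congr 1 <;> refine sum_congr rfl fun s hs => ?_
  · have : #s ≤ #T := card_le_card (mem_powerset.1 hs)
    rw [card_insert_of_notMem ha, Nat.sub_add_comm this, pow_succ]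
    ring
  · have has : a ∉ s := fun h => ha (mem_powerset.1 hs h)
    rw [card_insert_of_notMem ha, card_insert_of_notMem has, Nat.add_sub_add_right, pow_succ]
    ring

/-- Conditioning on the presence of `S` amounts to adding `S` to an unconditioned random set, by
independence. -/
theorem bexp_ind_subset_mul {S : Finset α} (hS : S ⊆ T) (g : Finset α → ℝ) :
    bexp p T (fun s => ind (S ⊆ s) * g s) = p ^ #S * bexp p T fun s => g (s ∪ S) := by
  induction T using Finset.induction generalizing S g with
  | empty =>
    obtain rfl := subset_empty.1 hS
    simp [ind_of]
  | insert a T ha ih =>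
    rw [bexp_insert ha, bexp_insert ha]
    by_cases haS : a ∈ S
    · have h1 : bexp p T (fun s => ind (S ⊆ s) * g s) = 0 := by
        rw [bexp_congr (g := fun _ => 0), bexp_const]
        intro s hs
        rw [ind_of_not, zero_mul]
        exact fun h => ha (hs (h haS))
      have h2 : ∀ s, ind (S ⊆ insert a s) = ind (S.erase a ⊆ s) := fun s =>
        ind_congr subset_insert_iff
      have h3 : S.erase a ⊆ T := by rwa [← subset_insert_iff]
      simp only [h1, h2]
      rw [ih h3 (fun s => g (insert a s))]
      have h4 : ∀ s, insert a (s ∪ S.erase a) = s ∪ S := by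
        intro s; ext b; simp only [mem_insert, mem_union, mem_erase]
        by_cases hb : b = a
        · subst hb; simp [haS]
        · simp [hb]
      have h5 : ∀ s, insert a s ∪ S = s ∪ S := by
        intro s; ext b; simp only [mem_insert, mem_union]
        by_cases hb : b = a
        · subst hb; simp [haS]
        · simp [hb]
      simp only [h4, h5]
      rw [← card_erase_add_one haS, pow_succ]
      ring
    · have h3 : S ⊆ T := (subset_insert_iff_of_notMem haS).1 hS
      have h2 : ∀ s, ind (S ⊆ insert a s) = ind (S ⊆ s) := fun s =>
        ind_congr (subset_insert_iff_of_notMem haS)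
      simp only [h2]
      rw [ih h3, ih h3 (fun s => g (insert a s))]
      simp only [insert_union]
      ring

theorem bprob_subset {S : Finset α} (hS : S ⊆ T) : bprob p T (fun s => S ⊆ s) = p ^ #S := by
  have := bexp_ind_subset_mul (p := p) hS fun _ => 1
  simpa [bexp_one, bprob] using this

/-! ### Correlation inequalities: Harris and van den Berg–Kesten -/

/-- Harris' inequality for decreasing functions. -/
theorem harris (hp0 : 0 ≤ p) (hp1 : p ≤ 1) (hf : Antitone f) (hg : Antitone g) :
    bexp p T f * bexp p T g ≤ bexp p T fun s => f s * g s := by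
  induction T using Finset.induction generalizing f g with
  | empty => simp [bexp]
  | insert a T ha ih =>
    rw [bexp_insert ha, bexp_insert ha, bexp_insert ha]
    have hf' : Antitone fun s => f (insert a s) := fun s t h => hf (insert_subset_insert a h)
    have hg' : Antitone fun s => g (insert a s) := fun s t h => hg (insert_subset_insert a h)
    have h0 := ih hf hg
    have h1 := ih hf' hg'
    have hF : bexp p T (fun s => f (insert a s)) ≤ bexp p T f :=
      bexp_mono hp0 hp1 fun s _ => hf (subset_insert a s)
    have hG : bexp p T (fun s => g (insert a s)) ≤ bexp p T g :=
      bexp_mono hp0 hp1 fun s _ => hg (subset_insert a s)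
    have hq : 0 ≤ 1 - p := sub_nonneg.2 hp1
    -- The average of the products over the two states of `a` exceeds the product of the averages by
    -- exactly p(1-p) times the product of the two decrements.
    have h2 := mul_nonneg (mul_nonneg hp0 hq) (mul_nonneg (sub_nonneg.2 hF) (sub_nonneg.2 hG))
    have h3 := mul_le_mul_of_nonneg_left h0 hq
    have h4 := mul_le_mul_of_nonneg_left h1 hp0
    nlinarith

theorem prod_le_bexp_prod (hp0 : 0 ≤ p) (hp1 : p ≤ 1) (I : Finset ι) (F : ι → Finset α → ℝ)
    (hF : ∀ i ∈ I, Antitone (F i)) (hF0 : ∀ i ∈ I, ∀ s, 0 ≤ F i s) :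
    ∏ i ∈ I, bexp p T (F i) ≤ bexp p T fun s => ∏ i ∈ I, F i s := by
  classical
  induction I using Finset.induction with
  | empty => simp [bexp_one]
  | insert i I hi ih =>
    have hF' : ∀ j ∈ I, Antitone (F j) := fun j hj => hF j (mem_insert_of_mem hj)
    have hF0' : ∀ j ∈ I, ∀ s, 0 ≤ F j s := fun j hj => hF0 j (mem_insert_of_mem hj)
    simp only [prod_insert hi]
    refine (mul_le_mul_of_nonneg_left (ih hF' hF0')
      (bexp_nonneg hp0 hp1 fun s _ => hF0 i (mem_insert_self _ _) s)).trans ?_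
    exact harris hp0 hp1 (hF i (mem_insert_self _ _)) fun s t h =>
      prod_le_prod (fun j hj => hF0' j hj _) fun j hj => hF' j hj h

/-- Disjoint occurrence of two events. -/
def DisjointlyOccur (A B : Finset α → Prop) (s : Finset α) : Prop :=
  ∃ I K, I ⊆ s ∧ K ⊆ s ∧ Disjoint I K ∧ A I ∧ B K

/-- The van den Berg–Kesten inequality for increasing events. -/
theorem bprob_disjointlyOccur_le (hp0 : 0 ≤ p) (hp1 : p ≤ 1) {A B : Finset α → Prop}
    (hA : ∀ s t, s ⊆ t → A s → A t) (hB : ∀ s t, s ⊆ t → B s → B t) :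
    bprob p T (DisjointlyOccur A B) ≤ bprob p T A * bprob p T B := by
  induction T using Finset.induction generalizing A B with
  | empty =>
    have h : ∀ f : Finset α → ℝ, bexp p ∅ f = f ∅ := fun f => by simp [bexp]
    simp only [bprob, h]
    rw [← ind_and]
    refine ind_mono ?_
    rintro ⟨I, K, hI, hK, -, hAI, hBK⟩
    exact ⟨hA _ _ hI hAI, hB _ _ hK hBK⟩
  | insert a T ha ih =>
    set A' : Finset α → Prop := fun s => A (insert a s) with hA'
    set B' : Finset α → Prop := fun s => B (insert a s) with hB'
    have mA : ∀ s t, s ⊆ t → A' s → A' t := fun s t h => hA _ _ (insert_subset_insert a h)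
    have mB : ∀ s t, s ⊆ t → B' s → B' t := fun s t h => hB _ _ (insert_subset_insert a h)
    have iA : ∀ s, A s → A' s := fun s => hA _ _ (subset_insert a s)
    have iB : ∀ s, B s → B' s := fun s => hB _ _ (subset_insert a s)
    have h00 := ih hA hB
    have h01 := ih hA mB
    have h10 := ih mA hB
    have h11 := ih mA mB
    have key : ∀ s, DisjointlyOccur A B (insert a s) →
        DisjointlyOccur A' B s ∨ DisjointlyOccur A B' s := by
      rintro s ⟨I, K, hI, hK, hd, hAI, hBK⟩
      by_cases haI : a ∈ I
      · left
        have haK : a ∉ K := fun h => disjoint_left.1 hd haI h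
        refine ⟨I.erase a, K, subset_insert_iff.1 hI, (subset_insert_iff_of_notMem haK).1 hK,
          hd.mono_left (erase_subset _ _), ?_, hBK⟩
        simpa [hA', insert_erase haI] using hAI
      · right
        refine ⟨I, K.erase a, (subset_insert_iff_of_notMem haI).1 hI, subset_insert_iff.1 hK,
          hd.mono_right (erase_subset _ _), hAI, ?_⟩
        exact hB _ _ (subset_insert_iff.2 Subset.rfl) hBK
    -- Once `a` is present, it serves as a witness for only one of the two events, so one of A'□B,
    -- A□B' occurs; A□B is contained in both, and inclusion–exclusion applies. The cruder bound by
    -- A'□B' is `e2`.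
    have e1 : bexp p T (fun s => ind (DisjointlyOccur A B (insert a s))) ≤
        bprob p T (DisjointlyOccur A' B) + bprob p T (DisjointlyOccur A B') -
          bprob p T (DisjointlyOccur A B) := by
      rw [bprob, bprob, bprob, ← bexp_add, ← bexp_sub]
      refine bexp_mono hp0 hp1 fun s _ => ?_
      by_cases h0 : DisjointlyOccur A B s
      · have h1 : DisjointlyOccur A' B s := by
          obtain ⟨I, K, hI, hK, hd, hAI, hBK⟩ := h0
          exact ⟨I, K, hI, hK, hd, iA _ hAI, hBK⟩
        have h2 : DisjointlyOccur A B' s := by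
          obtain ⟨I, K, hI, hK, hd, hAI, hBK⟩ := h0
          exact ⟨I, K, hI, hK, hd, hAI, iB _ hBK⟩
        rw [ind_of h0, ind_of h1, ind_of h2]
        linarith [ind_le_one (DisjointlyOccur A B (insert a s))]
      · rw [ind_of_not h0, sub_zero]
        by_cases h : DisjointlyOccur A B (insert a s)
        · rw [ind_of h]
          rcases key s h with h | h
          · rw [ind_of h]; linarith [ind_nonneg (DisjointlyOccur A B' s)]
          · rw [ind_of h]; linarith [ind_nonneg (DisjointlyOccur A' B s)]
        · rw [ind_of_not h]
          exact add_nonneg (ind_nonneg _) (ind_nonneg _)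
    have e2 : bexp p T (fun s => ind (DisjointlyOccur A B (insert a s))) ≤
        bprob p T (DisjointlyOccur A' B') := by
      refine bexp_mono hp0 hp1 fun s _ => ind_mono fun h => ?_
      rcases key s h with ⟨I, K, hI, hK, hd, hAI, hBK⟩ | ⟨I, K, hI, hK, hd, hAI, hBK⟩
      · exact ⟨I, K, hI, hK, hd, hAI, iB _ hBK⟩
      · exact ⟨I, K, hI, hK, hd, iA _ hAI, hBK⟩
    have hq : 0 ≤ 1 - p := sub_nonneg.2 hp1
    have expand : ∀ C : Finset α → Prop, bprob p (insert a T) C =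
        (1 - p) * bprob p T C + p * bprob p T fun s => C (insert a s) :=
      fun C => bexp_insert ha _
    rw [expand, expand, expand]
    change _ ≤ ((1 - p) * bprob p T A + p * bprob p T A') *
      ((1 - p) * bprob p T B + p * bprob p T B')
    -- Split the weight p of the presence of `a` as p(1-p) + p², using `e1` for the first portion
    -- and `e2` for the second. The coefficients then match the expansion of the product on the
    -- right.
    have m1 := mul_le_mul_of_nonneg_left e1 (mul_nonneg hp0 hq)
    have m2 := mul_le_mul_of_nonneg_left (e2.trans h11) (mul_nonneg hp0 hp0)
    have m3 := mul_le_mul_of_nonneg_left h00 (mul_nonneg hq hq)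
    have m4 := mul_le_mul_of_nonneg_left h01 (mul_nonneg hp0 hq)
    have m5 := mul_le_mul_of_nonneg_left h10 (mul_nonneg hp0 hq)
    change _ + p * bexp p T (fun s => ind (DisjointlyOccur A B (insert a s))) ≤ _
    nlinarith

/-! ### Janson's inequality -/

theorem one_sub_sum_le_prod (I : Finset ι) (x : ι → ℝ) (h0 : ∀ i ∈ I, 0 ≤ x i)
    (h1 : ∀ i ∈ I, x i ≤ 1) : 1 - ∑ i ∈ I, x i ≤ ∏ i ∈ I, (1 - x i) := by
  classical
  induction I using Finset.induction with
  | empty => simp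
  | insert i I hi ih =>
    have ih := ih (fun j hj => h0 j (mem_insert_of_mem hj)) fun j hj => h1 j (mem_insert_of_mem hj)
    rw [sum_insert hi, prod_insert hi]
    have a0 := h0 i (mem_insert_self _ _)
    have a1 := h1 i (mem_insert_self _ _)
    have hs : 0 ≤ ∑ j ∈ I, x j := sum_nonneg fun j hj => h0 j (mem_insert_of_mem hj)
    nlinarith [mul_le_mul_of_nonneg_left ih (sub_nonneg.2 a1), mul_nonneg a0 hs]

theorem antitone_one_sub_ind_subset (S : Finset α) {u : ℝ} (hu : 0 ≤ u) :
    Antitone fun s : Finset α => 1 - u * ind (S ⊆ s) := fun _ _ hst =>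
  sub_le_sub_left (mul_le_mul_of_nonneg_left (ind_mono fun h => h.trans hst) hu) _

theorem one_sub_mul_ind_nonneg (P : Prop) {u : ℝ} (hu : u ≤ 1) : 0 ≤ 1 - u * ind P := by
  by_cases h : P
  · rw [ind_of h]; linarith
  · rw [ind_of_not h]; linarith

/-- Factors whose sets avoid `S` are independent of the presence of `S`. The factors meeting `S` are
bounded below by one minus a sum; each summand costs at most p^|S ∪ F j| times the expectation of
the independent part `W₀`, because `W₀` is decreasing. Dropping factors only increases the
expectation, so `W₀` may be replaced by the full product when the prefactor is nonnegative. -/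
theorem janson_conditional (hp0 : 0 ≤ p) (hp1 : p ≤ 1) (I : Finset ι) (F : ι → Finset α)
    (hF : ∀ i ∈ I, F i ⊆ T) (S : Finset α) (hS : S ⊆ T) {u : ℝ} (hu0 : 0 ≤ u) (hu1 : u ≤ 1) :
    (p ^ #S - u * ∑ j ∈ I, ind (¬Disjoint S (F j)) * p ^ #(S ∪ F j)) *
        bexp p T (fun s => ∏ j ∈ I, (1 - u * ind (F j ⊆ s))) ≤
      bexp p T fun s => ind (S ⊆ s) * ∏ j ∈ I, (1 - u * ind (F j ⊆ s)) := by
  classical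
  set W : Finset α → ℝ := fun s => ∏ j ∈ I, (1 - u * ind (F j ⊆ s)) with hW
  have fac0 : ∀ j s, 0 ≤ 1 - u * ind (F j ⊆ s) := fun j s => one_sub_mul_ind_nonneg _ hu1
  have fac1 : ∀ j s, 1 - u * ind (F j ⊆ s) ≤ 1 := fun j s => by
    linarith [mul_nonneg hu0 (ind_nonneg (F j ⊆ s))]
  set I₀ := I.filter fun j => Disjoint S (F j) with hI₀
  set I₁ := I.filter fun j => ¬Disjoint S (F j) with hI₁
  set W₀ : Finset α → ℝ := fun s => ∏ j ∈ I₀, (1 - u * ind (F j ⊆ s)) with hW₀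
  have hW0nn : ∀ s, 0 ≤ W₀ s := fun s => prod_nonneg fun j _ => fac0 j s
  have hWW : ∀ s, W s = W₀ s * ∏ j ∈ I₁, (1 - u * ind (F j ⊆ s)) := fun s =>
    (prod_filter_mul_prod_filter_not I (fun j => Disjoint S (F j)) _).symm
  have anti : Antitone W₀ := fun s t hst => prod_le_prod (fun j _ => fac0 j t) fun j _ =>
    antitone_one_sub_ind_subset (F j) hu0 hst
  have hWle : bexp p T W ≤ bexp p T W₀ := bexp_mono hp0 hp1 fun s _ => by
    rw [hWW]
    exact mul_le_of_le_one_right (hW0nn s) (prod_le_one (fun j _ => fac0 j s) fun j _ => fac1 j s)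
  have hWnn : 0 ≤ bexp p T W := bexp_nonneg hp0 hp1 fun s _ => prod_nonneg fun j _ => fac0 j s
  have hSum : ∑ j ∈ I, ind (¬Disjoint S (F j)) * p ^ #(S ∪ F j) =
      ∑ j ∈ I₁, p ^ #(S ∪ F j) := by
    rw [hI₁, sum_filter]
    refine sum_congr rfl fun j _ => ?_
    by_cases h : Disjoint S (F j) <;> simp [ind_of, ind_of_not, h]
  rw [hSum]
  rcases le_or_gt 0 (p ^ #S - u * ∑ j ∈ I₁, p ^ #(S ∪ F j)) with hpos | hneg
  · refine (mul_le_mul_of_nonneg_left hWle hpos).trans ?_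
    have e0 : bexp p T (fun s => ind (S ⊆ s) * W₀ s) = p ^ #S * bexp p T W₀ := by
      rw [bexp_ind_subset_mul hS]
      congr 2
      funext s
      refine prod_congr rfl fun j hj => ?_
      have hd : Disjoint S (F j) := (mem_filter.1 hj).2
      congr 2
      refine ind_congr ⟨fun h => ?_, fun h => h.trans subset_union_left⟩
      intro x hx
      rcases mem_union.1 (h hx) with h' | h'
      · exact h'
      · exact absurd hx (disjoint_left.1 hd h')
    have e1 : ∀ j ∈ I₁, bexp p T (fun s => ind (S ∪ F j ⊆ s) * W₀ s) ≤
        p ^ #(S ∪ F j) * bexp p T W₀ := by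
      intro j hj
      rw [bexp_ind_subset_mul (union_subset hS (hF j (mem_filter.1 hj).1))]
      exact mul_le_mul_of_nonneg_left (bexp_mono hp0 hp1 fun s _ => anti subset_union_left)
        (pow_nonneg hp0 _)
    calc (p ^ #S - u * ∑ j ∈ I₁, p ^ #(S ∪ F j)) * bexp p T W₀
        = p ^ #S * bexp p T W₀ - u * ∑ j ∈ I₁, p ^ #(S ∪ F j) * bexp p T W₀ := by
          rw [sub_mul, mul_assoc, sum_mul]
      _ ≤ bexp p T (fun s => ind (S ⊆ s) * W₀ s) -
          u * ∑ j ∈ I₁, bexp p T (fun s => ind (S ∪ F j ⊆ s) * W₀ s) := by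
          rw [e0]
          exact sub_le_sub_left (mul_le_mul_of_nonneg_left (sum_le_sum e1) hu0) _
      _ = bexp p T (fun s => ind (S ⊆ s) * W₀ s -
          u * ∑ j ∈ I₁, ind (S ∪ F j ⊆ s) * W₀ s) := by
          rw [bexp_sub, bexp_const_mul, bexp_sum]
      _ ≤ _ := by
          refine bexp_mono hp0 hp1 fun s _ => ?_
          change _ ≤ ind (S ⊆ s) * W s
          have := one_sub_sum_le_prod I₁ (fun j => u * ind (F j ⊆ s))
            (fun j _ => mul_nonneg hu0 (ind_nonneg _))
            fun j _ => mul_le_one₀ hu1 (ind_nonneg _) (ind_le_one _)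
          have h2 := mul_le_mul_of_nonneg_left this
            (mul_nonneg (ind_nonneg (S ⊆ s)) (hW0nn s))
          rw [hWW]
          refine le_trans (le_of_eq ?_) (h2.trans (le_of_eq (by ring)))
          rw [mul_sub, mul_one, mul_sum, mul_sum]
          congr 1
          refine sum_congr rfl fun j _ => ?_
          rw [ind_congr (union_subset_iff (s := S) (t := F j) (u := s)), ind_and]
          ring
  · exact (mul_nonpos_of_nonpos_of_nonneg hneg.le hWnn).trans
      (bexp_nonneg hp0 hp1 fun s _ => mul_nonneg (ind_nonneg _) (prod_nonneg fun j _ => fac0 j s))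

/-- By `janson_conditional`, each new index multiplies the expectation by at most 1 - u(p^|F i| -
uD), where D collects its overlaps with earlier indices. The number 1 - u·1 acts as a Laplace weight
for a present set, with `u` to be optimised later. -/
theorem bexp_prod_one_sub_le (hp0 : 0 ≤ p) (hp1 : p ≤ 1) (I : Finset ι) (F : ι → Finset α)
    (hF : ∀ i ∈ I, F i ⊆ T) {u : ℝ} (hu0 : 0 ≤ u) (hu1 : u ≤ 1) :
    bexp p T (fun s => ∏ j ∈ I, (1 - u * ind (F j ⊆ s))) ≤
      Real.exp (-u * ∑ i ∈ I, p ^ #(F i) +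
        u ^ 2 * ∑ i ∈ I, ∑ j ∈ I, ind (¬Disjoint (F i) (F j)) * p ^ #(F i ∪ F j)) := by
  classical
  induction I using Finset.induction with
  | empty => simp [bexp_one]
  | insert i I hi ih =>
    have hF' : ∀ j ∈ I, F j ⊆ T := fun j hj => hF j (mem_insert_of_mem hj)
    have ih := ih hF'
    set W : Finset α → ℝ := fun s => ∏ j ∈ I, (1 - u * ind (F j ⊆ s)) with hW
    have hWnn : 0 ≤ bexp p T W := bexp_nonneg hp0 hp1 fun s _ => prod_nonneg fun j _ =>
      one_sub_mul_ind_nonneg _ hu1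
    have key := janson_conditional hp0 hp1 I F hF' (F i) (hF i (mem_insert_self _ _)) hu0 hu1
    set D := ∑ j ∈ I, ind (¬Disjoint (F i) (F j)) * p ^ #(F i ∪ F j) with hD
    set Q := fun i j => ind (¬Disjoint (F i) (F j)) * p ^ #(F i ∪ F j) with hQ
    have hQ0 : ∀ i j, 0 ≤ Q i j := fun i j => mul_nonneg (ind_nonneg _) (pow_nonneg hp0 _)
    have h1 : bexp p T (fun s => ∏ j ∈ insert i I, (1 - u * ind (F j ⊆ s))) =
        bexp p T W - u * bexp p T (fun s => ind (F i ⊆ s) * W s) := by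
      rw [← bexp_const_mul, ← bexp_sub]
      refine bexp_congr fun s _ => ?_
      rw [prod_insert hi]
      ring
    have h2 : bexp p T W - u * bexp p T (fun s => ind (F i ⊆ s) * W s) ≤
        (1 - u * (p ^ #(F i) - u * D)) * bexp p T W := by
      nlinarith [mul_le_mul_of_nonneg_left key hu0]
    have h3 : 1 - u * (p ^ #(F i) - u * D) ≤ Real.exp (-(u * (p ^ #(F i) - u * D))) := by
      linarith [Real.add_one_le_exp (-(u * (p ^ #(F i) - u * D)))]
    have h4 : D + ∑ i ∈ I, ∑ j ∈ I, Q i j ≤ ∑ i' ∈ insert i I, ∑ j ∈ insert i I, Q i' j := by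
      rw [sum_insert hi, sum_insert hi]
      refine add_le_add (le_add_of_nonneg_left (hQ0 _ _)) (sum_le_sum fun k _ => ?_)
      rw [sum_insert hi]
      exact le_add_of_nonneg_left (hQ0 _ _)
    rw [h1]
    calc _ ≤ _ := h2
      _ ≤ Real.exp (-(u * (p ^ #(F i) - u * D))) * Real.exp (-u * ∑ i ∈ I, p ^ #(F i) +
        u ^ 2 * ∑ i ∈ I, ∑ j ∈ I, Q i j) :=
          mul_le_mul h3 ih hWnn (Real.exp_nonneg _)
      _ ≤ _ := by
          rw [← Real.exp_add, Real.exp_le_exp, sum_insert hi]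
          change _ ≤ _ + u ^ 2 * ∑ i' ∈ insert i I, ∑ j ∈ insert i I, Q i' j
          nlinarith [mul_le_mul_of_nonneg_left h4 (sq_nonneg u)]

/-- Janson's inequality for the lower tail. -/
theorem janson (hp0 : 0 ≤ p) (hp1 : p ≤ 1) (I : Finset ι) (F : ι → Finset α)
    (hF : ∀ i ∈ I, F i ⊆ T) {D ε : ℝ} (hD0 : 0 < D)
    (hD : ∑ i ∈ I, ∑ j ∈ I, ind (¬Disjoint (F i) (F j)) * p ^ #(F i ∪ F j) ≤ D)
    (hl : ∑ i ∈ I, p ^ #(F i) ≤ D) (hε0 : 0 ≤ ε) (hε1 : ε ≤ 1) :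
    bprob p T (fun s => ∑ i ∈ I, ind (F i ⊆ s) ≤ (1 - ε) * ∑ i ∈ I, p ^ #(F i)) ≤
      Real.exp (-(ε ^ 2 * (∑ i ∈ I, p ^ #(F i)) ^ 2 / (12 * D))) := by
  set l := ∑ i ∈ I, p ^ #(F i) with hl'
  have hl0 : 0 ≤ l := sum_nonneg fun i _ => pow_nonneg hp0 _
  -- This maximises uεl - 3u²D, the exponent left after all errors of order u² are charged to D.
  set u := ε * l / (6 * D) with hu
  have hu0 : 0 ≤ u := by positivity
  have hu6 : u ≤ 1 / 6 := by
    rw [hu, div_le_div_iff₀ (by positivity) (by norm_num)]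
    nlinarith [mul_le_mul hε1 hl hl0 zero_le_one]
  -- A reverse exponential bound: a small count forces the product of the factors 1 - u·ind to be
  -- large, so Markov's inequality can be applied to the product.
  have base : Real.exp (-(u + 2 * u ^ 2)) ≤ 1 - u := by
    have h1 : 1 - u = (1 - u)⁻¹⁻¹ := (inv_inv _).symm
    have hpos : 0 < 1 - u := by linarith
    rw [h1, Real.exp_neg]
    refine inv_anti₀ (inv_pos.2 hpos) ?_
    have h2 : (1 - u)⁻¹ ≤ 1 + (u + 2 * u ^ 2) := by
      rw [inv_le_iff_one_le_mul₀ hpos]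
      nlinarith [mul_nonneg (mul_nonneg hu0 hu0) (by linarith : (0:ℝ) ≤ 1 - 2 * u)]
    linarith [Real.add_one_le_exp (u + 2 * u ^ 2)]
  have hfac : ∀ P : Prop, Real.exp (-(u + 2 * u ^ 2) * ind P) ≤ 1 - u * ind P := by
    intro P
    by_cases h : P
    · simpa [ind_of h] using base
    · simp [ind_of_not h]
  set t := Real.exp (-(u + 2 * u ^ 2) * ((1 - ε) * l)) with ht
  have hev : bprob p T (fun s => ∑ i ∈ I, ind (F i ⊆ s) ≤ (1 - ε) * l) ≤
      bprob p T (fun s => t ≤ ∏ j ∈ I, (1 - u * ind (F j ⊆ s))) := by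
    refine bprob_mono hp0 hp1 fun s _ hs => ?_
    calc t ≤ Real.exp (-(u + 2 * u ^ 2) * ∑ i ∈ I, ind (F i ⊆ s)) := by
          rw [ht, Real.exp_le_exp]
          nlinarith [mul_le_mul_of_nonneg_left hs (by positivity : 0 ≤ u + 2 * u ^ 2)]
      _ = ∏ i ∈ I, Real.exp (-(u + 2 * u ^ 2) * ind (F i ⊆ s)) := by
          rw [mul_sum, Real.exp_sum]
      _ ≤ _ := prod_le_prod (fun i _ => Real.exp_nonneg _) fun i _ => hfac _
  refine hev.trans ((bprob_le_div hp0 hp1 (fun s _ => prod_nonneg fun j _ =>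
    one_sub_mul_ind_nonneg _ (by linarith)) (Real.exp_pos _)).trans ?_)
  rw [div_le_iff₀ (Real.exp_pos _), ← Real.exp_add]
  refine (bexp_prod_one_sub_le hp0 hp1 I F hF hu0 (by linarith)).trans ?_
  rw [Real.exp_le_exp]
  have h1 := mul_le_mul_of_nonneg_left hD (sq_nonneg u)
  have h2 : u ^ 2 * l ≤ u ^ 2 * D := mul_le_mul_of_nonneg_left hl (sq_nonneg u)
  have h3 : ε ^ 2 * l ^ 2 / (12 * D) = u * ε * l - 3 * u ^ 2 * D := by
    rw [hu]; field_simp; ring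
  rw [h3]
  have h4 : 0 ≤ u ^ 2 * (ε * l) := by positivity
  nlinarith

/-! ### Moments through admissible sequences of present sets -/

/-- The number of sequences of `r` indices that extend the list `l`, such that each new index is
admissible after the previous ones and its set is contained in `s`. -/
noncomputable def chains (I : Finset ι) (F : ι → Finset α) (adm : List ι → ι → Prop) :
    ℕ → List ι → Finset α → ℝ
  | 0, _, _ => 1
  | r + 1, l, s => ∑ i ∈ I, ind (adm l i ∧ F i ⊆ s) * chains I F adm r (i :: l) s

theorem chains_nonneg (I : Finset ι) (F : ι → Finset α) (adm : List ι → ι → Prop) (r : ℕ)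
    (l : List ι) (s : Finset α) : 0 ≤ chains I F adm r l s := by
  induction r generalizing l with
  | zero => exact zero_le_one
  | succ r ih => exact sum_nonneg fun i _ => mul_nonneg (ind_nonneg _) (ih _)

/-- The union of the sets with indices in a list. -/
def listUnion (F : ι → Finset α) : List ι → Finset α
  | [] => ∅
  | i :: l => F i ∪ listUnion F l

theorem subset_listUnion {F : ι → Finset α} {l : List ι} {i : ι} (hi : i ∈ l) :
    F i ⊆ listUnion F l := by
  induction l with
  | nil => cases hi
  | cons j l ih =>
    rcases List.mem_cons.1 hi with rfl | h
    · exact subset_union_left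
    · exact (ih h).trans subset_union_right

theorem mem_listUnion {F : ι → Finset α} {l : List ι} {a : α} :
    a ∈ listUnion F l ↔ ∃ i ∈ l, a ∈ F i := by
  induction l with
  | nil => simp [listUnion]
  | cons j l ih => simp [listUnion, ih]

/-- Given that the sets of the list are present, a further set only costs its new elements. So each
step contributes a factor of at most `M`, whatever the history. -/
theorem bexp_ind_mul_chains_le (hp0 : 0 ≤ p) (I : Finset ι) (F : ι → Finset α)
    (hF : ∀ i ∈ I, F i ⊆ T) (adm : List ι → ι → Prop) {R : ℕ} {M : ℝ}
    (hM : ∀ l : List ι, l.length < R → (∀ i ∈ l, i ∈ I) →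
      ∑ i ∈ I, ind (adm l i) * p ^ #(F i \ listUnion F l) ≤ M)
    (r : ℕ) (l : List ι) (hl : ∀ i ∈ l, i ∈ I) (hr : l.length + r ≤ R) :
    bexp p T (fun s => ind (listUnion F l ⊆ s) * chains I F adm r l s) ≤
      p ^ #(listUnion F l) * M ^ r := by
  have hsub : ∀ l : List ι, (∀ i ∈ l, i ∈ I) → listUnion F l ⊆ T := by
    intro l hl a ha
    obtain ⟨i, hi, hai⟩ := mem_listUnion.1 ha
    exact hF i (hl i hi) hai
  induction r generalizing l with
  | zero =>
    simp only [chains, mul_one, pow_zero]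
    exact (bprob_subset (hsub l hl)).le
  | succ r ih =>
    have hM0 : 0 ≤ M := (sum_nonneg fun i _ => mul_nonneg (ind_nonneg _) (pow_nonneg hp0 _)).trans
      (hM l (by omega) hl)
    calc bexp p T (fun s => ind (listUnion F l ⊆ s) * chains I F adm (r + 1) l s)
        = ∑ i ∈ I, ind (adm l i) * bexp p T (fun s => ind (listUnion F (i :: l) ⊆ s) *
            chains I F adm r (i :: l) s) := by
          rw [← funext fun i => bexp_const_mul _, ← bexp_sum]
          refine bexp_congr fun s _ => ?_
          rw [chains, mul_sum]
          refine sum_congr rfl fun i _ => ?_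
          rw [listUnion, ind_congr (union_subset_iff (s := F i)), ind_and, ind_and]
          ring
      _ ≤ ∑ i ∈ I, ind (adm l i) * (p ^ #(listUnion F (i :: l)) * M ^ r) := by
          refine sum_le_sum fun i hi => mul_le_mul_of_nonneg_left ?_ (ind_nonneg _)
          refine ih (i :: l) (fun j hj => ?_) (by simp; omega)
          rcases List.mem_cons.1 hj with rfl | h
          · exact hi
          · exact hl j h
      _ = p ^ #(listUnion F l) * M ^ r *
            ∑ i ∈ I, ind (adm l i) * p ^ #(F i \ listUnion F l) := by
          rw [mul_sum]
          refine sum_congr rfl fun i _ => ?_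
          rw [listUnion, ← sdiff_union_self_eq_union, card_union_of_disjoint sdiff_disjoint, pow_add]
          ring
      _ ≤ p ^ #(listUnion F l) * M ^ r * M :=
          mul_le_mul_of_nonneg_left (hM l (by omega) hl) (by positivity)
      _ = _ := by ring

/-- The expected number of admissible sequences of `r` sets. -/
theorem bexp_chains_le (hp0 : 0 ≤ p) (I : Finset ι) (F : ι → Finset α)
    (hF : ∀ i ∈ I, F i ⊆ T) (adm : List ι → ι → Prop) {r : ℕ} {M : ℝ}
    (hM : ∀ l : List ι, l.length < r → (∀ i ∈ l, i ∈ I) →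
      ∑ i ∈ I, ind (adm l i) * p ^ #(F i \ listUnion F l) ≤ M) :
    bexp p T (chains I F adm r []) ≤ M ^ r := by
  have := bexp_ind_mul_chains_le hp0 I F hF adm hM r [] (by simp) (by simp)
  simpa [listUnion, ind_of] using this

/-- Without a restriction on the sequences, `chains` yields the ordinary r-th moment of the count;
disjointness and overlap conditions give restricted moments. -/
theorem chains_true (I : Finset ι) (F : ι → Finset α) (r : ℕ) (l : List ι) (s : Finset α) :
    chains I F (fun _ _ => True) r l s = (∑ i ∈ I, ind (F i ⊆ s)) ^ r := by
  induction r generalizing l with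
  | zero => simp [chains]
  | succ r ih => simp only [chains, ih, true_and, ← sum_mul]; ring

/-- Upper tail estimate by the `r`-th moment. -/
theorem bprob_upper_le_pow (hp0 : 0 ≤ p) (hp1 : p ≤ 1) (I : Finset ι) (F : ι → Finset α)
    (hF : ∀ i ∈ I, F i ⊆ T) (r : ℕ) {M t : ℝ} (ht : 0 < t)
    (hM : ∀ l : List ι, l.length < r → (∀ i ∈ l, i ∈ I) →
      ∑ i ∈ I, p ^ #(F i \ listUnion F l) ≤ M) :
    bprob p T (fun s => t ≤ ∑ i ∈ I, ind (F i ⊆ s)) ≤ (M / t) ^ r := by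
  have h := bexp_chains_le hp0 I F hF (fun _ _ => True) (r := r) (M := M) fun l h1 h2 => by
    simpa [ind_of] using hM l h1 h2
  simp only [funext (chains_true I F r [])] at h
  calc _ ≤ bprob p T (fun s => t ^ r ≤ (∑ i ∈ I, ind (F i ⊆ s)) ^ r) :=
        bprob_mono hp0 hp1 fun s _ hs => pow_le_pow_left₀ ht.le hs r
    _ ≤ _ := bprob_le_div hp0 hp1
        (fun s _ => pow_nonneg (sum_nonneg fun i _ => ind_nonneg _) _) (pow_pos ht r)
    _ ≤ _ := by rw [div_pow]; gcongr

/-- If many pairwise disjoint sets are present, then there are many sequences of disjoint sets. -/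
theorem pow_le_chains_disjoint (I : Finset (Finset α)) (R m : ℕ) (s : Finset α)
    (D : Finset (Finset α)) (hDI : D ⊆ I) (hDs : ∀ S ∈ D, S ⊆ s)
    (hdis : ∀ S ∈ D, ∀ S' ∈ D, S ≠ S' → Disjoint S S') (hm : m + R ≤ #D) (r : ℕ)
    (l : List (Finset α)) (hl : ∀ S ∈ l, S ∈ D) (hr : l.length + r ≤ R) :
    (m : ℝ) ^ r ≤ chains I id (fun l S => Disjoint S (listUnion id l)) r l s := by
  induction r generalizing l with
  | zero => simp [chains]
  | succ r ih =>
    rw [chains]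
    -- Fewer than `R` of the at least `m + R` sets have been used, so at least `m` choices remain at
    -- each step.
    have hcard : m ≤ #(D \ l.toFinset) := by
      have h1 := le_card_sdiff l.toFinset D
      have h2 := l.toFinset_card_le
      omega
    have hadm : ∀ S ∈ D \ l.toFinset, Disjoint S (listUnion id l) ∧ id S ⊆ s := by
      intro S hS
      rw [Finset.mem_sdiff, List.mem_toFinset] at hS
      refine ⟨?_, hDs S hS.1⟩
      rw [disjoint_right]
      intro a ha
      obtain ⟨S', hS', haS⟩ := mem_listUnion.1 ha
      exact disjoint_left.1 (hdis S' (hl S' hS') S hS.1 fun h => hS.2 (h ▸ hS')) haS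
    calc (m : ℝ) ^ (r + 1) = m * (m : ℝ) ^ r := pow_succ' _ _
      _ ≤ #(D \ l.toFinset) * (m : ℝ) ^ r := by gcongr
      _ = ∑ _S ∈ D \ l.toFinset, (m : ℝ) ^ r := by simp
      _ ≤ ∑ S ∈ D \ l.toFinset, ind (Disjoint S (listUnion id l) ∧ id S ⊆ s) *
            chains I id (fun l S => Disjoint S (listUnion id l)) r (S :: l) s := by
          refine sum_le_sum fun S hS => ?_
          rw [ind_of (hadm S hS), one_mul]
          refine ih _ (fun S' hS' => ?_) (by simp; omega)
          rcases List.mem_cons.1 hS' with rfl | h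
          · exact (Finset.mem_sdiff.1 hS).1
          · exact hl S' h
      _ ≤ _ := sum_le_sum_of_subset_of_nonneg (sdiff_subset.trans hDI) fun S _ _ =>
          mul_nonneg (ind_nonneg _) (chains_nonneg _ _ _ _ _ _)

/-- It is unlikely that there are many pairwise disjoint sets. -/
theorem bprob_disjoint_family_le (hp0 : 0 ≤ p) (hp1 : p ≤ 1) (I : Finset (Finset α))
    (hI : ∀ S ∈ I, S ⊆ T) (m r : ℕ) (hm : 0 < m) :
    bprob p T (fun s => ∃ D ⊆ I, (∀ S ∈ D, S ⊆ s) ∧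
      (∀ S ∈ D, ∀ S' ∈ D, S ≠ S' → Disjoint S S') ∧ m + r ≤ #D) ≤
      ((∑ S ∈ I, p ^ #S) / m) ^ r := by
  have h := bexp_chains_le hp0 I id hI (fun l S => Disjoint S (listUnion id l)) (r := r)
    (M := ∑ S ∈ I, p ^ #S) fun l _ _ => by
      refine sum_le_sum fun S _ => ?_
      by_cases hd : Disjoint S (listUnion id l)
      · rw [ind_of hd, one_mul, id, sdiff_eq_self_of_disjoint hd]
      · rw [ind_of_not hd, zero_mul]; exact pow_nonneg hp0 _
  have hm' : (0 : ℝ) < m := by exact_mod_cast hm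
  calc _ ≤ bprob p T (fun s => (m : ℝ) ^ r ≤
          chains I id (fun l S => Disjoint S (listUnion id l)) r [] s) := by
        refine bprob_mono hp0 hp1 ?_
        rintro s - ⟨D, hDI, hDs, hdis, hc⟩
        exact pow_le_chains_disjoint I r m s D hDI hDs hdis hc r [] (by simp) (by simp)
    _ ≤ _ := bprob_le_div hp0 hp1 (fun s _ => chains_nonneg _ _ _ _ _ _) (pow_pos hm' r)
    _ ≤ _ := by rw [div_pow]; gcongr

/-- If every short list of present sets can be extended, then there is a long admissible list. -/
theorem one_le_chains (I : Finset ι) (F : ι → Finset α) (adm : List ι → ι → Prop) (R : ℕ)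
    (s : Finset α) (h : ∀ l : List ι, l.length < R → (∀ i ∈ l, i ∈ I ∧ F i ⊆ s) →
      ∃ i ∈ I, adm l i ∧ F i ⊆ s) (r : ℕ) (l : List ι) (hl : ∀ i ∈ l, i ∈ I ∧ F i ⊆ s)
    (hr : l.length + r ≤ R) : 1 ≤ chains I F adm r l s := by
  induction r generalizing l with
  | zero => simp [chains]
  | succ r ih =>
    obtain ⟨i, hi, hadm⟩ := h l (by omega) hl
    have h1 := ih (i :: l) (fun j hj => by
      rcases List.mem_cons.1 hj with rfl | h
      · exact ⟨hi, hadm.2⟩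
      · exact hl j h) (by simp; omega)
    rw [chains]
    refine h1.trans ?_
    have := single_le_sum (f := fun i => ind (adm l i ∧ F i ⊆ s) * chains I F adm r (i :: l) s)
      (fun j _ => mul_nonneg (ind_nonneg _) (chains_nonneg I F adm r (j :: l) s)) hi
    simpa [ind_of hadm] using this

/-- If long admissible lists are unlikely, then so is it that every short list extends. -/
theorem bprob_extendable_le (hp0 : 0 ≤ p) (hp1 : p ≤ 1) (I : Finset ι) (F : ι → Finset α)
    (hF : ∀ i ∈ I, F i ⊆ T) (adm : List ι → ι → Prop) {r : ℕ} {M : ℝ}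
    (hM : ∀ l : List ι, l.length < r → (∀ i ∈ l, i ∈ I) →
      ∑ i ∈ I, ind (adm l i) * p ^ #(F i \ listUnion F l) ≤ M) :
    bprob p T (fun s => ∀ l : List ι, l.length < r → (∀ i ∈ l, i ∈ I ∧ F i ⊆ s) →
      ∃ i ∈ I, adm l i ∧ F i ⊆ s) ≤ M ^ r := by
  calc _ ≤ bprob p T (fun s => 1 ≤ chains I F adm r [] s) :=
        bprob_mono hp0 hp1 fun s _ hs => one_le_chains I F adm r s hs r [] (by simp) (by simp)
    _ ≤ bexp p T (chains I F adm r []) / 1 :=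
        bprob_le_div hp0 hp1 (fun s _ => chains_nonneg _ _ _ _ _ _) one_pos
    _ ≤ _ := by rw [div_one]; exact bexp_chains_le hp0 I F hF adm hM

/-! ### Lower bounds for probabilities and the second moment method -/

theorem exp_neg_le_one_sub {q P : ℝ} (h0 : 0 ≤ q) (hq : q ≤ P) (hP : P ≤ 1 / 2) :
    Real.exp (-(q * (1 + 2 * P))) ≤ 1 - q := by
  have hpos : 0 < 1 - q := by linarith
  have h1 : 1 - q = (1 - q)⁻¹⁻¹ := (inv_inv _).symm
  rw [h1, Real.exp_neg]
  refine inv_anti₀ (inv_pos.2 hpos) ?_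
  have h2 : (1 - q)⁻¹ ≤ 1 + q * (1 + 2 * P) := by
    rw [inv_le_iff_one_le_mul₀ hpos]
    nlinarith [mul_nonneg h0 (by linarith : (0:ℝ) ≤ P - q), mul_nonneg h0 h0,
      mul_nonneg (mul_nonneg h0 h0) (by linarith : (0:ℝ) ≤ 1 / 2 - P),
      mul_nonneg h0 (by linarith : (0:ℝ) ≤ 1 / 2 - P)]
  linarith [Real.add_one_le_exp (q * (1 + 2 * P))]

/-- The probability that exactly the sets of a family are present. -/
theorem le_bprob_filter_eq (hp0 : 0 ≤ p) (hp1 : p ≤ 1 / 2) (I t : Finset (Finset α))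
    (hI : ∀ S ∈ I, S ⊆ T) (ht : t ⊆ I) {L : ℝ}
    (hL : ∑ S ∈ I \ t, p ^ #(S \ t.biUnion id) ≤ L) (hpL : p * L ≤ 1)
    (hns : ∀ S ∈ I \ t, ¬S ⊆ t.biUnion id) :
    p ^ #(t.biUnion id) * Real.exp (-(L + 2)) ≤ bprob p T fun s => I.filter (· ⊆ s) = t := by
  have hp1' : p ≤ 1 := by linarith
  set U := t.biUnion id with hU
  have hUT : U ⊆ T := biUnion_subset.2 fun S hS => hI S (ht hS)
  -- Require all of `U` and exclude every other set. After conditioning on `U`, the exclusions are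
  -- decreasing events, so Harris' inequality bounds their joint probability below by the product.
  have h1 : bexp p T (fun s => ind (U ⊆ s) * ∏ S ∈ I \ t, (1 - 1 * ind (S ⊆ s))) ≤
      bprob p T fun s => I.filter (· ⊆ s) = t := by
    refine bexp_mono hp0 hp1' fun s _ => ?_
    by_cases hUs : U ⊆ s
    · by_cases hx : ∃ S ∈ I \ t, S ⊆ s
      · obtain ⟨S, hS, hSs⟩ := hx
        rw [prod_eq_zero hS (by rw [ind_of hSs]; norm_num), mul_zero]
        exact ind_nonneg _
      · push Not at hx
        rw [ind_of (P := I.filter (· ⊆ s) = t)]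
        · refine mul_le_one₀ (ind_le_one _) (prod_nonneg fun S _ =>
            one_sub_mul_ind_nonneg _ le_rfl) (prod_le_one (fun S _ =>
            one_sub_mul_ind_nonneg _ le_rfl) fun S _ => ?_)
          linarith [ind_nonneg (S ⊆ s)]
        · ext S
          rw [mem_filter]
          refine ⟨fun h => ?_, fun h => ⟨ht h, (subset_biUnion_of_mem id h).trans hUs⟩⟩
          by_contra hSt
          exact hx S (Finset.mem_sdiff.2 ⟨h.1, hSt⟩) h.2
    · rw [ind_of_not hUs, zero_mul]; exact ind_nonneg _
  refine le_trans ?_ h1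
  rw [bexp_ind_subset_mul hUT]
  refine mul_le_mul_of_nonneg_left ?_ (pow_nonneg hp0 _)
  have h2 : ∀ s S : Finset α, ind (S ⊆ s ∪ U) = ind (S \ U ⊆ s) := fun s S =>
    ind_congr (by rw [union_comm]; exact sdiff_le_iff.symm)
  simp only [h2]
  refine le_trans ?_ (prod_le_bexp_prod hp0 hp1' _ _ (fun S _ =>
    antitone_one_sub_ind_subset (S \ U) zero_le_one) fun S _ s => one_sub_mul_ind_nonneg _ le_rfl)
  have h3 : ∀ S ∈ I \ t, bexp p T (fun s => 1 - 1 * ind (S \ U ⊆ s)) = 1 - p ^ #(S \ U) := by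
    intro S hS
    rw [bexp_sub, bexp_one]
    simp only [one_mul]
    rw [show bexp p T (fun s => ind (S \ U ⊆ s)) = p ^ #(S \ U) from
      bprob_subset (sdiff_subset.trans (hI S (Finset.mem_sdiff.1 hS).1))]
  rw [prod_congr rfl h3]
  have h4 : ∀ S ∈ I \ t, Real.exp (-(p ^ #(S \ U) * (1 + 2 * p))) ≤ 1 - p ^ #(S \ U) := by
    intro S hS
    refine exp_neg_le_one_sub (pow_nonneg hp0 _) ?_ hp1
    have : #(S \ U) ≠ 0 := by
      rw [Ne, card_eq_zero, sdiff_eq_empty_iff_subset]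
      exact hns S hS
    exact pow_le_of_le_one hp0 hp1' this
  refine le_trans ?_ (prod_le_prod (fun S _ => Real.exp_nonneg _) h4)
  rw [← Real.exp_sum, Real.exp_le_exp, sum_neg_distrib, ← sum_mul, neg_le_neg_iff]
  -- Every excluded set needs an element outside `U`, so its conditional probability is at most `p`.
  -- The relative error 2p in the exponent adds at most 2pL ≤ 2, whence `L + 2`.
  have h5 := mul_le_mul_of_nonneg_right hL (by linarith : 0 ≤ 1 + 2 * p)
  linarith

/-- A lower bound for the probability that at least `z` of the sets are present. -/
theorem le_bprob_card_ge (hp0 : 0 ≤ p) (hp1 : p ≤ 1 / 2) (I : Finset (Finset α))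
    (hI : ∀ S ∈ I, S ⊆ T) (Fam : Finset (Finset (Finset α))) (z m : ℕ) {L : ℝ}
    (hpL : p * L ≤ 1) (hFam : ∀ t ∈ Fam, t ⊆ I ∧ #t = z ∧ #(t.biUnion id) ≤ m ∧
      ∑ S ∈ I \ t, p ^ #(S \ t.biUnion id) ≤ L ∧ ∀ S ∈ I \ t, ¬S ⊆ t.biUnion id) :
    #Fam * (p ^ m * Real.exp (-(L + 2))) ≤ bprob p T fun s => z ≤ #(I.filter (· ⊆ s)) := by
  have hp1' : p ≤ 1 := by linarith
  calc #Fam * (p ^ m * Real.exp (-(L + 2)))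
      = ∑ _t ∈ Fam, p ^ m * Real.exp (-(L + 2)) := by simp
    _ ≤ ∑ t ∈ Fam, bprob p T fun s => I.filter (· ⊆ s) = t := by
        refine sum_le_sum fun t ht => ?_
        obtain ⟨h1, h2, h3, h4, h5⟩ := hFam t ht
        refine le_trans ?_ (le_bprob_filter_eq hp0 hp1 I t hI h1 h4 hpL h5)
        exact mul_le_mul_of_nonneg_right (pow_le_pow_of_le_one hp0 hp1' h3) (Real.exp_nonneg _)
    -- Specifying exactly which sets are present makes the events mutually exclusive, so no
    -- probability is counted twice.
    _ = bexp p T fun s => ∑ t ∈ Fam, ind (I.filter (· ⊆ s) = t) := (bexp_sum _ _).symm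
    _ ≤ _ := by
        refine bexp_mono hp0 hp1' fun s _ => ?_
        by_cases h : I.filter (· ⊆ s) ∈ Fam
        · rw [sum_eq_single_of_mem _ h fun t _ ht => ind_of_not (Ne.symm ht), ind_of rfl,
            ind_of (hFam _ h).2.1.ge]
        · rw [sum_eq_zero fun t ht => ind_of_not fun h' => h (by rwa [h'])]
          exact ind_nonneg _

/-- The second moment method for events that are nearly pairwise negatively correlated. -/
theorem bprob_forall_not_le (hp0 : 0 ≤ p) (hp1 : p ≤ 1) (I : Finset ι) (A : ι → Finset α → Prop)
    {q η : ℝ} (hq : 0 < q) (hη : 0 ≤ η) (hI : 0 < #I) (hA : ∀ i ∈ I, q ≤ bprob p T (A i))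
    (hAA : ∀ i ∈ I, ∀ j ∈ I, i ≠ j →
      bprob p T (fun s => A i s ∧ A j s) ≤ bprob p T (A i) * bprob p T (A j) + η) :
    bprob p T (fun s => ∀ i ∈ I, ¬A i s) ≤ 1 / (#I * q) + η / q ^ 2 := by
  classical
  set N : ℝ := ((#I : ℕ) : ℝ) with hN
  have hN0 : 0 < N := by rw [hN]; exact_mod_cast hI
  set m := ∑ i ∈ I, bprob p T (A i) with hm
  have hNm : N * q ≤ m := by
    have := card_nsmul_le_sum I (fun i => bprob p T (A i)) q hA
    simpa using this
  have hm0 : 0 < m := lt_of_lt_of_le (by positivity) hNm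
  set Z : Finset α → ℝ := fun s => ∑ i ∈ I, ind (A i s) with hZ
  have hEZ : bexp p T Z = m := bexp_sum _ _
  -- The diagonal contributes m, the other pairs at most m² + N²η. The variance is therefore at most
  -- m + N²η.
  have hEZ2 : bexp p T (fun s => Z s ^ 2) ≤ m + m ^ 2 + N ^ 2 * η := by
    have h1 : ∀ s, Z s ^ 2 = ∑ i ∈ I, ∑ j ∈ I, ind (A i s ∧ A j s) := by
      intro s
      rw [hZ, sq, sum_mul_sum]
      exact sum_congr rfl fun i _ => sum_congr rfl fun j _ => (ind_and _ _).symm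
    simp only [h1]
    rw [bexp_sum]
    have h2 : ∀ i ∈ I, bexp p T (fun s => ∑ j ∈ I, ind (A i s ∧ A j s)) ≤
        bprob p T (A i) + ∑ j ∈ I, (bprob p T (A i) * bprob p T (A j) + η) := by
      intro i hi
      rw [bexp_sum, ← add_sum_erase I _ hi]
      refine add_le_add (bexp_mono hp0 hp1 fun s _ => ind_mono fun h => h.1) ?_
      refine (sum_le_sum fun j hj => hAA i hi j (mem_of_mem_erase hj)
        (ne_of_mem_erase hj).symm).trans ?_
      exact sum_le_sum_of_subset_of_nonneg (erase_subset _ _) fun j _ _ =>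
        add_nonneg (mul_nonneg (bprob_nonneg hp0 hp1 _) (bprob_nonneg hp0 hp1 _)) hη
    refine (sum_le_sum h2).trans (le_of_eq ?_)
    simp only [sum_add_distrib, ← mul_sum, ← sum_mul, sum_const, nsmul_eq_mul]
    rw [← hm, ← hN]
    ring
  have hvar : bexp p T (fun s => (Z s - m) ^ 2) ≤ m + N ^ 2 * η := by
    have : bexp p T (fun s => (Z s - m) ^ 2) =
        bexp p T (fun s => Z s ^ 2) - 2 * m * bexp p T Z + bexp p T fun _ => m ^ 2 := by
      rw [← bexp_const_mul, ← bexp_sub, ← bexp_add]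
      exact bexp_congr fun s _ => by ring
    rw [bexp_const] at this
    rw [this, hEZ]
    nlinarith
  calc bprob p T (fun s => ∀ i ∈ I, ¬A i s)
      ≤ bprob p T (fun s => m ^ 2 ≤ (Z s - m) ^ 2) := by
        refine bprob_mono hp0 hp1 fun s _ hs => ?_
        have : Z s = 0 := sum_eq_zero fun i hi => ind_of_not (hs i hi)
        rw [this]
        exact le_of_eq (by ring)
    _ ≤ (m + N ^ 2 * η) / m ^ 2 := (bprob_le_div hp0 hp1 (fun s _ => sq_nonneg _)
        (by positivity)).trans (by gcongr)
    _ = 1 / m + N ^ 2 * η / m ^ 2 := by field_simp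
    _ ≤ 1 / (N * q) + N ^ 2 * η / (N * q) ^ 2 := by gcongr
    _ = _ := by field_simp

end BernoulliSubset
-- Embeddings with prescribed roots
namespace RootedExtension

open Finset BernoulliSubset

variable {κ V : Type*} [Fintype κ] [Fintype V] {n : ℕ}

/-- The vertices that are not roots. -/
noncomputable def free (root : κ ↪ V) : Finset V := by
  classical exact univ.filter fun v => v ∉ Set.range root

/-- The embeddings that map the roots to a given tuple. -/
noncomputable def embs (root : κ ↪ V) (x : κ ↪ Fin n) : Finset (V ↪ Fin n) := by
  classical exact univ.filter fun φ => ∀ j, φ (root j) = x j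

/-- The number of edges inside the union of the roots and `A`. -/
noncomputable def edgesIn (root : κ ↪ V) (E : Finset (Sym2 V)) (A : Finset V) : ℕ := by
  classical exact #(E.filter fun e => ∀ v ∈ e, v ∈ A ∨ v ∈ Set.range root)

/-- The image of a set of edges under an embedding. -/
def im (φ : V ↪ Fin n) (E : Finset (Sym2 V)) : Finset (Sym2 (Fin n)) := E.map φ.sym2Map

/-- The edges of the complete graph. -/
def allEdges (n : ℕ) : Finset (Sym2 (Fin n)) := univ.filter fun e => ¬e.IsDiag

/-- A set of edges none of which is a loop or joins two roots. -/
structure IsExtEdges (root : κ ↪ V) (E : Finset (Sym2 V)) : Prop where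
  not_isDiag : ∀ e ∈ E, ¬e.IsDiag
  exists_free : ∀ e ∈ E, ∃ v ∈ e, v ∉ Set.range root

/-- The number of embeddings that extend `x` and map `E` into `s`. -/
noncomputable def embCount (root : κ ↪ V) (E : Finset (Sym2 V)) (x : κ ↪ Fin n)
    (s : Finset (Sym2 (Fin n))) : ℝ :=
  ∑ φ ∈ embs root x, ind (im φ E ⊆ s)

/-- The number of embeddings of the vertices that extend a tuple of roots. -/
noncomputable def numEmbs (root : κ ↪ V) (n : ℕ) : ℕ :=
  (n - Fintype.card κ).descFactorial #(free root)

/-- The expectation of `embCount`. -/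
noncomputable def embMean (root : κ ↪ V) (E : Finset (Sym2 V)) (n : ℕ) (p : ℝ) : ℝ :=
  numEmbs root n * p ^ #E

theorem mem_free {root : κ ↪ V} {v : V} : v ∈ free root ↔ v ∉ Set.range root := by
  simp [free]

theorem mem_embs {root : κ ↪ V} {x : κ ↪ Fin n} {φ : V ↪ Fin n} :
    φ ∈ embs root x ↔ ∀ j, φ (root j) = x j := by
  simp [embs]

theorem card_im (φ : V ↪ Fin n) (E : Finset (Sym2 V)) : #(im φ E) = #E := card_map _

theorem mem_im {φ : V ↪ Fin n} {E : Finset (Sym2 V)} {e : Sym2 (Fin n)} :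
    e ∈ im φ E ↔ ∃ d ∈ E, d.map φ = e := by
  simp [im, Function.Embedding.sym2Map]

theorem map_mem_im {φ : V ↪ Fin n} {E : Finset (Sym2 V)} {d : Sym2 V} (hd : d ∈ E) :
    d.map φ ∈ im φ E := mem_im.2 ⟨d, hd, rfl⟩

theorem im_subset_allEdges {root : κ ↪ V} {E : Finset (Sym2 V)} (hE : IsExtEdges root E)
    (φ : V ↪ Fin n) : im φ E ⊆ allEdges n := by
  intro e he
  obtain ⟨d, hd, rfl⟩ := mem_im.1 he
  simp only [allEdges, mem_filter, mem_univ, true_and]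
  rw [Sym2.isDiag_map φ.injective]
  exact hE.not_isDiag d hd

theorem card_free (root : κ ↪ V) : #(free root) + Fintype.card κ = Fintype.card V := by
  classical
  have h : free root = (univ.map root)ᶜ := by
    ext v; simp [mem_free]
  rw [h, card_compl, card_map, card_univ]
  exact Nat.sub_add_cancel (Fintype.card_le_of_embedding root)

theorem card_free_le (root : κ ↪ V) : #(free root) ≤ Fintype.card V := card_le_univ _

theorem edgesIn_free {root : κ ↪ V} (E : Finset (Sym2 V)) : edgesIn root E (free root) = #E := by
  classical
  rw [edgesIn, filter_true_of_mem]
  intro e _ v _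
  by_cases h : v ∈ Set.range root
  · exact Or.inr h
  · exact Or.inl (mem_free.2 h)

theorem edgesIn_le (root : κ ↪ V) (E : Finset (Sym2 V)) (A : Finset V) : edgesIn root E A ≤ #E := by
  classical exact card_filter_le _ _

theorem edgesIn_empty {root : κ ↪ V} {E : Finset (Sym2 V)} (hE : IsExtEdges root E) :
    edgesIn root E ∅ = 0 := by
  classical
  rw [edgesIn, card_eq_zero, filter_eq_empty_iff]
  intro e he h
  obtain ⟨v, hv, hvr⟩ := hE.exists_free e he
  rcases h v hv with h | h
  · simp at h
  · exact hvr h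

theorem card_embs (root : κ ↪ V) (x : κ ↪ Fin n) : #(embs root x) = numEmbs root n := by
  classical
  have e : {φ : V ↪ Fin n // ∀ j, φ (root j) = x j} ≃
      ({v : V // v ∈ free root} ↪ {a : Fin n // a ∈ (univ.map x)ᶜ}) :=
    { toFun := fun φ => ⟨fun v => ⟨φ.1 v, by
        rw [mem_compl, Finset.mem_map]
        rintro ⟨j, -, hj⟩
        rw [← φ.2 j] at hj
        exact mem_free.1 v.2 ⟨j, φ.1.injective hj⟩⟩, fun v w h =>
          Subtype.ext (φ.1.injective (congrArg Subtype.val h))⟩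
      invFun := fun f => ⟨⟨fun v => if h : ∃ j, root j = v then x h.choose else
          (f ⟨v, mem_free.2 h⟩ : Fin n), by
          intro v w hvw
          have hf : ∀ (j : κ) v (h : v ∈ free root), x j ≠ (f ⟨v, h⟩ : Fin n) := by
            intro j v h hj
            exact mem_compl.1 (f ⟨v, h⟩).2 (Finset.mem_map.2 ⟨j, mem_univ _, hj⟩)
          by_cases hv : ∃ j, root j = v <;> by_cases hw : ∃ j, root j = w
          · simp only [dif_pos hv, dif_pos hw] at hvw
            rw [← hv.choose_spec, ← hw.choose_spec, x.injective hvw]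
          · simp only [dif_pos hv, dif_neg hw] at hvw
            exact absurd hvw (hf _ _ _)
          · simp only [dif_neg hv, dif_pos hw] at hvw
            exact absurd hvw.symm (hf _ _ _)
          · simp only [dif_neg hv, dif_neg hw] at hvw
            have := f.injective (Subtype.ext hvw)
            exact congrArg Subtype.val this⟩, fun j => by
          have h : ∃ i, root i = root j := ⟨j, rfl⟩
          change (if h : ∃ i, root i = root j then _ else _) = _
          rw [dif_pos h, root.injective h.choose_spec]⟩
      left_inv := fun φ => by
        ext v
        change ((if h : ∃ j, root j = v then x h.choose else φ.1 v : Fin n) : ℕ) = _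
        by_cases h : ∃ j, root j = v
        · rw [dif_pos h, ← φ.2, h.choose_spec]
        · rw [dif_neg h]
      right_inv := fun f => by
        ext v
        have h : ¬∃ j, root j = v.1 := mem_free.1 v.2
        change ((if h : ∃ j, root j = v.1 then x h.choose else _ : Fin n) : ℕ) = _
        rw [dif_neg h] }
  have h1 : #(embs root x) = Fintype.card {φ : V ↪ Fin n // ∀ j, φ (root j) = x j} := by
    rw [Fintype.card_subtype]
    congr 1
  rw [h1, Fintype.card_congr e, Fintype.card_embedding_eq, Fintype.card_coe, Fintype.card_coe,
    card_compl, card_map, card_univ, Fintype.card_fin, numEmbs]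

theorem numEmbs_le (root : κ ↪ V) (n : ℕ) : (numEmbs root n : ℝ) ≤ (n : ℝ) ^ #(free root) := by
  have h := (Nat.descFactorial_le_pow (n - Fintype.card κ) #(free root)).trans
    (Nat.pow_le_pow_left (Nat.sub_le n (Fintype.card κ)) _)
  exact_mod_cast h

/-- Each factor of the falling factorial is at least n/2. -/
theorem le_numEmbs (root : κ ↪ V) (hn : 2 * Fintype.card V ≤ n) :
    (n : ℝ) ^ #(free root) ≤ 2 ^ Fintype.card V * numEmbs root n := by
  have h1 : n ≤ 2 * (n - Fintype.card κ + 1 - #(free root)) := by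
    have := card_free root
    omega
  have h2 : n ^ #(free root) ≤ 2 ^ #(free root) * numEmbs root n := by
    calc n ^ #(free root) ≤ (2 * (n - Fintype.card κ + 1 - #(free root))) ^ #(free root) :=
          Nat.pow_le_pow_left h1 _
      _ = 2 ^ #(free root) * (n - Fintype.card κ + 1 - #(free root)) ^ #(free root) := mul_pow _ _ _
      _ ≤ _ := Nat.mul_le_mul_left _ (Nat.pow_sub_le_descFactorial _ _)
  have h3 : 2 ^ #(free root) * numEmbs root n ≤ 2 ^ Fintype.card V * numEmbs root n :=
    Nat.mul_le_mul_right _ (Nat.pow_le_pow_right two_pos (card_free_le root))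
  exact_mod_cast h2.trans h3

theorem card_embs_filter_le (root : κ ↪ V) (x : κ ↪ Fin n) {A : Finset V} (hA : A ⊆ free root)
    (W : Finset (Fin n)) (P : (V ↪ Fin n) → Prop) [DecidablePred P]
    (hP : ∀ φ, P φ → ∀ v ∈ A, φ v ∈ W) :
    #((embs root x).filter P) ≤ #W ^ #A * n ^ (#(free root) - #A) := by
  classical
  set t : V → Finset (Fin n) := fun v =>
    if h : ∃ j, root j = v then {x h.choose} else if v ∈ A then W else univ with ht
  have h1 : #((embs root x).filter P) ≤ #(Fintype.piFinset t) := by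
    refine card_le_card_of_injOn (fun φ => φ) ?_ (fun φ _ ψ _ h => DFunLike.coe_injective h)
    intro φ hφ
    rw [mem_coe, mem_filter, mem_embs] at hφ
    rw [mem_coe, Fintype.mem_piFinset]
    intro v
    simp only [ht]
    split_ifs with h1 h2
    · rw [mem_singleton, ← hφ.1, h1.choose_spec]
    · exact hP φ hφ.2 v h2
    · exact mem_univ _
  refine h1.trans (le_of_eq ?_)
  rw [Fintype.card_piFinset, ← prod_subset (subset_univ (free root)), ← prod_sdiff hA, mul_comm]
  · congr 1
    · refine prod_eq_pow_card fun v hv => ?_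
      have h : ¬∃ j, root j = v := mem_free.1 (hA hv)
      simp [ht, h, hv]
    · rw [← card_sdiff_of_subset hA]
      refine prod_eq_pow_card fun v hv => ?_
      have h : ¬∃ j, root j = v := mem_free.1 (Finset.mem_sdiff.1 hv).1
      simp [ht, h, (Finset.mem_sdiff.1 hv).2]
  · intro v _ hv
    have h : ∃ j, root j = v := by simpa [mem_free] using hv
    simp [ht, h]

theorem embMean_nonneg (root : κ ↪ V) (E : Finset (Sym2 V)) (n : ℕ) {p : ℝ} (hp : 0 ≤ p) :
    0 ≤ embMean root E n p := by
  unfold embMean; positivity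

theorem sum_pow_card_im (root : κ ↪ V) (E : Finset (Sym2 V)) (x : κ ↪ Fin n) (p : ℝ) :
    ∑ φ ∈ embs root x, p ^ #(im φ E) = embMean root E n p := by
  simp only [card_im, sum_const, card_embs, nsmul_eq_mul, embMean]

theorem embMean_le (root : κ ↪ V) (E : Finset (Sym2 V)) (n : ℕ) {p : ℝ} (hp : 0 ≤ p) :
    embMean root E n p ≤ (n : ℝ) ^ #(free root) * p ^ #E :=
  mul_le_mul_of_nonneg_right (numEmbs_le root n) (pow_nonneg hp _)

theorem le_embMean (root : κ ↪ V) (E : Finset (Sym2 V)) (hn : 2 * Fintype.card V ≤ n) {p : ℝ}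
    (hp : 0 ≤ p) :
    (n : ℝ) ^ #(free root) * p ^ #E ≤ 2 ^ Fintype.card V * embMean root E n p := by
  rw [embMean, ← mul_assoc]
  exact mul_le_mul_of_nonneg_right (le_numEmbs root hn) (pow_nonneg hp _)

/-! ### Overlaps with a fixed set of edges, and the tails of embedding counts -/

/-- The non-root vertices that are mapped into `W`. -/
noncomputable def hits (root : κ ↪ V) (W : Finset (Fin n)) (φ : V ↪ Fin n) : Finset V :=
  (free root).filter fun v => φ v ∈ W

/-- The edges that are mapped into `U`. -/
def inside (E : Finset (Sym2 V)) (U : Finset (Sym2 (Fin n))) (φ : V ↪ Fin n) : Finset (Sym2 V) :=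
  E.filter fun e => e.map φ ∈ U

theorem hits_subset (root : κ ↪ V) (W : Finset (Fin n)) (φ : V ↪ Fin n) :
    hits root W φ ⊆ free root := filter_subset _ _

theorem card_im_sdiff (E : Finset (Sym2 V)) (U : Finset (Sym2 (Fin n))) (φ : V ↪ Fin n) :
    #(im φ E \ U) + #(inside E U φ) = #E := by
  classical
  have h : im φ E \ U = (E.filter fun e => ¬e.map φ ∈ U).map φ.sym2Map := by
    ext e
    simp only [Finset.mem_sdiff, mem_im, Finset.mem_map, mem_filter]
    constructor
    · rintro ⟨⟨d, hd, rfl⟩, h⟩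
      exact ⟨d, ⟨hd, h⟩, rfl⟩
    · rintro ⟨d, ⟨hd, h⟩, rfl⟩
      exact ⟨⟨d, hd, rfl⟩, h⟩
  rw [h, card_map, inside, add_comm]
  exact card_filter_add_card_filter_not _

/-- An edge mapped into `U` has all its non-root ends mapped into `W`. This reduces edge overlaps to
vertex sets, over which the densities are controlled. -/
theorem card_inside_le {root : κ ↪ V} {E : Finset (Sym2 V)} {U : Finset (Sym2 (Fin n))}
    {W : Finset (Fin n)} (hU : U ⊆ W.sym2) (φ : V ↪ Fin n) :
    #(inside E U φ) ≤ edgesIn root E (hits root W φ) := by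
  classical
  refine card_le_card fun e he => ?_
  rw [inside, mem_filter] at he
  rw [mem_filter]
  refine ⟨he.1, fun v hv => ?_⟩
  by_cases h : v ∈ Set.range root
  · exact Or.inr h
  · left
    rw [hits, mem_filter]
    refine ⟨mem_free.2 h, ?_⟩
    have := mem_sym2_iff.1 (hU he.2) (φ v) (Sym2.mem_map.2 ⟨v, hv, rfl⟩)
    exact this

theorem inside_nonempty {E : Finset (Sym2 V)} {U : Finset (Sym2 (Fin n))} {φ : V ↪ Fin n}
    (h : ¬Disjoint (im φ E) U) : (inside E U φ).Nonempty := by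
  obtain ⟨e, he, heU⟩ := not_disjoint_iff.1 h
  obtain ⟨d, hd, rfl⟩ := mem_im.1 he
  exact ⟨d, mem_filter.2 ⟨hd, heU⟩⟩

theorem hits_nonempty {root : κ ↪ V} {E : Finset (Sym2 V)} (hE : IsExtEdges root E)
    {U : Finset (Sym2 (Fin n))} {W : Finset (Fin n)} (hU : U ⊆ W.sym2) {φ : V ↪ Fin n}
    (h : (inside E U φ).Nonempty) : (hits root W φ).Nonempty := by
  by_contra h'
  rw [not_nonempty_iff_eq_empty] at h'
  have h1 := card_inside_le (root := root) (E := E) hU φ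
  rw [h', edgesIn_empty hE] at h1
  have := h.card_pos
  omega

/-- The total weight of embeddings that overlap with a set of edges. -/
theorem sum_overlap_le (root : κ ↪ V) (E : Finset (Sym2 V)) (x : κ ↪ Fin n) {p g w : ℝ}
    (hp0 : 0 < p) (hg : 0 < g) (U : Finset (Sym2 (Fin n))) (W : Finset (Fin n))
    (hW : (#W : ℝ) ≤ w) (hw : 1 ≤ w) (Q : Finset (V ↪ Fin n)) (hQ : Q ⊆ embs root x)
    (hQg : ∀ φ ∈ Q, g ≤ (n : ℝ) ^ #(hits root W φ) * p ^ #(inside E U φ)) :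
    ∑ φ ∈ Q, p ^ #(im φ E \ U) ≤
      2 ^ Fintype.card V * w ^ Fintype.card V * ((n : ℝ) ^ #(free root) * p ^ #E) / g := by
  classical
  set v := #(free root) with hv
  have hterm : ∀ φ ∈ Q, p ^ #(im φ E \ U) ≤ (n : ℝ) ^ #(hits root W φ) * p ^ #E / g := by
    intro φ hφ
    rw [le_div_iff₀ hg, ← card_im_sdiff E U φ, pow_add]
    calc p ^ #(im φ E \ U) * g ≤ p ^ #(im φ E \ U) *
          ((n : ℝ) ^ #(hits root W φ) * p ^ #(inside E U φ)) :=
          mul_le_mul_of_nonneg_left (hQg φ hφ) (by positivity)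
      _ = _ := by ring
  -- For a fixed set A of hit vertices there are at most w^|A| n^(v-|A|) embeddings, each of weight
  -- at most n^|A| p^e / g. The powers of n recombine to n^v, so the loss is only a power of w
  -- divided by g.
  have hfib : ∀ A ∈ (free root).powerset,
      ∑ φ ∈ Q.filter (fun φ => hits root W φ = A), p ^ #(im φ E \ U) ≤
        w ^ Fintype.card V * ((n : ℝ) ^ v * p ^ #E) / g := by
    intro A hA
    have hA := mem_powerset.1 hA
    have hcard : (#(Q.filter (fun φ => hits root W φ = A)) : ℝ) ≤ #W ^ #A * (n : ℝ) ^ (v - #A) := by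
      have h1 : #(Q.filter (fun φ => hits root W φ = A)) ≤
          #((embs root x).filter (fun φ => hits root W φ = A)) :=
        card_le_card (filter_subset_filter _ hQ)
      have h2 := card_embs_filter_le root x hA W (fun φ => hits root W φ = A) (by
        rintro φ rfl u hu
        exact (mem_filter.1 hu).2)
      exact_mod_cast h1.trans h2
    have hAv : #A ≤ v := card_le_card hA
    calc ∑ φ ∈ Q.filter (fun φ => hits root W φ = A), p ^ #(im φ E \ U)
        ≤ ∑ _φ ∈ Q.filter (fun φ => hits root W φ = A), (n : ℝ) ^ #A * p ^ #E / g := by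
          refine sum_le_sum fun φ hφ => ?_
          rw [mem_filter] at hφ
          exact (hterm φ hφ.1).trans_eq (by rw [hφ.2])
      _ = #(Q.filter (fun φ => hits root W φ = A)) * ((n : ℝ) ^ #A * p ^ #E / g) := by simp
      _ ≤ (#W ^ #A * (n : ℝ) ^ (v - #A)) * ((n : ℝ) ^ #A * p ^ #E / g) := by gcongr
      _ = #W ^ #A * ((n : ℝ) ^ v * p ^ #E) / g := by
          rw [← Nat.sub_add_cancel hAv, pow_add, Nat.add_sub_cancel]; ring
      _ ≤ w ^ Fintype.card V * ((n : ℝ) ^ v * p ^ #E) / g := by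
          have : (#W : ℝ) ^ #A ≤ w ^ Fintype.card V :=
            (pow_le_pow_left₀ (Nat.cast_nonneg _) hW _).trans
              (pow_le_pow_right₀ hw (card_le_univ _))
          gcongr
  rw [← sum_fiberwise_of_maps_to (t := (free root).powerset) (g := hits root W)
    fun φ _ => mem_powerset.2 (hits_subset root W φ)]
  refine (sum_le_sum hfib).trans ?_
  rw [sum_const, card_powerset, nsmul_eq_mul]
  push_cast
  have h2 : (2 : ℝ) ^ v ≤ 2 ^ Fintype.card V :=
    pow_le_pow_right₀ one_le_two (card_free_le root)
  calc (2 : ℝ) ^ v * (w ^ Fintype.card V * ((n : ℝ) ^ v * p ^ #E) / g)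
      ≤ 2 ^ Fintype.card V * (w ^ Fintype.card V * ((n : ℝ) ^ v * p ^ #E) / g) := by gcongr
    _ = _ := by ring

/-- The vertices used by an embedding. -/
noncomputable def range (φ : V ↪ Fin n) : Finset (Fin n) := univ.map φ

theorem card_range (φ : V ↪ Fin n) : #(range φ) = Fintype.card V := by simp [range]

theorem im_subset_sym2 (φ : V ↪ Fin n) (E : Finset (Sym2 V)) : im φ E ⊆ (range φ).sym2 := by
  intro e he
  obtain ⟨d, _, rfl⟩ := mem_im.1 he
  rw [mem_sym2_iff]
  intro a ha
  obtain ⟨v, _, rfl⟩ := Sym2.mem_map.1 ha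
  exact Finset.mem_map.2 ⟨v, mem_univ _, rfl⟩

/-- The lower tail of the number of embeddings. -/
theorem lower_tail {root : κ ↪ V} {E : Finset (Sym2 V)} (hE : IsExtEdges root E) (x : κ ↪ Fin n)
    {p g ε : ℝ} (hp0 : 0 < p) (hp1 : p ≤ 1) (hg : 0 < g) (hn : 2 * Fintype.card V ≤ n)
    (hgA : ∀ A ⊆ free root, 0 < edgesIn root E A → g ≤ (n : ℝ) ^ #A * p ^ edgesIn root E A)
    (hε0 : 0 < ε) (hε1 : ε ≤ 1) :
    bprob p (allEdges n) (fun s => embCount root E x s ≤ (1 - ε) * embMean root E n p) ≤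
      Real.exp (-(ε ^ 2 * g /
        (12 * (2 ^ Fintype.card V * (Fintype.card V : ℝ) ^ Fintype.card V * 4 ^ Fintype.card V)))) := by
  classical
  -- Without edges `hgA` is vacuous and does not bound `g` by Λ, but the count is then a positive
  -- constant and the event is impossible.
  rcases E.eq_empty_or_nonempty with rfl | hne
  · rw [bprob_eq_zero]
    · exact Real.exp_nonneg _
    · intro s _
      have h1 : embCount root ∅ x s = numEmbs root n := by
        simp [embCount, im, ind_of, card_embs]
      have h2 : (0 : ℝ) < numEmbs root n := by
        have := Nat.descFactorial_pos (n := n - Fintype.card κ) (k := #(free root))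
        rw [numEmbs]
        have h := card_free root
        exact_mod_cast this.2 (by omega)
      rw [h1, embMean, card_empty, pow_zero, mul_one]
      nlinarith
  have hE1 : 0 < #E := hne.card_pos
  set v := #(free root) with hv
  set c := Fintype.card V with hc
  set Λ := (n : ℝ) ^ v * p ^ #E with hΛ
  have hcpos : 1 ≤ c := by
    obtain ⟨e, he⟩ := hne
    obtain ⟨u, _⟩ := hE.exists_free e he
    exact Fintype.card_pos_iff.2 ⟨u⟩
  have hc1 : (1 : ℝ) ≤ c := by exact_mod_cast hcpos
  have hgΛ : g ≤ Λ := by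
    have := hgA (free root) Subset.rfl (by rwa [edgesIn_free])
    rwa [edgesIn_free] at this
  have hn0 : (0 : ℝ) < n := by
    have : 0 < n := by omega
    exact_mod_cast this
  have hΛ0 : 0 < Λ := by positivity
  -- The embeddings overlapping a given one have total weight at most 2^c c^c Λ / g; summing over
  -- the given one contributes another Λ. As g ≤ Λ, this also dominates the mean, as Janson's
  -- inequality requires.
  set D := 2 ^ c * (c : ℝ) ^ c * Λ ^ 2 / g with hD
  have hD0 : 0 < D := by positivity
  have hK : (1 : ℝ) ≤ 2 ^ c * (c : ℝ) ^ c :=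
    one_le_mul_of_one_le_of_one_le (one_le_pow₀ one_le_two) (one_le_pow₀ hc1)
  have hmD : embMean root E n p ≤ D := by
    refine (embMean_le root E n hp0.le).trans ?_
    rw [hD, le_div_iff₀ hg]
    calc Λ * g ≤ 1 * (Λ * Λ) := by rw [one_mul]; gcongr
      _ ≤ 2 ^ c * (c : ℝ) ^ c * (Λ * Λ) := by gcongr
      _ = _ := by ring
  have hdouble : ∑ φ ∈ embs root x, ∑ ψ ∈ embs root x,
      ind (¬Disjoint (im φ E) (im ψ E)) * p ^ #(im φ E ∪ im ψ E) ≤ D := by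
    have h1 : ∀ φ ∈ embs root x, ∑ ψ ∈ embs root x,
        ind (¬Disjoint (im φ E) (im ψ E)) * p ^ #(im φ E ∪ im ψ E) ≤
        p ^ #E * (2 ^ c * (c : ℝ) ^ c * Λ / g) := by
      intro φ _
      have h2 : ∑ ψ ∈ embs root x, ind (¬Disjoint (im φ E) (im ψ E)) * p ^ #(im φ E ∪ im ψ E) =
          p ^ #E * ∑ ψ ∈ (embs root x).filter (fun ψ => ¬Disjoint (im ψ E) (im φ E)),
            p ^ #(im ψ E \ im φ E) := by
        rw [mul_sum, sum_filter]
        refine sum_congr rfl fun ψ _ => ?_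
        by_cases h : Disjoint (im ψ E) (im φ E)
        · rw [if_neg (not_not.2 h), ind_of_not (not_not.2 h.symm), zero_mul]
        · rw [if_pos h, ind_of fun h' => h h'.symm, one_mul, ← pow_add, union_comm,
            ← sdiff_union_self_eq_union, card_union_of_disjoint sdiff_disjoint, card_im, add_comm]
      rw [h2]
      refine mul_le_mul_of_nonneg_left ?_ (by positivity)
      refine sum_overlap_le root E x hp0 hg (im φ E) (range φ) (by rw [card_range]) hc1 _
        (filter_subset _ _) fun ψ hψ => ?_
      have hin := inside_nonempty (mem_filter.1 hψ).2
      have hle := card_inside_le (root := root) (E := E) (im_subset_sym2 φ E) ψ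
      refine (hgA _ (hits_subset root (range φ) ψ) (hin.card_pos.trans_le hle)).trans ?_
      exact mul_le_mul_of_nonneg_left (pow_le_pow_of_le_one hp0.le hp1 hle) (by positivity)
    refine (sum_le_sum h1).trans ?_
    rw [sum_const, nsmul_eq_mul, card_embs, ← mul_assoc]
    refine (mul_le_mul_of_nonneg_right (embMean_le root E n hp0.le) (by positivity)).trans
      (le_of_eq ?_)
    rw [hD]; ring
  have hj := janson hp0.le hp1 (embs root x) (fun φ => im φ E)
    (fun φ _ => im_subset_allEdges hE φ) hD0 hdouble (by rw [sum_pow_card_im]; exact hmD) hε0.le hε1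
  rw [sum_pow_card_im] at hj
  refine hj.trans ?_
  rw [Real.exp_le_exp, neg_le_neg_iff]
  have h1 := le_embMean root E hn hp0.le
  have h2 : Λ ^ 2 ≤ 4 ^ c * embMean root E n p ^ 2 := by
    calc Λ ^ 2 ≤ (2 ^ c * embMean root E n p) ^ 2 := pow_le_pow_left₀ hΛ0.le h1 2
      _ = _ := by rw [mul_pow, ← pow_mul, mul_comm c 2, pow_mul]; norm_num
  rw [hD, div_le_div_iff₀ (by positivity) (by positivity)]
  have e1 : ε ^ 2 * g * (12 * (2 ^ c * (c : ℝ) ^ c * Λ ^ 2 / g)) =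
      (12 * ε ^ 2 * (2 ^ c * (c : ℝ) ^ c)) * Λ ^ 2 := by
    field_simp
  rw [e1]
  refine (mul_le_mul_of_nonneg_left h2 (by positivity)).trans (le_of_eq (by ring))

/-- The vertices used by a list of embeddings. -/
noncomputable def listRange (l : List (V ↪ Fin n)) : Finset (Fin n) :=
  listUnion range l

theorem card_listRange_le (l : List (V ↪ Fin n)) :
    #(listRange l) ≤ l.length * Fintype.card V := by
  induction l with
  | nil => simp [listRange, listUnion]
  | cons φ l ih =>
    rw [listRange, listUnion, List.length_cons, add_mul, one_mul, add_comm]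
    exact (card_union_le _ _).trans (add_le_add (card_range φ).le ih)

theorem listUnion_im_subset (E : Finset (Sym2 V)) (l : List (V ↪ Fin n)) :
    listUnion (fun φ => im φ E) l ⊆ (listRange l).sym2 := by
  intro e he
  obtain ⟨φ, hφ, hmem⟩ := mem_listUnion.1 he
  exact sym2_mono (subset_listUnion (F := range) hφ) (im_subset_sym2 φ E hmem)

/-- The upper tail of the number of embeddings when all partial extensions are abundant. -/
theorem upper_tail_of_abundant {root : κ ↪ V} {E : Finset (Sym2 V)} (hE : IsExtEdges root E)
    (x : κ ↪ Fin n)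
    {p g ε : ℝ} (hp0 : 0 < p) (hp1 : p ≤ 1) (hg : 0 < g) (hn : 2 * Fintype.card V ≤ n)
    (hn0 : 0 < n)
    (hgA : ∀ A ⊆ free root, A.Nonempty → g ≤ (n : ℝ) ^ #A * p ^ edgesIn root E A)
    (hε0 : 0 < ε) (hε1 : ε ≤ 1) (r : ℕ)
    (hr : 4 ^ Fintype.card V * ((r * Fintype.card V + 1 : ℕ) : ℝ) ^ Fintype.card V ≤ ε / 4 * g) :
    bprob p (allEdges n) (fun s => (1 + ε) * embMean root E n p ≤ embCount root E x s) ≤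
      Real.exp (-(ε * r / 4)) := by
  classical
  set c := Fintype.card V with hc
  set w : ℝ := ((r * c + 1 : ℕ) : ℝ) with hw
  have hw1 : 1 ≤ w := by rw [hw]; push_cast; nlinarith [(Nat.cast_nonneg (r * c) : (0:ℝ) ≤ _)]
  set μ := embMean root E n p with hμ
  have hn0' : (0 : ℝ) < n := by exact_mod_cast hn0
  have hΛμ := le_embMean root E hn hp0.le
  have hμ0 : 0 < μ := by
    have : 0 < (n : ℝ) ^ #(free root) * p ^ #E := by positivity
    by_contra h
    push Not at h
    nlinarith [mul_nonpos_of_nonneg_of_nonpos (by positivity : (0:ℝ) ≤ 2 ^ c) h]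
  -- Fewer than `r` chosen embeddings occupy at most `w` vertices. Embeddings avoiding these on the
  -- non-roots keep their full cost and contribute at most μ; those hitting them contribute at most
  -- εμ/4, by the choice of `r`.
  have hM : ∀ l : List (V ↪ Fin n), l.length < r → (∀ φ ∈ l, φ ∈ embs root x) →
      ∑ φ ∈ embs root x, p ^ #(im φ E \ listUnion (fun φ => im φ E) l) ≤ (1 + ε / 4) * μ := by
    intro l hl _
    set U := listUnion (fun φ => im φ E) l with hU
    set W := listRange l with hW
    have hUW : U ⊆ W.sym2 := listUnion_im_subset E l
    have hWw : (#W : ℝ) ≤ w := by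
      have h1 := card_listRange_le l
      have h2 : l.length * c ≤ r * c := Nat.mul_le_mul_right _ hl.le
      rw [hw]
      exact_mod_cast (h1.trans h2).trans (Nat.le_succ _)
    rw [← sum_filter_add_sum_filter_not _ (fun φ => hits root W φ = ∅), add_mul, one_mul]
    refine add_le_add ?_ ?_
    · calc ∑ φ ∈ (embs root x).filter (fun φ => hits root W φ = ∅), p ^ #(im φ E \ U)
          ≤ ∑ φ ∈ (embs root x).filter (fun φ => hits root W φ = ∅), p ^ #(im φ E) := by
            refine sum_le_sum fun φ hφ => le_of_eq ?_
            have h := (mem_filter.1 hφ).2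
            have h3 : #(inside E U φ) = 0 := by
              by_contra h4
              have := hits_nonempty hE hUW (card_pos.1 (Nat.pos_of_ne_zero h4))
              rw [h] at this
              simp at this
            have := card_im_sdiff E U φ
            rw [h3, add_zero] at this
            rw [this, card_im]
        _ ≤ ∑ φ ∈ embs root x, p ^ #(im φ E) :=
            sum_le_sum_of_subset_of_nonneg (filter_subset _ _) fun _ _ _ => by positivity
        _ = μ := sum_pow_card_im root E x p
    · refine (sum_overlap_le root E x hp0 hg U W hWw hw1 _ (filter_subset _ _) ?_).trans ?_
      · intro φ hφ
        have h := nonempty_iff_ne_empty.2 (mem_filter.1 hφ).2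
        refine (hgA _ (hits_subset root W φ) h).trans ?_
        exact mul_le_mul_of_nonneg_left (pow_le_pow_of_le_one hp0.le hp1 (card_inside_le hUW φ))
          (by positivity)
      · rw [div_le_iff₀ hg]
        calc 2 ^ c * w ^ c * ((n : ℝ) ^ #(free root) * p ^ #E)
            ≤ 2 ^ c * w ^ c * (2 ^ c * μ) := by gcongr
          _ = 4 ^ c * w ^ c * μ := by
              rw [show (4 : ℝ) = 2 * 2 by norm_num, mul_pow]; ring
          _ ≤ ε / 4 * g * μ := by gcongr
          _ = _ := by ring
  refine (bprob_upper_le_pow hp0.le hp1 (embs root x) (fun φ => im φ E)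
    (fun φ _ => im_subset_allEdges hE φ) r (by positivity) hM).trans ?_
  have h1 : (1 + ε / 4) * μ / ((1 + ε) * μ) ≤ Real.exp (-(ε / 4)) := by
    rw [mul_div_mul_right _ _ hμ0.ne']
    calc (1 + ε / 4) / (1 + ε) ≤ 1 - ε / 4 := by
          rw [div_le_iff₀ (by positivity)]; nlinarith
      _ ≤ _ := by linarith [Real.add_one_le_exp (-(ε / 4))]
  refine (pow_le_pow_left₀ (by positivity) h1 r).trans (le_of_eq ?_)
  rw [← Real.exp_nat_mul]
  congr 1
  ring

end RootedExtension
-- From embeddings to copies: automorphisms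
namespace RootedExtension

open Finset BernoulliSubset

variable {κ V : Type*} [Fintype κ] [Fintype V] {n : ℕ}

/-- The number of automorphisms of a rooted graph. -/
noncomputable def aut (root : κ ↪ V) (E : Finset (Sym2 V)) : ℕ := by
  classical exact #((univ : Finset (Equiv.Perm V)).filter fun σ =>
    (∀ j, σ (root j) = root j) ∧ E.map σ.toEmbedding.sym2Map = E)

theorem aut_pos (root : κ ↪ V) (E : Finset (Sym2 V)) : 0 < aut root E := by
  classical
  refine card_pos.2 ⟨1, ?_⟩
  rw [mem_filter]
  refine ⟨mem_univ _, fun j => rfl, ?_⟩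
  ext e
  simp [Function.Embedding.sym2Map]

theorem aut_le (root : κ ↪ V) (E : Finset (Sym2 V)) : aut root E ≤ (Fintype.card V).factorial := by
  classical
  refine (card_filter_le _ _).trans ?_
  rw [card_univ, Fintype.card_perm]

theorem im_trans (σ : Equiv.Perm V) (φ : V ↪ Fin n) (E : Finset (Sym2 V)) :
    im (σ.toEmbedding.trans φ) E = im φ (E.map σ.toEmbedding.sym2Map) := by
  ext e
  simp only [mem_im, Finset.mem_map]
  constructor
  · rintro ⟨d, hd, rfl⟩
    exact ⟨_, ⟨d, hd, rfl⟩, by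
      change Sym2.map φ (Sym2.map σ d) = _
      rw [Sym2.map_map]; rfl⟩
  · rintro ⟨_, ⟨d, hd, rfl⟩, rfl⟩
    refine ⟨d, hd, ?_⟩
    change _ = Sym2.map φ (Sym2.map σ d)
    rw [Sym2.map_map]; rfl

theorem im_injective (φ : V ↪ Fin n) : Function.Injective (im φ) := map_injective _

/-- Two embeddings with the same vertices and the same edges in their images differ by a unique
automorphism fixing the roots. The predicate is left abstract because the lemma serves both for edge
sets and for subgraphs. -/
theorem card_fiber (root : κ ↪ V) (E : Finset (Sym2 V)) (x : κ ↪ Fin n) {φ₀ : V ↪ Fin n}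
    (h₀ : φ₀ ∈ embs root x) (P : (V ↪ Fin n) → Prop) [DecidablePred P]
    (hP : ∀ φ ∈ embs root x, P φ ↔ range φ = range φ₀ ∧ im φ E = im φ₀ E) :
    #((embs root x).filter P) = aut root E := by
  classical
  have h₀' := mem_embs.1 h₀
  symm
  refine card_nbij (fun σ : Equiv.Perm V => σ.toEmbedding.trans φ₀) ?_ ?_ ?_
  · intro σ hσ
    obtain ⟨-, h1, h2⟩ := mem_filter.1 hσ
    have hmem : σ.toEmbedding.trans φ₀ ∈ embs root x := mem_embs.2 fun j => by
      change φ₀ (σ (root j)) = x j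
      rw [h1, h₀']
    refine mem_filter.2 ⟨hmem, (hP _ hmem).2 ⟨?_, ?_⟩⟩
    · ext a
      simp only [range, Finset.mem_map, mem_univ, true_and]
      constructor
      · rintro ⟨v, rfl⟩; exact ⟨σ v, rfl⟩
      · rintro ⟨v, rfl⟩; exact ⟨σ.symm v, congrArg φ₀ (σ.apply_symm_apply v)⟩
    · rw [im_trans, h2]
  · intro σ _ τ _ h
    ext v
    exact φ₀.injective (DFunLike.congr_fun h v)
  · intro φ hφ
    obtain ⟨hmem, hφ⟩ := mem_filter.1 hφ
    obtain ⟨hr, hi⟩ := (hP _ hmem).1 hφ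
    have hex : ∀ v, ∃ u, φ₀ u = φ v := by
      intro v
      have : φ v ∈ range φ₀ := hr ▸ Finset.mem_map.2 ⟨v, mem_univ _, rfl⟩
      obtain ⟨u, -, hu⟩ := Finset.mem_map.1 this
      exact ⟨u, hu⟩
    choose f hf using hex
    have hfi : Function.Injective f := fun v w h => φ.injective (by rw [← hf, ← hf, h])
    let σ : Equiv.Perm V := Equiv.ofBijective f (Finite.injective_iff_bijective.1 hfi)
    have hσ : σ.toEmbedding.trans φ₀ = φ := by
      ext v
      exact congrArg Fin.val (hf v)
    refine ⟨σ, mem_filter.2 ⟨mem_univ _, fun j => φ₀.injective ?_, ?_⟩, hσ⟩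
    · change φ₀ (f (root j)) = _
      rw [hf, h₀', mem_embs.1 hmem]
    · apply im_injective φ₀
      rw [← im_trans, hσ, hi]

/-- Every vertex that is not a root lies on an edge. -/
def Covers (root : κ ↪ V) (E : Finset (Sym2 V)) : Prop := ∀ v ∈ free root, ∃ e ∈ E, v ∈ e

theorem apply_mem_of_im_subset {root : κ ↪ V} {E : Finset (Sym2 V)} (hc : Covers root E)
    {φ : V ↪ Fin n} {U : Finset (Sym2 (Fin n))} {W : Finset (Fin n)} (hU : U ⊆ W.sym2)
    (h : im φ E ⊆ U) {v : V} (hv : v ∈ free root) : φ v ∈ W := by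
  obtain ⟨e, he, hve⟩ := hc v hv
  exact mem_sym2_iff.1 (hU (h (map_mem_im he))) (φ v) (Sym2.mem_map.2 ⟨v, hve, rfl⟩)

/-- If no non-root is isolated, the edges of a copy determine its vertices. So copies can be treated
as plain sets of edges, which is what the estimates for random subsets need. -/
theorem range_eq_of_im_eq {root : κ ↪ V} {E : Finset (Sym2 V)} (hc : Covers root E)
    {x : κ ↪ Fin n} {φ ψ : V ↪ Fin n} (hφ : φ ∈ embs root x) (hψ : ψ ∈ embs root x)
    (h : im φ E = im ψ E) : range φ = range ψ := by
  have key : ∀ φ ψ : V ↪ Fin n, φ ∈ embs root x → ψ ∈ embs root x → im φ E = im ψ E →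
      range φ ⊆ range ψ := by
    intro φ ψ hφ hψ h a ha
    obtain ⟨v, -, rfl⟩ := Finset.mem_map.1 ha
    by_cases hv : v ∈ free root
    · exact apply_mem_of_im_subset hc (im_subset_sym2 ψ E) h.subset hv
    · obtain ⟨j, rfl⟩ : v ∈ Set.range root := by simpa [mem_free] using hv
      refine Finset.mem_map.2 ⟨root j, mem_univ _, ?_⟩
      rw [mem_embs.1 hφ, mem_embs.1 hψ]
  exact (key φ ψ hφ hψ h).antisymm (key ψ φ hψ hφ h.symm)

/-- The edge sets of the copies of a rooted graph. -/
noncomputable def copies (root : κ ↪ V) (E : Finset (Sym2 V)) (x : κ ↪ Fin n) :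
    Finset (Finset (Sym2 (Fin n))) := (embs root x).image fun φ => im φ E

theorem mem_copies {root : κ ↪ V} {E : Finset (Sym2 V)} {x : κ ↪ Fin n}
    {S : Finset (Sym2 (Fin n))} : S ∈ copies root E x ↔ ∃ φ ∈ embs root x, im φ E = S :=
  mem_image

theorem sum_embs_eq {root : κ ↪ V} {E : Finset (Sym2 V)} (hc : Covers root E) (x : κ ↪ Fin n)
    (f : Finset (Sym2 (Fin n)) → ℝ) :
    ∑ φ ∈ embs root x, f (im φ E) = aut root E * ∑ S ∈ copies root E x, f S := by
  classical
  rw [mul_sum, copies, sum_comp]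
  refine sum_congr rfl fun S hS => ?_
  obtain ⟨φ₀, h₀, rfl⟩ := mem_image.1 hS
  rw [card_fiber root E x h₀, nsmul_eq_mul]
  exact fun φ hφ => ⟨fun h => ⟨range_eq_of_im_eq hc hφ h₀ h, h⟩, fun h => h.2⟩

theorem sum_copies_le {root : κ ↪ V} {E : Finset (Sym2 V)} (hc : Covers root E) (x : κ ↪ Fin n)
    (f : Finset (Sym2 (Fin n)) → ℝ) (hf : ∀ S, 0 ≤ f S) :
    ∑ S ∈ copies root E x, f S ≤ ∑ φ ∈ embs root x, f (im φ E) := by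
  rw [sum_embs_eq hc]
  refine le_mul_of_one_le_left (sum_nonneg fun S _ => hf S) ?_
  exact_mod_cast aut_pos root E

/-- The number of copies in a set of edges. -/
noncomputable def copyCount (root : κ ↪ V) (E : Finset (Sym2 V)) (x : κ ↪ Fin n)
    (s : Finset (Sym2 (Fin n))) : ℕ := #((copies root E x).filter (· ⊆ s))

theorem embCount_eq {root : κ ↪ V} {E : Finset (Sym2 V)} (hc : Covers root E) (x : κ ↪ Fin n)
    (s : Finset (Sym2 (Fin n))) :
    embCount root E x s = aut root E * copyCount root E x s := by
  rw [embCount, sum_embs_eq hc x fun S => ind (S ⊆ s), sum_ind, copyCount]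

theorem card_copies_mul {root : κ ↪ V} {E : Finset (Sym2 V)} (hc : Covers root E)
    (x : κ ↪ Fin n) : aut root E * #(copies root E x) = numEmbs root n := by
  have := sum_embs_eq hc x fun _ => 1
  simp only [sum_const, nsmul_eq_mul, mul_one, card_embs] at this
  exact_mod_cast this.symm

theorem card_of_mem_copies {root : κ ↪ V} {E : Finset (Sym2 V)} {x : κ ↪ Fin n}
    {S : Finset (Sym2 (Fin n))} (hS : S ∈ copies root E x) : #S = #E := by
  obtain ⟨φ, -, rfl⟩ := mem_copies.1 hS
  exact card_im φ E

theorem subset_allEdges_of_mem_copies {root : κ ↪ V} {E : Finset (Sym2 V)}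
    (hE : IsExtEdges root E) {x : κ ↪ Fin n} {S : Finset (Sym2 (Fin n))}
    (hS : S ∈ copies root E x) : S ⊆ allEdges n := by
  obtain ⟨φ, -, rfl⟩ := mem_copies.1 hS
  exact im_subset_allEdges hE φ

/-! ### The upper tail of the number of copies near their threshold -/

/-- All partial overlaps of copies are unlikely by a factor `G`. -/
def OverlapBound (root : κ ↪ V) (E : Finset (Sym2 V)) (n : ℕ) (p G : ℝ) : Prop :=
  ∀ A ⊆ free root, A.Nonempty → ∀ f ≤ edgesIn root E A, f < #E → G ≤ (n : ℝ) ^ #A * p ^ f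

/-- The order of magnitude `n ^ v * p ^ e` of the expected number of copies. -/
noncomputable def scale (root : κ ↪ V) (E : Finset (Sym2 V)) (n : ℕ) (p : ℝ) : ℝ :=
  (n : ℝ) ^ #(free root) * p ^ #E

/-- Full containment in `U` has to be excluded: near the threshold n^v p^e itself may be small, and
only overlaps that leave an edge outside `U` are covered by `OverlapBound`. -/
theorem sum_partial_overlap_le {root : κ ↪ V} {E : Finset (Sym2 V)} (hE : IsExtEdges root E)
    (x : κ ↪ Fin n) {p G w : ℝ} (hp0 : 0 < p) (hG0 : 0 < G) (hG : OverlapBound root E n p G)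
    (U : Finset (Sym2 (Fin n))) (W : Finset (Fin n)) (hUW : U ⊆ W.sym2)
    (hW : (#W : ℝ) ≤ w) (hw : 1 ≤ w) :
    ∑ φ ∈ embs root x, ind (¬Disjoint (im φ E) U ∧ ¬im φ E ⊆ U) * p ^ #(im φ E \ U) ≤
      2 ^ Fintype.card V * w ^ Fintype.card V * scale root E n p / G := by
  classical
  have h1 : ∑ φ ∈ embs root x, ind (¬Disjoint (im φ E) U ∧ ¬im φ E ⊆ U) * p ^ #(im φ E \ U) =
      ∑ φ ∈ (embs root x).filter (fun φ => ¬Disjoint (im φ E) U ∧ ¬im φ E ⊆ U),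
        p ^ #(im φ E \ U) := by
    rw [sum_filter]
    refine sum_congr rfl fun φ _ => ?_
    by_cases h : ¬Disjoint (im φ E) U ∧ ¬im φ E ⊆ U
    · rw [if_pos h, ind_of h, one_mul]
    · rw [if_neg h, ind_of_not h, zero_mul]
  rw [h1]
  refine sum_overlap_le root E x hp0 hG0 U W hW hw _ (filter_subset _ _) fun φ hφ => ?_
  obtain ⟨-, h2, h3⟩ := mem_filter.1 hφ
  refine hG _ (hits_subset root W φ) (hits_nonempty hE hUW (inside_nonempty h2)) _
    (card_inside_le hUW φ) ?_
  have h4 := card_im_sdiff E U φ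
  have h5 : 0 < #(im φ E \ U) := card_pos.2 (sdiff_nonempty.2 h3)
  omega

/-- The excluded case is bounded trivially: a contained copy has all its non-roots among at most `w`
vertices. -/
theorem card_contained_le {root : κ ↪ V} {E : Finset (Sym2 V)} (hc : Covers root E)
    (x : κ ↪ Fin n) (U : Finset (Sym2 (Fin n))) (W : Finset (Fin n)) (hUW : U ⊆ W.sym2)
    {w : ℕ} (hW : #W ≤ w) (hw : 1 ≤ w) [DecidablePred fun φ => im φ E ⊆ U] :
    #((embs root x).filter fun φ => im φ E ⊆ U) ≤ w ^ Fintype.card V := by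
  classical
  have := card_embs_filter_le root x Subset.rfl W (fun φ => im φ E ⊆ U)
    fun φ h v hv => apply_mem_of_im_subset hc hUW h hv
  rw [Nat.sub_self, pow_zero, mul_one] at this
  exact this.trans ((Nat.pow_le_pow_left hW _).trans (Nat.pow_le_pow_right hw (card_free_le root)))

theorem sum_sdiff_le {root : κ ↪ V} {E : Finset (Sym2 V)} (hE : IsExtEdges root E)
    (hc : Covers root E) (x : κ ↪ Fin n) {p G : ℝ} {w : ℕ} (hp0 : 0 < p) (hp1 : p ≤ 1) (hG0 : 0 < G)
    (hG : OverlapBound root E n p G)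
    (U : Finset (Sym2 (Fin n))) (W : Finset (Fin n)) (hUW : U ⊆ W.sym2)
    (hW : #W ≤ w) (hw : 1 ≤ w) :
    ∑ φ ∈ embs root x, p ^ #(im φ E \ U) ≤ scale root E n p +
      2 ^ Fintype.card V * (w : ℝ) ^ Fintype.card V * scale root E n p / G +
        (w : ℝ) ^ Fintype.card V := by
  classical
  have h1 : ∀ φ ∈ embs root x, p ^ #(im φ E \ U) ≤ p ^ #E +
      ind (¬Disjoint (im φ E) U ∧ ¬im φ E ⊆ U) * p ^ #(im φ E \ U) + ind (im φ E ⊆ U) := by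
    intro φ _
    have hpos : 0 ≤ p ^ #E := by positivity
    by_cases h2 : im φ E ⊆ U
    · rw [ind_of h2, ind_of_not fun h => h.2 h2, zero_mul, add_zero]
      exact (pow_le_one₀ hp0.le hp1).trans (by linarith)
    · by_cases h3 : Disjoint (im φ E) U
      · rw [sdiff_eq_self_of_disjoint h3, card_im, ind_of_not fun h => h.1 h3, ind_of_not h2]
        simp
      · rw [ind_of ⟨h3, h2⟩, ind_of_not h2]
        linarith
  refine (sum_le_sum h1).trans ?_
  rw [sum_add_distrib, sum_add_distrib]
  refine add_le_add (add_le_add ?_ ?_) ?_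
  · rw [sum_const, nsmul_eq_mul, card_embs]
    exact embMean_le root E n hp0.le
  · exact sum_partial_overlap_le hE x hp0 hG0 hG U W hUW (by exact_mod_cast hW)
      (by exact_mod_cast hw)
  · rw [sum_ind]
    exact_mod_cast card_contained_le hc x U W hUW hW hw

/-- The copies in `s` that overlap with other copies in `s`. -/
noncomputable def overlapping (root : κ ↪ V) (E : Finset (Sym2 V)) (x : κ ↪ Fin n)
    (s : Finset (Sym2 (Fin n))) : Finset (Finset (Sym2 (Fin n))) := by
  classical exact (copies root E x).filter fun S =>
    S ⊆ s ∧ ∃ S' ∈ copies root E x, S' ⊆ s ∧ S' ≠ S ∧ ¬Disjoint S S'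

/-- It is unlikely that many copies overlap with other copies. -/
theorem bprob_overlapping_le {root : κ ↪ V} {E : Finset (Sym2 V)} (hE : IsExtEdges root E)
    (hc : Covers root E) (x : κ ↪ Fin n) {p G : ℝ} (hp0 : 0 < p) (hp1 : p ≤ 1) (hG0 : 0 < G)
    (hG : OverlapBound root E n p G) (R : ℕ) (hV : 0 < Fintype.card V) {w : ℕ}
    (hw : w = (2 * R + 1) * Fintype.card V) {η : ℝ}
    (hη : η = 2 ^ Fintype.card V * (w : ℝ) ^ Fintype.card V * scale root E n p / G) :
    bprob p (allEdges n) (fun s => w ^ Fintype.card V < #(overlapping root E x s)) ≤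
      ((scale root E n p + η + (w : ℝ) ^ Fintype.card V) * η) ^ R := by
  classical
  set c := Fintype.card V with hc'
  have hw1 : 1 ≤ w := by rw [hw]; nlinarith
  set F : (V ↪ Fin n) × (V ↪ Fin n) → Finset (Sym2 (Fin n)) :=
    fun a => im a.1 E ∪ im a.2 E with hF
  set rg : (V ↪ Fin n) × (V ↪ Fin n) → Finset (Fin n) := fun a => range a.1 ∪ range a.2 with hrg
  set I := embs root x ×ˢ embs root x with hI
  -- Each step adds a pair whose second copy overlaps the previous edges together with the first
  -- copy, but is not contained in them. Summed over the second copy, this saves a factor η; the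
  -- first copy is unrestricted.
  set adm : List ((V ↪ Fin n) × (V ↪ Fin n)) → (V ↪ Fin n) × (V ↪ Fin n) → Prop := fun l a =>
    ¬Disjoint (im a.2 E) (listUnion F l ∪ im a.1 E) ∧ ¬im a.2 E ⊆ listUnion F l ∪ im a.1 E with hadm
  have hUW : ∀ l, listUnion F l ⊆ (listUnion rg l).sym2 := by
    intro l e he
    obtain ⟨a, ha, hea⟩ := mem_listUnion.1 he
    refine sym2_mono (subset_listUnion (F := rg) ha) ?_
    rcases mem_union.1 hea with h | h
    · exact sym2_mono subset_union_left (im_subset_sym2 _ E h)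
    · exact sym2_mono subset_union_right (im_subset_sym2 _ E h)
  have hcard : ∀ l, #(listUnion rg l) ≤ l.length * (2 * c) := by
    intro l
    induction l with
    | nil => simp [listUnion]
    | cons a l ih =>
      rw [listUnion, List.length_cons, add_mul, one_mul, add_comm]
      refine (card_union_le _ _).trans (add_le_add ?_ ih)
      refine (card_union_le _ _).trans ?_
      rw [card_range, card_range]
      omega
  have hη0 : 0 ≤ η := by rw [hη, scale]; positivity
  have hM : ∀ l : List ((V ↪ Fin n) × (V ↪ Fin n)), l.length < R → (∀ i ∈ l, i ∈ I) →
      ∑ i ∈ I, ind (adm l i) * p ^ #(F i \ listUnion F l) ≤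
        (scale root E n p + η + (w : ℝ) ^ c) * η := by
    intro l hl _
    set U := listUnion F l with hU
    set W := listUnion rg l with hW
    -- At most `R` pairs on 2c vertices each, and one further copy: this is the origin of (2R+1)c.
    have hWc : #W + c ≤ w := by
      have := hcard l
      rw [hw]
      nlinarith
    rw [hI, sum_product]
    have hinner : ∀ φ ∈ embs root x, ∑ ψ ∈ embs root x,
        ind (adm l (φ, ψ)) * p ^ #(F (φ, ψ) \ U) ≤ p ^ #(im φ E \ U) * η := by
      intro φ _
      have h1 : ∀ ψ, ind (adm l (φ, ψ)) * p ^ #(F (φ, ψ) \ U) = p ^ #(im φ E \ U) *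
          (ind (¬Disjoint (im ψ E) (U ∪ im φ E) ∧ ¬im ψ E ⊆ U ∪ im φ E) *
            p ^ #(im ψ E \ (U ∪ im φ E))) := by
        intro ψ
        have h2 : F (φ, ψ) \ U = im φ E \ U ∪ im ψ E \ (U ∪ im φ E) := by
          ext e
          simp only [hF, Finset.mem_sdiff, mem_union]
          tauto
        have h3 : Disjoint (im φ E \ U) (im ψ E \ (U ∪ im φ E)) := by
          rw [disjoint_left]
          intro e he he'
          simp only [Finset.mem_sdiff, mem_union] at he he'
          tauto
        rw [h2, card_union_of_disjoint h3, pow_add]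
        ring
      rw [sum_congr rfl fun ψ _ => h1 ψ, ← mul_sum]
      refine mul_le_mul_of_nonneg_left ?_ (by positivity)
      rw [hη]
      refine sum_partial_overlap_le hE x hp0 hG0 hG (U ∪ im φ E) (W ∪ range φ) ?_ ?_ ?_
      · exact union_subset ((hUW l).trans (sym2_mono subset_union_left))
          ((im_subset_sym2 φ E).trans (sym2_mono subset_union_right))
      · have := card_union_le W (range φ)
        rw [card_range] at this
        exact_mod_cast this.trans hWc
      · exact_mod_cast hw1
    refine (sum_le_sum hinner).trans ?_
    rw [← sum_mul]
    refine mul_le_mul_of_nonneg_right ?_ hη0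
    rw [hη]
    exact sum_sdiff_le hE hc x hp0 hp1 hG0 hG U W (hUW l) (by omega) hw1
  refine le_trans (bprob_mono hp0.le hp1 ?_) (bprob_extendable_le hp0.le hp1 I F (fun i _ =>
    union_subset (im_subset_allEdges hE _) (im_subset_allEdges hE _)) adm hM)
  intro s _ hs l hl hls
  by_contra hno
  have hno' : ∀ φ ∈ embs root x, ∀ ψ ∈ embs root x, im φ E ⊆ s → im ψ E ⊆ s →
      ¬Disjoint (im ψ E) (listUnion F l ∪ im φ E) → im ψ E ⊆ listUnion F l ∪ im φ E := by
    intro φ hφ ψ hψ h1 h2 h3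
    by_contra h4
    exact hno ⟨(φ, ψ), mem_product.2 ⟨hφ, hψ⟩, ⟨h3, h4⟩, union_subset h1 h2⟩
  set U := listUnion F l with hU
  -- If a list cannot be extended, every overlapping copy S lies in U. With its partner S' as first
  -- copy, S ⊆ U ∪ S', so S has an edge of U outside S'. Thus S meets U, and with a first copy a.1
  -- already in U the failure to extend gives S ⊆ U ∪ im a.1 = U. There are boundedly many copies
  -- inside U.
  have hsub : overlapping root E x s ⊆
      ((embs root x).filter fun φ => im φ E ⊆ U).image fun φ => im φ E := by
    intro S hS
    obtain ⟨hSc, hSs, S', hS'c, hS's, hne, hnd⟩ := mem_filter.1 hS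
    obtain ⟨φ, hφ, rfl⟩ := mem_copies.1 hSc
    obtain ⟨ψ, hψ, rfl⟩ := mem_copies.1 hS'c
    have h1 : im φ E ⊆ U ∪ im ψ E := hno' ψ hψ φ hφ hS's hSs fun h =>
      hnd (h.mono_right subset_union_right)
    have h2 : ∃ e ∈ im φ E, e ∉ im ψ E := by
      by_contra h
      push Not at h
      exact hne (eq_of_subset_of_card_le h (by rw [card_im, card_im])).symm
    obtain ⟨e, he, he'⟩ := h2
    have heU : e ∈ U := (mem_union.1 (h1 he)).resolve_right he'
    obtain ⟨a, ha, hea⟩ := mem_listUnion.1 heU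
    obtain ⟨haI, has⟩ := hls a ha
    have haU : im a.1 E ⊆ U := subset_union_left.trans (subset_listUnion (F := F) ha)
    have h3 := hno' a.1 (mem_product.1 haI).1 φ hφ (subset_union_left.trans has) hSs
      (not_disjoint_iff.2 ⟨e, he, mem_union_left _ heU⟩)
    refine mem_image.2 ⟨φ, mem_filter.2 ⟨hφ, ?_⟩, rfl⟩
    rwa [union_eq_left.2 haU] at h3
  have h1 : #(overlapping root E x s) ≤ w ^ c :=
    (card_le_card hsub).trans (card_image_le.trans
      (card_contained_le hc x U (listUnion rg l) (hUW l) (by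
        have := hcard l
        rw [hw]
        nlinarith) hw1))
  omega

theorem sum_copies_pow {root : κ ↪ V} {E : Finset (Sym2 V)} (x : κ ↪ Fin n) (p : ℝ) :
    ∑ S ∈ copies root E x, p ^ #S = #(copies root E x) * p ^ #E := by
  rw [sum_congr rfl fun S hS => by rw [card_of_mem_copies hS], sum_const, nsmul_eq_mul]

/-- The upper tail of the number of copies, near the threshold for their existence. -/
theorem upper_tail_copies {root : κ ↪ V} {E : Finset (Sym2 V)} (hE : IsExtEdges root E)
    (hc : Covers root E) (x : κ ↪ Fin n) {p G : ℝ} (hp0 : 0 < p) (hp1 : p ≤ 1) (hG0 : 0 < G)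
    (hG : OverlapBound root E n p G) (R : ℕ) (hV : 0 < Fintype.card V) {w : ℕ}
    (hw : w = (2 * R + 1) * Fintype.card V) {η : ℝ}
    (hη : η = 2 ^ Fintype.card V * (w : ℝ) ^ Fintype.card V * scale root E n p / G)
    (m r : ℕ) (hm : 0 < m) :
    bprob p (allEdges n) (fun s => m + r + w ^ Fintype.card V ≤ copyCount root E x s) ≤
      (#(copies root E x) * p ^ #E / m) ^ r +
        ((scale root E n p + η + (w : ℝ) ^ Fintype.card V) * η) ^ R := by
  classical
  have h1 := bprob_overlapping_le hE hc x hp0 hp1 hG0 hG R hV hw hη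
  have h2 := bprob_disjoint_family_le hp0.le hp1 (copies root E x)
    (fun S hS => subset_allEdges_of_mem_copies hE hS) m r hm
  rw [sum_copies_pow] at h2
  refine le_trans ?_ (add_le_add h2 h1)
  refine (bprob_mono hp0.le hp1 ?_).trans (bprob_or_le hp0.le hp1 _ _)
  intro s _ hs
  by_contra hcon
  push Not at hcon
  obtain ⟨h3, h4⟩ := hcon
  -- The present copies that overlap no other present copy are pairwise disjoint, and more than `m +
  -- r` of them being present is controlled by disjoint sequences.
  set D := (copies root E x).filter (· ⊆ s) \ overlapping root E x s with hD
  have h5 := h3 D (sdiff_subset.trans (filter_subset _ _))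
    (fun S hS => (mem_filter.1 (Finset.mem_sdiff.1 hS).1).2) (by
      intro S hS S' hS' hne
      by_contra hnd
      obtain ⟨hS1, hS2⟩ := Finset.mem_sdiff.1 hS
      obtain ⟨hS1', -⟩ := Finset.mem_sdiff.1 hS'
      rw [mem_filter] at hS1 hS1'
      exact hS2 (mem_filter.2 ⟨hS1.1, hS1.2, S', hS1'.1, hS1'.2, hne.symm, hnd⟩))
  have h6 := le_card_sdiff (overlapping root E x s) ((copies root E x).filter (· ⊆ s))
  rw [← hD] at h6
  rw [copyCount] at hs
  omega

/-! ### Strictly balanced rooted graphs and families of vertex-disjoint copies -/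

/-- Every proper rooted subgraph has a smaller density. -/
structure StrictlyBalanced (root : κ ↪ V) (E : Finset (Sym2 V)) : Prop where
  nonempty : E.Nonempty
  lt : ∀ A ⊆ free root, A.Nonempty → A ≠ free root →
    #(free root) * edgesIn root E A < #E * #A

theorem StrictlyBalanced.free_nonempty {root : κ ↪ V} {E : Finset (Sym2 V)}
    (hE : IsExtEdges root E) (h : StrictlyBalanced root E) : (free root).Nonempty := by
  obtain ⟨e, he⟩ := h.nonempty
  obtain ⟨v, -, hv⟩ := hE.exists_free e he
  exact ⟨v, mem_free.2 hv⟩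

/-- Deleting an isolated non-root would keep all edges on fewer vertices, giving a denser proper
rooted subgraph. -/
theorem StrictlyBalanced.covers {root : κ ↪ V} {E : Finset (Sym2 V)} (hE : IsExtEdges root E)
    (h : StrictlyBalanced root E) : Covers root E := by
  classical
  intro v hv
  by_contra hcon
  push Not at hcon
  set A := (free root).erase v with hA
  have h1 : edgesIn root E A = #E := by
    rw [edgesIn, filter_true_of_mem]
    intro e he u hu
    by_cases hur : u ∈ Set.range root
    · exact Or.inr hur
    · refine Or.inl (mem_erase.2 ⟨?_, mem_free.2 hur⟩)
      rintro rfl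
      exact hcon e he hu
  have h2 : A.Nonempty := by
    obtain ⟨e, he⟩ := h.nonempty
    obtain ⟨u, hu, hur⟩ := hE.exists_free e he
    refine ⟨u, mem_erase.2 ⟨?_, mem_free.2 hur⟩⟩
    rintro rfl
    exact hcon e he hu
  have h3 := h.lt A (erase_subset _ _) h2 fun h => by
    have : v ∈ A := h ▸ hv
    simp [hA] at this
  rw [h1, mul_comm] at h3
  have h4 := Nat.lt_of_mul_lt_mul_left h3
  have h5 := card_le_card (erase_subset v (free root))
  rw [← hA] at h5
  omega

/-- The vertices of a set of edges that are not roots. -/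
noncomputable def freeVerts (x : κ ↪ Fin n) (S : Finset (Sym2 (Fin n))) : Finset (Fin n) := by
  classical exact univ.filter fun a => a ∉ Set.range x ∧ ∃ e ∈ S, a ∈ e

theorem apply_not_mem_range {root : κ ↪ V} {x : κ ↪ Fin n} {φ : V ↪ Fin n}
    (hφ : φ ∈ embs root x) {v : V} (hv : v ∈ free root) : φ v ∉ Set.range x := by
  rintro ⟨j, hj⟩
  rw [← mem_embs.1 hφ j] at hj
  exact mem_free.1 hv ⟨j, φ.injective hj⟩

theorem freeVerts_im {root : κ ↪ V} {E : Finset (Sym2 V)} (hc : Covers root E) {x : κ ↪ Fin n}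
    {φ : V ↪ Fin n} (hφ : φ ∈ embs root x) : freeVerts x (im φ E) = (free root).map φ := by
  classical
  ext a
  simp only [freeVerts, mem_filter, mem_univ, true_and, Finset.mem_map]
  constructor
  · rintro ⟨ha, e, he, hae⟩
    obtain ⟨d, hd, rfl⟩ := mem_im.1 he
    obtain ⟨v, hv, rfl⟩ := Sym2.mem_map.1 hae
    refine ⟨v, mem_free.2 ?_, rfl⟩
    rintro ⟨j, rfl⟩
    exact ha ⟨j, (mem_embs.1 hφ j).symm⟩
  · rintro ⟨v, hv, rfl⟩
    obtain ⟨e, he, hve⟩ := hc v hv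
    exact ⟨apply_not_mem_range hφ hv, _, map_mem_im he, Sym2.mem_map.2 ⟨v, hve, rfl⟩⟩

/-- A union of vertex-disjoint copies contains no further copies. -/
theorem mem_of_subset_biUnion {root : κ ↪ V} {E : Finset (Sym2 V)} (hE : IsExtEdges root E)
    (hb : StrictlyBalanced root E) {x : κ ↪ Fin n} {t : Finset (Finset (Sym2 (Fin n)))}
    (htc : t ⊆ copies root E x)
    (hd : ∀ S ∈ t, ∀ S' ∈ t, S ≠ S' → Disjoint (freeVerts x S) (freeVerts x S'))
    {S : Finset (Sym2 (Fin n))} (hS : S ∈ copies root E x) (hSt : S ⊆ t.biUnion id) : S ∈ t := by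
  classical
  obtain ⟨φ, hφ, rfl⟩ := mem_copies.1 hS
  set A : Finset (Sym2 (Fin n)) → Finset V :=
    fun S' => (free root).filter fun v => φ v ∈ freeVerts x S' with hA
  have hmemA : ∀ S' e v, e ∈ E → e.map φ ∈ S' → v ∈ e → v ∈ free root → v ∈ A S' := by
    intro S' e v he heS hv hvf
    refine mem_filter.2 ⟨hvf, ?_⟩
    simp only [freeVerts, mem_filter, mem_univ, true_and]
    exact ⟨apply_not_mem_range hφ hvf, _, heS, Sym2.mem_map.2 ⟨v, hv, rfl⟩⟩
  have hex : ∀ e ∈ E, ∃ S' ∈ t, e.map φ ∈ S' := fun e he => by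
    simpa using hSt (map_mem_im he)
  have hdis : ∀ S' ∈ t, ∀ S'' ∈ t, S' ≠ S'' → Disjoint (A S') (A S'') := by
    intro S' h' S'' h'' hne
    rw [disjoint_left]
    intro v hv hv'
    exact disjoint_left.1 (hd S' h' S'' h'' hne) (mem_filter.1 hv).2 (mem_filter.1 hv').2
  have hsumA : ∑ S' ∈ t, #(A S') ≤ #(free root) := by
    rw [← card_biUnion hdis]
    exact card_le_card (biUnion_subset.2 fun S' _ => filter_subset _ _)
  have hsumE : #E ≤ ∑ S' ∈ t, edgesIn root E (A S') := by
    have : E ⊆ t.biUnion fun S' => E.filter fun e => ∀ v ∈ e, v ∈ A S' ∨ v ∈ Set.range root := by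
      intro e he
      obtain ⟨S', hS', heS'⟩ := hex e he
      refine mem_biUnion.2 ⟨S', hS', mem_filter.2 ⟨he, fun v hv => ?_⟩⟩
      by_cases hvr : v ∈ Set.range root
      · exact Or.inr hvr
      · exact Or.inl (hmemA S' e v he heS' hv (mem_free.2 hvr))
    exact (card_le_card this).trans card_biUnion_le
  -- The sets A S' are disjoint, and every edge of the new copy lies within one of them together
  -- with the roots. If all were proper, each would be less dense than the whole, and summing would
  -- give fewer than all edges.
  have hfull : ∃ S' ∈ t, A S' = free root := by
    by_contra hcon
    push Not at hcon
    have h1 : ∀ S' ∈ t, #(free root) * edgesIn root E (A S') ≤ #E * #(A S') := by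
      intro S' hS'
      rcases (A S').eq_empty_or_nonempty with h | h
      · rw [h, edgesIn_empty hE]; simp
      · exact (hb.lt _ (filter_subset _ _) h (hcon S' hS')).le
    have h2 : ∃ S' ∈ t, #(free root) * edgesIn root E (A S') < #E * #(A S') := by
      obtain ⟨e, he⟩ := hb.nonempty
      obtain ⟨v, hv, hvr⟩ := hE.exists_free e he
      obtain ⟨S', hS', heS'⟩ := hex e he
      exact ⟨S', hS', hb.lt _ (filter_subset _ _)
        ⟨v, hmemA S' e v he heS' hv (mem_free.2 hvr)⟩ (hcon S' hS')⟩
    have h3 := sum_lt_sum h1 h2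
    rw [← mul_sum, ← mul_sum] at h3
    have h4 := Nat.mul_le_mul_left #(free root) hsumE
    have h5 := Nat.mul_le_mul_left #E hsumA
    rw [mul_comm #E #(free root)] at h5
    omega
  obtain ⟨S', hS', hAS'⟩ := hfull
  have hsub : im φ E ⊆ S' := by
    intro e he
    obtain ⟨d, hd', rfl⟩ := mem_im.1 he
    obtain ⟨S'', hS'', hdS''⟩ := hex d hd'
    obtain ⟨v, hv, hvr⟩ := hE.exists_free d hd'
    have hv'' := hmemA S'' d v hd' hdS'' hv (mem_free.2 hvr)
    have hv' : v ∈ A S' := hAS' ▸ mem_free.2 hvr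
    have : S'' = S' := by
      by_contra hne
      exact disjoint_left.1 (hdis S'' hS'' S' hS' hne) hv'' hv'
    rwa [this] at hdS''
  rwa [eq_of_subset_of_card_le hsub (by rw [card_of_mem_copies (htc hS'), card_im])]

/-- The families of `z` vertex-disjoint copies. -/
noncomputable def disjointFamilies (root : κ ↪ V) (E : Finset (Sym2 V)) (x : κ ↪ Fin n) (z : ℕ) :
    Finset (Finset (Finset (Sym2 (Fin n)))) := by
  classical exact ((copies root E x).powersetCard z).filter fun t =>
    ∀ S ∈ t, ∀ S' ∈ t, S ≠ S' → Disjoint (freeVerts x S) (freeVerts x S')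

theorem card_embs_meeting_le (root : κ ↪ V) (x : κ ↪ Fin n) (W : Finset (Fin n))
    (P : (V ↪ Fin n) → Prop) [DecidablePred P] (hP : ∀ φ, P φ → ∃ v ∈ free root, φ v ∈ W) :
    #((embs root x).filter P) ≤ Fintype.card V * (#W * n ^ (#(free root) - 1)) := by
  classical
  have h1 : (embs root x).filter P ⊆
      (free root).biUnion fun v => (embs root x).filter fun φ => φ v ∈ W := by
    intro φ hφ
    obtain ⟨hφ1, hφ2⟩ := mem_filter.1 hφ
    obtain ⟨v, hv, hvW⟩ := hP φ hφ2
    exact mem_biUnion.2 ⟨v, hv, mem_filter.2 ⟨hφ1, hvW⟩⟩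
  refine (card_le_card h1).trans (card_biUnion_le.trans ?_)
  have h2 : ∀ v ∈ free root, #((embs root x).filter fun φ => φ v ∈ W) ≤
      #W * n ^ (#(free root) - 1) := by
    intro v hv
    have := card_embs_filter_le root x (A := {v}) (by simpa using hv) W (fun φ => φ v ∈ W)
      (by simp)
    simpa using this
  refine (sum_le_card_nsmul _ _ _ h2).trans ?_
  rw [smul_eq_mul]
  exact Nat.mul_le_mul_right _ (card_free_le root)

/-- Double counting of inclusions t ⊆ t'. A family t of size z extends by each copy avoiding its at
most z|V| non-root vertices, and a family of size z+1 has only z+1 subfamilies of size z. -/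
theorem card_disjointFamilies_succ {root : κ ↪ V} {E : Finset (Sym2 V)} (hE : IsExtEdges root E)
    (hb : StrictlyBalanced root E) (x : κ ↪ Fin n) (z : ℕ) :
    #(disjointFamilies root E x z) *
        (#(copies root E x) - z * (Fintype.card V ^ 2 * n ^ (#(free root) - 1))) ≤
      #(disjointFamilies root E x (z + 1)) * (z + 1) := by
  classical
  have hc := hb.covers hE
  refine card_mul_le_card_mul (fun t t' => t ⊆ t') ?_ ?_
  · intro t ht
    obtain ⟨ht1, htd⟩ := mem_filter.1 ht
    obtain ⟨htc, htz⟩ := mem_powersetCard.1 ht1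
    set W := t.biUnion (freeVerts x) with hW
    have hWc : #W ≤ z * Fintype.card V := by
      refine (card_biUnion_le_card_mul t _ (Fintype.card V) ?_).trans_eq (by rw [htz])
      intro S hS
      obtain ⟨φ, hφ, rfl⟩ := mem_copies.1 (htc hS)
      rw [freeVerts_im hc hφ, card_map]
      exact card_free_le root
    set N := (copies root E x).filter fun S => Disjoint (freeVerts x S) W with hN
    have hNnot : ∀ S ∈ N, S ∉ t := by
      intro S hS hSt
      obtain ⟨hS1, hS2⟩ := mem_filter.1 hS
      obtain ⟨φ, hφ, rfl⟩ := mem_copies.1 hS1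
      obtain ⟨v, hv⟩ := hb.free_nonempty hE
      have hmem : φ v ∈ freeVerts x (im φ E) := by
        rw [freeVerts_im hc hφ]; exact Finset.mem_map.2 ⟨v, hv, rfl⟩
      exact disjoint_left.1 hS2 hmem (mem_biUnion.2 ⟨_, hSt, hmem⟩)
    have h1 : #(copies root E x) - z * (Fintype.card V ^ 2 * n ^ (#(free root) - 1)) ≤ #N := by
      have h2 : #((copies root E x).filter fun S => ¬Disjoint (freeVerts x S) W) ≤
          Fintype.card V * (#W * n ^ (#(free root) - 1)) := by
        have h3 : ((copies root E x).filter fun S => ¬Disjoint (freeVerts x S) W) ⊆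
            ((embs root x).filter fun φ => ∃ v ∈ free root, φ v ∈ W).image fun φ => im φ E := by
          intro S hS
          obtain ⟨hS1, hS2⟩ := mem_filter.1 hS
          obtain ⟨φ, hφ, rfl⟩ := mem_copies.1 hS1
          rw [freeVerts_im hc hφ, not_disjoint_iff] at hS2
          obtain ⟨a, ha, haW⟩ := hS2
          obtain ⟨v, hv, rfl⟩ := Finset.mem_map.1 ha
          exact mem_image.2 ⟨φ, mem_filter.2 ⟨hφ, v, hv, haW⟩, rfl⟩
        exact (card_le_card h3).trans (card_image_le.trans
          (card_embs_meeting_le root x W _ fun φ h => h))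
      have h4 := card_filter_add_card_filter_not (s := copies root E x)
        (fun S => Disjoint (freeVerts x S) W)
      have h5 : Fintype.card V * (#W * n ^ (#(free root) - 1)) ≤
          z * (Fintype.card V ^ 2 * n ^ (#(free root) - 1)) := by
        calc Fintype.card V * (#W * n ^ (#(free root) - 1)) ≤
            Fintype.card V * (z * Fintype.card V * n ^ (#(free root) - 1)) := by gcongr
          _ = _ := by ring
      rw [← hN] at h4
      omega
    refine h1.trans (card_le_card_of_injOn (fun S => insert S t) ?_ ?_)
    · intro S hS
      obtain ⟨hS1, hS2⟩ := mem_filter.1 hS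
      have hSt := hNnot S hS
      have hdS : ∀ S' ∈ t, Disjoint (freeVerts x S) (freeVerts x S') := fun S' hS' =>
        hS2.mono_right (subset_biUnion_of_mem (freeVerts x) hS')
      refine mem_filter.2 ⟨mem_filter.2 ⟨mem_powersetCard.2 ⟨insert_subset hS1 htc, ?_⟩, ?_⟩,
        subset_insert _ _⟩
      · rw [card_insert_of_notMem hSt, htz]
      · intro S₁ h₁ S₂ h₂ hne
        rcases mem_insert.1 h₁ with rfl | h₁' <;> rcases mem_insert.1 h₂ with rfl | h₂'
        · exact absurd rfl hne
        · exact hdS _ h₂'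
        · exact (hdS _ h₁').symm
        · exact htd _ h₁' _ h₂' hne
    · intro S hS S' hS' h
      have : S ∈ insert S' t := by
        have h' : insert S t = insert S' t := h
        rw [← h']; exact mem_insert_self _ _
      exact (mem_insert.1 this).resolve_right (hNnot S hS)
  · intro t' ht'
    have hz : #t' = z + 1 := (mem_powersetCard.1 (mem_filter.1 ht').1).2
    have : bipartiteBelow (fun t t' => t ⊆ t') (disjointFamilies root E x z) t' ⊆
        t'.powersetCard z := by
      intro t ht
      obtain ⟨h1, h2⟩ := mem_filter.1 ht
      exact mem_powersetCard.2 ⟨h2, (mem_powersetCard.1 (mem_filter.1 h1).1).2⟩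
    refine (card_le_card this).trans (le_of_eq ?_)
    rw [card_powersetCard, hz, Nat.choose_succ_self_right]

/-- The bound `Z` for `z` fixes the base of the power throughout the induction. -/
theorem pow_le_card_disjointFamilies {root : κ ↪ V} {E : Finset (Sym2 V)}
    (hE : IsExtEdges root E) (hb : StrictlyBalanced root E) (x : κ ↪ Fin n) (Z z : ℕ) (hz : z ≤ Z) :
    (#(copies root E x) - Z * (Fintype.card V ^ 2 * n ^ (#(free root) - 1))) ^ z ≤
      #(disjointFamilies root E x z) * z.factorial := by
  classical
  induction z with
  | zero =>
    rw [pow_zero, Nat.factorial_zero, mul_one, Nat.one_le_iff_ne_zero, card_ne_zero]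
    exact ⟨∅, mem_filter.2 ⟨by simp, by simp⟩⟩
  | succ z ih =>
    have ih := ih (by omega)
    have h1 := card_disjointFamilies_succ hE hb x z
    have h2 : #(copies root E x) - Z * (Fintype.card V ^ 2 * n ^ (#(free root) - 1)) ≤
        #(copies root E x) - z * (Fintype.card V ^ 2 * n ^ (#(free root) - 1)) :=
      Nat.sub_le_sub_left (Nat.mul_le_mul_right _ (by omega)) _
    rw [pow_succ, Nat.factorial_succ]
    calc _ ≤ (#(disjointFamilies root E x z) * z.factorial) *
          (#(copies root E x) - z * (Fintype.card V ^ 2 * n ^ (#(free root) - 1))) :=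
          Nat.mul_le_mul ih h2
      _ = (#(disjointFamilies root E x z) *
          (#(copies root E x) - z * (Fintype.card V ^ 2 * n ^ (#(free root) - 1)))) *
            z.factorial := by ring
      _ ≤ (#(disjointFamilies root E x (z + 1)) * (z + 1)) * z.factorial :=
          Nat.mul_le_mul_right _ h1
      _ = _ := by ring

/-- A lower bound for the probability of having at least `z` copies, near the threshold for the
existence of copies. -/
theorem le_bprob_copyCount {root : κ ↪ V} {E : Finset (Sym2 V)} (hE : IsExtEdges root E)
    (hb : StrictlyBalanced root E) (x : κ ↪ Fin n) {p G : ℝ} (hp0 : 0 < p) (hp1 : p ≤ 1 / 2)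
    (hG0 : 0 < G) (hG : OverlapBound root E n p G) (z : ℕ)
    (hη : 2 ^ Fintype.card V * ((z * Fintype.card V + 1 : ℕ) : ℝ) ^ Fintype.card V *
      scale root E n p / G ≤ 1)
    (hpL : p * (#(copies root E x) * p ^ #E + 1) ≤ 1) :
    (((#(copies root E x) - z * (Fintype.card V ^ 2 * n ^ (#(free root) - 1)) : ℕ) : ℝ) *
        p ^ #E) ^ z / z.factorial * Real.exp (-(#(copies root E x) * p ^ #E + 3)) ≤
      bprob p (allEdges n) fun s => z ≤ copyCount root E x s := by
  classical
  have hc := hb.covers hE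
  set l := #(copies root E x) * p ^ #E with hl
  -- In the exponent, `l` accounts for the unconditioned cost of all copies and 1 for those
  -- partially overlapping the chosen family. By strict balance the union of the family contains no
  -- further copy, so exact presence can be prescribed.
  have h1 := le_bprob_card_ge hp0.le hp1 (copies root E x)
    (fun S hS => subset_allEdges_of_mem_copies hE hS) (disjointFamilies root E x z) z (z * #E)
    (L := l + 1) hpL ?_
  · refine le_trans ?_ h1
    have h2 : (((#(copies root E x) - z * (Fintype.card V ^ 2 * n ^ (#(free root) - 1)) : ℕ) : ℝ))
        ^ z / z.factorial ≤ #(disjointFamilies root E x z) := by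
      rw [div_le_iff₀ (by positivity)]
      exact_mod_cast pow_le_card_disjointFamilies hE hb x z z le_rfl
    rw [mul_pow, ← pow_mul, mul_comm #E z, show l + 1 + 2 = l + 3 by ring, mul_div_right_comm,
      mul_assoc]
    exact mul_le_mul_of_nonneg_right h2 (by positivity)
  · intro t ht
    obtain ⟨ht1, htd⟩ := mem_filter.1 ht
    obtain ⟨htc, htz⟩ := mem_powersetCard.1 ht1
    have hns : ∀ S ∈ copies root E x \ t, ¬S ⊆ t.biUnion id := by
      intro S hS hSU
      obtain ⟨hS1, hS2⟩ := Finset.mem_sdiff.1 hS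
      exact hS2 (mem_of_subset_biUnion hE hb htc htd hS1 hSU)
    refine ⟨htc, htz, ?_, ?_, hns⟩
    · refine (card_biUnion_le_card_mul t id #E fun S hS => ?_).trans_eq (by rw [htz])
      exact (card_of_mem_copies (htc hS)).le
    · set U := t.biUnion id with hU
      have hW : ∃ W : Finset (Fin n), U ⊆ W.sym2 ∧ #W ≤ z * Fintype.card V := by
        have : ∀ S : Finset (Sym2 (Fin n)), ∃ W : Finset (Fin n), S ∈ t →
            S ⊆ W.sym2 ∧ #W ≤ Fintype.card V := by
          intro S
          by_cases hS : S ∈ t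
          · obtain ⟨φ, -, rfl⟩ := mem_copies.1 (htc hS)
            exact ⟨range φ, fun _ => ⟨im_subset_sym2 φ E, (card_range φ).le⟩⟩
          · exact ⟨∅, fun h => absurd h hS⟩
        choose w hw using this
        refine ⟨t.biUnion w, biUnion_subset.2 fun S hS => (hw S hS).1.trans
          (sym2_mono (subset_biUnion_of_mem w hS)), ?_⟩
        exact (card_biUnion_le_card_mul t w _ fun S hS => (hw S hS).2).trans_eq (by rw [htz])
      obtain ⟨W, hUW, hWc⟩ := hW
      have h3 : ∀ S ∈ copies root E x \ t, p ^ #(S \ U) ≤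
          p ^ #E + ind (¬Disjoint S U ∧ ¬S ⊆ U) * p ^ #(S \ U) := by
        intro S hS
        have hSc := (Finset.mem_sdiff.1 hS).1
        by_cases h : Disjoint S U
        · rw [sdiff_eq_self_of_disjoint h, card_of_mem_copies hSc, ind_of_not fun h' => h'.1 h]
          simp
        · rw [ind_of ⟨h, hns S hS⟩, one_mul]
          exact le_add_of_nonneg_left (by positivity)
      refine (sum_le_sum h3).trans ?_
      refine (sum_le_sum_of_subset_of_nonneg (sdiff_subset (s := copies root E x) (t := t))
        fun S _ _ => add_nonneg (by positivity)
          (mul_nonneg (ind_nonneg _) (by positivity))).trans ?_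
      rw [sum_add_distrib, sum_const, nsmul_eq_mul, ← hl]
      refine add_le_add le_rfl (le_trans ?_ hη)
      refine (sum_copies_le hc x (fun S => ind (¬Disjoint S U ∧ ¬S ⊆ U) * p ^ #(S \ U))
        fun S => mul_nonneg (ind_nonneg _) (by positivity)).trans ?_
      exact sum_partial_overlap_le hE x hp0 hG0 hG U W hUW
        (by exact_mod_cast hWc.trans (Nat.le_succ _)) (by push_cast; nlinarith
          [(by positivity : (0:ℝ) ≤ (z : ℝ) * Fintype.card V)])

/-! ### Correlation between different tuples of roots -/

/-- Copies at different tuples of roots are unlikely to share edges. -/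
theorem sum_cross_overlap_le {root : κ ↪ V} {E : Finset (Sym2 V)} (hE : IsExtEdges root E)
    (hb : StrictlyBalanced root E) (x y : κ ↪ Fin n) {p G : ℝ} (hp0 : 0 < p)
    (hG0 : 0 < G) (hG : OverlapBound root E n p G) {j : κ} {u : V} (hju : s(root j, u) ∈ E)
    (hj : y j ∉ Set.range x) :
    ∑ φ ∈ embs root x, ∑ ψ ∈ embs root y,
        ind (¬Disjoint (im φ E) (im ψ E)) * p ^ #(im φ E ∪ im ψ E) ≤
      (2 * Fintype.card V : ℝ) ^ Fintype.card V * scale root E n p ^ 2 / G +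
        (Fintype.card V : ℝ) ^ (Fintype.card V + 1) * scale root E n p / n := by
  classical
  have hc := hb.covers hE
  set c := Fintype.card V with hc'
  have hc1 : 1 ≤ c := Fintype.card_pos_iff.2 ⟨u⟩
  have hn : 0 < n := (y j).pos
  have h1 : ∀ φ ∈ embs root x, ∀ ψ ∈ embs root y,
      ind (¬Disjoint (im φ E) (im ψ E)) * p ^ #(im φ E ∪ im ψ E) ≤
      p ^ #E * (ind (¬Disjoint (im ψ E) (im φ E) ∧ ¬im ψ E ⊆ im φ E) * p ^ #(im ψ E \ im φ E)) +
        p ^ #E * (ind (∃ v ∈ free root, φ v ∈ ({y j} : Finset (Fin n))) *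
          ind (im ψ E ⊆ im φ E)) := by
    intro φ hφ ψ hψ
    by_cases hd : Disjoint (im φ E) (im ψ E)
    · rw [ind_of_not (not_not.2 hd), zero_mul]
      exact add_nonneg (mul_nonneg (by positivity) (mul_nonneg (ind_nonneg _) (by positivity)))
        (mul_nonneg (by positivity) (mul_nonneg (ind_nonneg _) (ind_nonneg _)))
    · rw [ind_of hd, one_mul, union_comm, ← sdiff_union_self_eq_union,
        card_union_of_disjoint sdiff_disjoint, card_im, add_comm, pow_add]
      -- Groundedness enters here: the edge at root j makes `y j` a vertex of the edges of ψ. If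
      -- these are contained in those of φ, then φ maps a non-root to `y j`, since `y j` is not
      -- among the roots x; this leaves a factor n fewer choices for φ.
      by_cases hs : im ψ E ⊆ im φ E
      · have hex : ∃ v ∈ free root, φ v ∈ ({y j} : Finset (Fin n)) := by
          have h2 : Sym2.map ψ s(root j, u) ∈ im φ E := hs (map_mem_im hju)
          have h3 : y j ∈ range φ := by
            refine mem_sym2_iff.1 (im_subset_sym2 φ E h2) _ ?_
            rw [Sym2.mem_map]
            exact ⟨root j, Sym2.mem_mk_left _ _, mem_embs.1 hψ j⟩
          obtain ⟨v, -, hv⟩ := Finset.mem_map.1 h3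
          refine ⟨v, mem_free.2 ?_, mem_singleton.2 hv⟩
          rintro ⟨i, rfl⟩
          exact hj ⟨i, by rw [← hv, mem_embs.1 hφ]⟩
        rw [ind_of hs, ind_of hex, ind_of_not fun h => h.2 hs, sdiff_eq_empty_iff_subset.2 hs]
        simp
      · rw [ind_of ⟨fun h => hd h.symm, hs⟩, ind_of_not hs]
        simp
  refine (sum_le_sum fun φ hφ => sum_le_sum fun ψ hψ => h1 φ hφ ψ hψ).trans ?_
  simp only [sum_add_distrib, ← mul_sum]
  refine add_le_add ?_ ?_
  · have h2 : ∀ φ ∈ embs root x, ∑ ψ ∈ embs root y,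
        ind (¬Disjoint (im ψ E) (im φ E) ∧ ¬im ψ E ⊆ im φ E) * p ^ #(im ψ E \ im φ E) ≤
        2 ^ c * (c : ℝ) ^ c * scale root E n p / G := fun φ _ =>
      sum_partial_overlap_le hE y hp0 hG0 hG (im φ E) (range φ) (im_subset_sym2 φ E)
        (by rw [card_range]) (by exact_mod_cast hc1)
    have h3 := sum_le_card_nsmul _ _ _ h2
    rw [nsmul_eq_mul, card_embs] at h3
    calc p ^ #E * _ ≤ p ^ #E * (numEmbs root n * (2 ^ c * (c : ℝ) ^ c * scale root E n p / G)) :=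
          mul_le_mul_of_nonneg_left h3 (by positivity)
      _ ≤ p ^ #E * ((n : ℝ) ^ #(free root) * (2 ^ c * (c : ℝ) ^ c * scale root E n p / G)) := by
          have hs : 0 ≤ scale root E n p := by unfold scale; positivity
          gcongr
          exact numEmbs_le root n
      _ = _ := by rw [mul_pow, scale]; ring
  · have h2 : ∀ φ ∈ embs root x, ∑ ψ ∈ embs root y, ind (im ψ E ⊆ im φ E) ≤ (c : ℝ) ^ c := by
      intro φ _
      rw [sum_ind]
      exact_mod_cast card_contained_le hc y (im φ E) (range φ) (im_subset_sym2 φ E)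
        (card_range φ).le hc1
    have h3 := card_embs_meeting_le root x {y j}
      (fun φ => ∃ v ∈ free root, φ v ∈ ({y j} : Finset (Fin n))) fun φ h => h
    rw [card_singleton, one_mul] at h3
    have hv : 1 ≤ #(free root) := (hb.free_nonempty hE).card_pos
    calc p ^ #E * ∑ φ ∈ embs root x, ind (∃ v ∈ free root, φ v ∈ ({y j} : Finset (Fin n))) *
          ∑ ψ ∈ embs root y, ind (im ψ E ⊆ im φ E)
        ≤ p ^ #E * ∑ φ ∈ embs root x, ind (∃ v ∈ free root, φ v ∈ ({y j} : Finset (Fin n))) *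
            (c : ℝ) ^ c := by
          refine mul_le_mul_of_nonneg_left (sum_le_sum fun φ hφ => ?_) (by positivity)
          exact mul_le_mul_of_nonneg_left (h2 φ hφ) (ind_nonneg _)
      _ ≤ p ^ #E * ((c * (n : ℝ) ^ (#(free root) - 1)) * (c : ℝ) ^ c) := by
          rw [← sum_mul, sum_ind]
          gcongr
          exact_mod_cast h3
      _ = _ := by
          have hn' : (n : ℝ) ≠ 0 := by positivity
          rw [scale, ← Nat.sub_add_cancel hv, pow_succ, Nat.add_sub_cancel]
          field_simp
          exact (pow_succ _ _).symm

/-- Having many copies at two different tuples of roots is nearly negatively correlated. -/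
theorem bprob_two_copyCounts_le {root : κ ↪ V} {E : Finset (Sym2 V)} (hE : IsExtEdges root E)
    (hb : StrictlyBalanced root E) (x y : κ ↪ Fin n) {p G : ℝ} (hp0 : 0 < p) (hp1 : p ≤ 1)
    (hG0 : 0 < G) (hG : OverlapBound root E n p G) {j : κ} {u : V} (hju : s(root j, u) ∈ E)
    (hj : y j ∉ Set.range x) (z : ℕ) :
    bprob p (allEdges n) (fun s => z ≤ copyCount root E x s ∧ z ≤ copyCount root E y s) ≤
      bprob p (allEdges n) (fun s => z ≤ copyCount root E x s) *
        bprob p (allEdges n) (fun s => z ≤ copyCount root E y s) +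
      ((2 * Fintype.card V : ℝ) ^ Fintype.card V * scale root E n p ^ 2 / G +
        (Fintype.card V : ℝ) ^ (Fintype.card V + 1) * scale root E n p / n) := by
  classical
  have mono : ∀ x : κ ↪ Fin n, ∀ s t, s ⊆ t → z ≤ copyCount root E x s →
      z ≤ copyCount root E x t := by
    intro x s t hst h
    refine h.trans (card_le_card fun S hS => ?_)
    obtain ⟨h1, h2⟩ := mem_filter.1 hS
    exact mem_filter.2 ⟨h1, h2.trans hst⟩
  -- Either no present copy at x shares an edge with one at y, and then the two counts have disjoint
  -- witnesses, or two overlapping copies exist, which is bounded by the first moment.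
  have hBK := bprob_disjointlyOccur_le (T := allEdges n) hp0.le hp1 (mono x) (mono y)
  have hcross : bprob p (allEdges n) (fun s => ∃ φ ∈ embs root x, ∃ ψ ∈ embs root y,
      ¬Disjoint (im φ E) (im ψ E) ∧ im φ E ∪ im ψ E ⊆ s) ≤ _ :=
    le_trans ?_ (sum_cross_overlap_le hE hb x y hp0 hG0 hG hju hj)
  · refine le_trans ?_ (add_le_add hBK hcross)
    refine (bprob_mono hp0.le hp1 ?_).trans (bprob_or_le hp0.le hp1 _ _)
    rintro s - ⟨h1, h2⟩
    by_contra hcon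
    push Not at hcon
    obtain ⟨h3, h4⟩ := hcon
    refine h3 ⟨((copies root E x).filter (· ⊆ s)).biUnion id,
      ((copies root E y).filter (· ⊆ s)).biUnion id, ?_, ?_, ?_, ?_, ?_⟩
    · exact biUnion_subset.2 fun S hS => (mem_filter.1 hS).2
    · exact biUnion_subset.2 fun S hS => (mem_filter.1 hS).2
    · rw [disjoint_biUnion_left]
      intro S hS
      rw [disjoint_biUnion_right]
      intro S' hS'
      obtain ⟨hS1, hS2⟩ := mem_filter.1 hS
      obtain ⟨hS1', hS2'⟩ := mem_filter.1 hS'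
      obtain ⟨φ, hφ, rfl⟩ := mem_copies.1 hS1
      obtain ⟨ψ, hψ, rfl⟩ := mem_copies.1 hS1'
      by_contra hnd
      exact h4 φ hφ ψ hψ hnd (union_subset hS2 hS2')
    · refine h1.trans (card_le_card fun S hS => ?_)
      exact mem_filter.2 ⟨(mem_filter.1 hS).1, subset_biUnion_of_mem id hS⟩
    · refine h2.trans (card_le_card fun S hS => ?_)
      exact mem_filter.2 ⟨(mem_filter.1 hS).1, subset_biUnion_of_mem id hS⟩
  · refine (bprob_exists_le hp0.le hp1 _ _).trans (sum_le_sum fun φ _ => ?_)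
    refine (bprob_exists_le hp0.le hp1 _ _).trans (sum_le_sum fun ψ _ => ?_)
    by_cases h : Disjoint (im φ E) (im ψ E)
    · rw [bprob_eq_zero fun s _ hs => hs.1 h]
      exact mul_nonneg (ind_nonneg _) (by positivity)
    · rw [ind_of h, one_mul, ← bprob_subset (union_subset (im_subset_allEdges hE φ)
        (im_subset_allEdges hE ψ))]
      exact bprob_mono hp0.le hp1 fun s _ hs => hs.2

end RootedExtension
-- Asymptotic upper tails
namespace RootedExtension

open Finset BernoulliSubset

theorem eventually_mul_rpow_le (C : ℝ) {a b : ℝ} (h : a < b) :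
    ∀ᶠ n : ℕ in atTop, C * (n : ℝ) ^ a ≤ (n : ℝ) ^ b := by
  have h1 : Tendsto (fun n : ℕ => (n : ℝ) ^ (b - a)) atTop atTop :=
    (tendsto_rpow_atTop (sub_pos.2 h)).comp tendsto_natCast_atTop_atTop
  filter_upwards [h1.eventually_ge_atTop C, eventually_gt_atTop 0] with n hn hn0
  have hn0' : (0 : ℝ) < n := by exact_mod_cast hn0
  calc C * (n : ℝ) ^ a ≤ (n : ℝ) ^ (b - a) * (n : ℝ) ^ a := by gcongr
    _ = (n : ℝ) ^ b := by rw [← Real.rpow_add hn0', sub_add_cancel]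

theorem eventually_mul_log_le (C : ℝ) {b : ℝ} (hb : 0 < b) :
    ∀ᶠ n : ℕ in atTop, C * Real.log n ≤ (n : ℝ) ^ b := by
  have h := ((isLittleO_log_rpow_atTop hb).comp_tendsto
    tendsto_natCast_atTop_atTop).bound (c := 1 / (|C| + 1)) (by positivity)
  filter_upwards [h, eventually_ge_atTop 1] with n hn hn1
  have hn1' : (1 : ℝ) ≤ n := by exact_mod_cast hn1
  have hl : 0 ≤ Real.log n := Real.log_nonneg hn1'
  simp only [Function.comp, Real.norm_eq_abs] at hn
  rw [abs_of_nonneg hl, abs_of_nonneg (Real.rpow_nonneg (by positivity) _), div_mul_eq_mul_div,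
    one_mul, le_div_iff₀ (by positivity)] at hn
  calc C * Real.log n ≤ (|C| + 1) * Real.log n :=
        mul_le_mul_of_nonneg_right (by linarith [le_abs_self C]) hl
    _ ≤ _ := by linarith

theorem eventually_le_log (C : ℝ) : ∀ᶠ n : ℕ in atTop, C ≤ Real.log n :=
  (Real.tendsto_log_atTop.comp tendsto_natCast_atTop_atTop).eventually_ge_atTop C

theorem eventually_pow_mul_exp_le (k : ℝ) {C b : ℝ} (hC : 0 < C) (hb : 0 < b) :
    ∀ᶠ n : ℕ in atTop, Real.exp (-((n : ℝ) ^ b * C)) ≤ (n : ℝ) ^ (-k) := by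
  filter_upwards [eventually_mul_log_le (k / C) hb, eventually_ge_atTop 1] with n hn hn1
  have hn1' : (0 : ℝ) < n := by exact_mod_cast hn1
  rw [Real.rpow_def_of_pos hn1' (-k), Real.exp_le_exp]
  have := mul_le_mul_of_nonneg_right hn hC.le
  have e : k / C * Real.log n * C = k * Real.log n := by field_simp
  linarith

variable {κ V : Type*} [Fintype κ] [Fintype V]

/-- The upper tail when all partial extensions are polynomially abundant. -/
theorem eventually_upper_tail {root : κ ↪ V} {E : Finset (Sym2 V)} (hE : IsExtEdges root E)
    {α β : ℝ} (hα : 0 < α) (hαβ : α * (2 * Fintype.card V + 1) < β) :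
    ∀ᶠ n : ℕ in atTop, ∀ p : ℝ, 0 < p → p ≤ 1 →
      (∀ A ⊆ free root, A.Nonempty → (n : ℝ) ^ β ≤ (n : ℝ) ^ #A * p ^ edgesIn root E A) →
      ∀ ε : ℝ, (n : ℝ) ^ (-α) ≤ ε → ε ≤ 1 → ∀ x : κ ↪ Fin n,
        bprob p (allEdges n) (fun s => (1 + ε) * embMean root E n p ≤ embCount root E x s) ≤
          Real.exp (-((n : ℝ) ^ α * (1 / 4))) := by
  set c := Fintype.card V with hc
  have e1 := eventually_mul_rpow_le (4 * (4 ^ c * (2 * c + 1 : ℝ) ^ c))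
    (a := 2 * α * c + α) (b := β) (by linarith)
  filter_upwards [e1, eventually_ge_atTop (2 * c + 1)] with n h1 hn p hp0 hp1 hgA ε hε hε1 x
  have hn0 : 0 < n := by omega
  have hN0 : (0 : ℝ) < n := by exact_mod_cast hn0
  have hN1 : (1 : ℝ) ≤ n := by exact_mod_cast hn0
  set N : ℝ := (n : ℝ) with hN
  have hε0 : 0 < ε := (Real.rpow_pos_of_pos hN0 _).trans_le hε
  set r := ⌈N ^ (2 * α)⌉₊ with hr
  have hN2 : 1 ≤ N ^ (2 * α) := Real.one_le_rpow hN1 (by linarith)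
  have hr1 : N ^ (2 * α) ≤ r := Nat.le_ceil _
  have hr2 : (r : ℝ) ≤ 2 * N ^ (2 * α) := by
    have := Nat.ceil_lt_add_one (by positivity : 0 ≤ N ^ (2 * α))
    linarith
  have hpow : (N ^ (2 * α)) ^ c = N ^ (2 * α * c) := by
    rw [← Real.rpow_natCast, ← Real.rpow_mul hN0.le]
  refine (upper_tail_of_abundant hE x hp0 hp1 (Real.rpow_pos_of_pos hN0 β) (by omega) hn0 hgA hε0
    hε1 r ?_).trans ?_
  · have h2 : ((r * c + 1 : ℕ) : ℝ) ≤ (2 * c + 1) * N ^ (2 * α) := by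
      push_cast
      nlinarith [mul_le_mul_of_nonneg_right hr2 (Nat.cast_nonneg c : (0:ℝ) ≤ c)]
    calc 4 ^ c * ((r * c + 1 : ℕ) : ℝ) ^ c ≤ 4 ^ c * ((2 * c + 1) * N ^ (2 * α)) ^ c := by
          gcongr
      _ = (4 * (4 ^ c * (2 * c + 1 : ℝ) ^ c)) * N ^ (2 * α * c + α) * (N ^ (-α) / 4) := by
          rw [mul_pow, hpow, Real.rpow_add hN0, Real.rpow_neg hN0.le]
          field_simp
      _ ≤ N ^ β * (ε / 4) := by gcongr
      _ = _ := by ring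
  · rw [Real.exp_le_exp, neg_le_neg_iff]
    have h3 : N ^ α = N ^ (-α) * N ^ (2 * α) := by
      rw [← Real.rpow_add hN0]; congr 1; ring
    have h4 : N ^ (-α) * N ^ (2 * α) ≤ ε * r := by gcongr
    rw [h3]
    linarith

theorem one_div_pow_le_exp {ε : ℝ} (h0 : 0 ≤ ε) (h1 : ε ≤ 1) (r : ℕ) :
    (1 / (1 + ε / 4)) ^ r ≤ Real.exp (-(ε / 8 * r)) := by
  have h : 1 / (1 + ε / 4) ≤ Real.exp (-(ε / 8)) := by
    calc 1 / (1 + ε / 4) ≤ 1 - ε / 8 := by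
          rw [div_le_iff₀ (by positivity)]; nlinarith
      _ ≤ _ := by linarith [Real.add_one_le_exp (-(ε / 8))]
  refine (pow_le_pow_left₀ (by positivity) h r).trans (le_of_eq ?_)
  rw [← Real.exp_nat_mul]
  congr 1
  ring

/-- Each of about εl/4 factors gains ε/8 in the exponent, together about ε²l/32. The rounding of `r`
is absorbed by using K + 1 in the hypothesis. -/
theorem div_pow_le_exp {l ε m K L : ℝ} {r : ℕ} (hl : 0 < l) (h0 : 0 < ε) (h1 : ε ≤ 1)
    (hm : (1 + ε / 4) * l ≤ m) (hr : ε * l / 4 - 1 ≤ r) (hL : 1 ≤ L)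
    (h : 32 * (K + 1) * L ≤ ε ^ 2 * l) : (l / m) ^ r ≤ Real.exp (-(K * L)) := by
  have hm0 : 0 < m := lt_of_lt_of_le (by positivity) hm
  calc (l / m) ^ r ≤ (1 / (1 + ε / 4)) ^ r := by
        refine pow_le_pow_left₀ (by positivity) ?_ r
        rw [div_le_div_iff₀ hm0 (by positivity)]
        linarith
    _ ≤ Real.exp (-(ε / 8 * r)) := one_div_pow_le_exp h0.le h1 r
    _ ≤ _ := by
        rw [Real.exp_le_exp, neg_le_neg_iff]
        have := mul_le_mul_of_nonneg_left hr (by positivity : 0 ≤ ε / 8)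
        linarith

/-- The upper tail of the number of copies near the threshold for the existence of copies. -/
theorem eventually_upper_tail_copies {root : κ ↪ V} {E : Finset (Sym2 V)} (hE : IsExtEdges root E)
    (hb : StrictlyBalanced root E) {θ : ℝ} (hθ : 0 < θ) (K : ℕ) :
    ∀ᶠ n : ℕ in atTop, ∀ p : ℝ, 0 < p → p ≤ 1 → OverlapBound root E n p ((n : ℝ) ^ θ) →
      scale root E n p ≤ (n : ℝ) ^ (θ / 4) →
      ∀ ε : ℝ, 0 < ε → ε ≤ 1 → ∀ x : κ ↪ Fin n,
        32 * (K + 1) * Real.log n ≤ ε ^ 2 * (#(copies root E x) * p ^ #E) →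
        bprob p (allEdges n)
          (fun s => (1 + ε) * (#(copies root E x) * p ^ #E) ≤ copyCount root E x s) ≤
          2 * (n : ℝ) ^ (-(K : ℝ)) := by
  set c := Fintype.card V with hc
  -- Each step of a chain of overlapping pairs will cost at least a factor n^(-θ/4) (`hMle`), so
  -- boundedly many steps beat n^(-K).
  obtain ⟨R, hR⟩ : ∃ R : ℕ, K ≤ R * (θ / 4) := by
    obtain ⟨R, hR⟩ := exists_nat_ge (K / (θ / 4))
    exact ⟨R, by rwa [div_le_iff₀ (by positivity)] at hR⟩
  set w := (2 * R + 1) * c with hw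
  set B : ℝ := 2 ^ c * (w : ℝ) ^ c with hB
  have hB0 : 0 ≤ B := by positivity
  have e1 := eventually_mul_rpow_le (B * (1 + B + (w : ℝ) ^ c)) (a := -(θ / 2)) (b := -(θ / 4))
    (by linarith)
  have e2 := eventually_le_log (2 * ((w : ℝ) ^ c + 1))
  have hcpos : 0 < c := by
    obtain ⟨v, _⟩ := hb.free_nonempty hE
    exact Fintype.card_pos_iff.2 ⟨v⟩
  filter_upwards [e1, e2, eventually_ge_atTop 3] with n h1 h2 hn p hp0 hp1 hG hΛ ε hε0 hε1 x hlog
  have hN3 : (3 : ℝ) ≤ n := by exact_mod_cast hn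
  have hN0 : (0 : ℝ) < n := by linarith
  have hN1 : (1 : ℝ) ≤ n := by linarith
  set N : ℝ := (n : ℝ) with hN
  set l := #(copies root E x) * p ^ #E with hl
  have hl0 : 0 ≤ l := by positivity
  have hL0 : 0 ≤ Real.log N := Real.log_nonneg hN1
  have hεl : 2 * ((w : ℝ) ^ c + 1) ≤ ε * l := by
    have : ε ^ 2 * l ≤ ε * l := by nlinarith [mul_nonneg hε0.le hl0]
    have hK : 0 ≤ (K : ℝ) * Real.log N := by positivity
    linarith
  have hlpos : 0 < l := by
    have h5 : 0 < ε * l := lt_of_lt_of_le (by positivity) hεl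
    exact pos_of_mul_pos_right h5 hε0.le
  set η := 2 ^ c * (w : ℝ) ^ c * scale root E n p / N ^ θ with hη
  have hs0 : 0 ≤ scale root E n p := by unfold scale; positivity
  have hηle : η ≤ B * N ^ (-(3 * θ / 4)) := by
    calc η ≤ B * N ^ (θ / 4) / N ^ θ := by rw [hη]; gcongr
      _ = _ := by
          rw [mul_div_assoc, ← Real.rpow_sub hN0]; congr 2; ring
  have hη0 : 0 ≤ η := by rw [hη]; positivity
  have hone : 1 ≤ N ^ (θ / 4) := Real.one_le_rpow hN1 (by positivity)
  have hηB : η ≤ B := hηle.trans (mul_le_of_le_one_right hB0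
    (Real.rpow_le_one_of_one_le_of_nonpos hN1 (by linarith)))
  have hMle : (scale root E n p + η + (w : ℝ) ^ c) * η ≤ N ^ (-(θ / 4)) := by
    have hw0 : (0 : ℝ) ≤ (w : ℝ) ^ c := by positivity
    calc (scale root E n p + η + (w : ℝ) ^ c) * η
        ≤ ((1 + B + (w : ℝ) ^ c) * N ^ (θ / 4)) * (B * N ^ (-(3 * θ / 4))) := by
          refine mul_le_mul ?_ hηle hη0 (by positivity)
          nlinarith
      _ = B * (1 + B + (w : ℝ) ^ c) * N ^ (-(θ / 2)) := by
          rw [show -(θ / 2) = θ / 4 + -(3 * θ / 4) by ring, Real.rpow_add hN0]; ring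
      _ ≤ _ := h1
  have hM0 : 0 ≤ (scale root E n p + η + (w : ℝ) ^ c) * η := by positivity
  have hMR : ((scale root E n p + η + (w : ℝ) ^ c) * η) ^ R ≤ N ^ (-(K : ℝ)) := by
    calc _ ≤ (N ^ (-(θ / 4))) ^ R := pow_le_pow_left₀ hM0 hMle R
      _ = N ^ (-(θ / 4) * R) := by rw [← Real.rpow_natCast, ← Real.rpow_mul hN0.le]
      _ ≤ _ := Real.rpow_le_rpow_of_exponent_le hN1 (by linarith)
  -- Half of the excess εl is shared between m ≈ (1+ε/4)l and r ≈ εl/4. The other half absorbs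
  -- rounding and the boundedly many overlapping copies, by `hεl`.
  set r := ⌊ε * l / 4⌋₊ with hr
  set m := ⌈(1 + ε / 4) * l⌉₊ with hm
  have hr1 : (r : ℝ) ≤ ε * l / 4 := Nat.floor_le (by positivity)
  have hr2 : ε * l / 4 - 1 ≤ r := by linarith [Nat.lt_floor_add_one (ε * l / 4)]
  have hm1 : (1 + ε / 4) * l ≤ m := Nat.le_ceil _
  have hm2 : (m : ℝ) ≤ (1 + ε / 4) * l + 1 := (Nat.ceil_lt_add_one (by positivity)).le
  have hmpos : 0 < m := by
    have : (0 : ℝ) < m := lt_of_lt_of_le (by positivity) hm1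
    exact_mod_cast this
  have hmain := upper_tail_copies hE (hb.covers hE) x hp0 hp1 (Real.rpow_pos_of_pos hN0 θ) hG R
    hcpos hw hη m r hmpos
  have hfirst : (l / m) ^ r ≤ N ^ (-(K : ℝ)) := by
    have hlog1 : 1 ≤ Real.log N := by
      rw [Real.le_log_iff_exp_le hN0]
      linarith [Real.exp_one_lt_d9]
    refine (div_pow_le_exp hlpos hε0 hε1 hm1 hr2 hlog1 hlog).trans_eq ?_
    rw [Real.rpow_def_of_pos hN0]; ring_nf
  have hsub : bprob p (allEdges n) (fun s => (1 + ε) * l ≤ copyCount root E x s) ≤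
      bprob p (allEdges n) (fun s => m + r + w ^ c ≤ copyCount root E x s) := by
    refine bprob_mono hp0.le hp1 fun s _ hs => ?_
    have : ((m + r + w ^ c : ℕ) : ℝ) ≤ copyCount root E x s := by
      refine le_trans ?_ hs
      push_cast
      linarith
    exact_mod_cast this
  refine hsub.trans (hmain.trans ?_)
  linarith

/-! ### A lower bound for Poisson probabilities -/

theorem factorial_le_pow_div_exp {z : ℕ} (hz : 1 ≤ z) :
    (z.factorial : ℝ) ≤ Real.exp 1 * z * (z / Real.exp 1) ^ z := by
  induction z, hz using Nat.le_induction with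
  | base => simp
  | succ z hz ih =>
    have hz0 : (0 : ℝ) < z := by exact_mod_cast hz
    have he := Real.exp_pos 1
    have key : Real.exp 1 * (z : ℝ) ^ (z + 1) ≤ ((z : ℝ) + 1) ^ (z + 1) := by
      have h1 : Real.exp (1 / ((z : ℝ) + 1)) ≤ (z + 1) / z := by
        have h2 : (z : ℝ) / (z + 1) ≤ Real.exp (-(1 / ((z : ℝ) + 1))) := by
          have := Real.add_one_le_exp (-(1 / ((z : ℝ) + 1)))
          refine le_trans (le_of_eq ?_) this
          field_simp
          ring
        rw [Real.exp_neg] at h2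
        have h3 := inv_anti₀ (by positivity) h2
        rwa [inv_inv, inv_div] at h3
      have h4 := pow_le_pow_left₀ (Real.exp_nonneg _) h1 (z + 1)
      rw [← Real.exp_nat_mul, div_pow, le_div_iff₀ (by positivity)] at h4
      have h5 : ((z + 1 : ℕ) : ℝ) * (1 / ((z : ℝ) + 1)) = 1 := by
        push_cast; field_simp
      rwa [h5] at h4
    rw [Nat.factorial_succ]
    push_cast
    calc ((z : ℝ) + 1) * z.factorial
        ≤ (z + 1) * (Real.exp 1 * z * (z / Real.exp 1) ^ z) := by gcongr
      _ = (z + 1) / Real.exp 1 ^ z * (Real.exp 1 * (z : ℝ) ^ (z + 1)) := by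
          rw [div_pow, pow_succ]; field_simp
      _ ≤ (z + 1) / Real.exp 1 ^ z * ((z : ℝ) + 1) ^ (z + 1) := by gcongr
      _ = Real.exp 1 * (z + 1) * ((z + 1) / Real.exp 1) ^ (z + 1) := by
          rw [div_pow, pow_succ (Real.exp 1)]; field_simp

/-- A Gaussian lower bound for the Poisson distribution. -/
theorem poisson_lower_bound {l : ℝ} (hl : 0 < l) {z : ℕ} (hz : 1 ≤ z) :
    Real.exp (-((z - l) ^ 2 / l) - 1) / z ≤ l ^ z / z.factorial * Real.exp (-l) := by
  have hz0 : (0 : ℝ) < z := by exact_mod_cast hz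
  have h1 := factorial_le_pow_div_exp hz
  have hf : (0 : ℝ) < z.factorial := by positivity
  -- From t ≤ exp(t-1) at t = z/l. Then z - z(z/l - 1) - l equals -(z-l)²/l exactly, which is the
  -- Gaussian exponent.
  have h2 : ((z : ℝ) / l) ^ z ≤ Real.exp (z * ((z : ℝ) / l - 1)) := by
    have : (z : ℝ) / l ≤ Real.exp ((z : ℝ) / l - 1) := by
      linarith [Real.add_one_le_exp ((z : ℝ) / l - 1)]
    rw [Real.exp_nat_mul]
    exact pow_le_pow_left₀ (by positivity) this z
  have h3 : (z.factorial : ℝ) ≤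
      Real.exp 1 * z * (Real.exp (z * ((z : ℝ) / l - 1)) * l ^ z * Real.exp (-(z : ℝ))) := by
    refine h1.trans ?_
    have h4 : ((z : ℝ) / Real.exp 1) ^ z = ((z : ℝ) / l) ^ z * l ^ z * Real.exp (-(z : ℝ)) := by
      rw [div_pow, div_pow, Real.exp_neg, ← Real.exp_nat_mul, mul_one]
      field_simp
    rw [h4]
    gcongr
  rw [div_mul_eq_mul_div, div_le_div_iff₀ hz0 hf]
  calc Real.exp (-((z - l) ^ 2 / l) - 1) * z.factorial
      ≤ Real.exp (-((z - l) ^ 2 / l) - 1) *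
        (Real.exp 1 * z * (Real.exp (z * ((z : ℝ) / l - 1)) * l ^ z * Real.exp (-(z : ℝ)))) := by
        gcongr
    _ = (Real.exp (-((z - l) ^ 2 / l) - 1) * Real.exp 1 * Real.exp (z * ((z : ℝ) / l - 1)) *
          Real.exp (-(z : ℝ))) * (l ^ z * z) := by ring
    _ = Real.exp (-l) * (l ^ z * z) := by
        rw [← Real.exp_add, ← Real.exp_add, ← Real.exp_add]
        congr 2
        field_simp
        ring
    _ = _ := by ring

end RootedExtension
-- Many copies at some tuple, by the second moment method
namespace RootedExtension

open Finset BernoulliSubset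

variable {κ V : Type*} [Fintype κ] [Fintype V]

/-- The expected number of copies. -/
noncomputable def copyMean (root : κ ↪ V) (E : Finset (Sym2 V)) (n : ℕ) (p : ℝ) : ℝ :=
  embMean root E n p / aut root E

theorem embMean_eq_aut_mul (root : κ ↪ V) (E : Finset (Sym2 V)) (n : ℕ) (p : ℝ) :
    embMean root E n p = aut root E * copyMean root E n p := by
  have : (aut root E : ℝ) ≠ 0 := by exact_mod_cast (aut_pos root E).ne'
  rw [copyMean]
  field_simp

theorem card_copies_mul_pow {root : κ ↪ V} {E : Finset (Sym2 V)} (hc : Covers root E) {n : ℕ}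
    (x : κ ↪ Fin n) (p : ℝ) : #(copies root E x) * p ^ #E = copyMean root E n p := by
  have : (aut root E : ℝ) ≠ 0 := by exact_mod_cast (aut_pos root E).ne'
  rw [copyMean, embMean, ← card_copies_mul hc x]
  push_cast
  field_simp

theorem copyMean_le_scale (root : κ ↪ V) (E : Finset (Sym2 V)) (n : ℕ) {p : ℝ} (hp : 0 ≤ p) :
    copyMean root E n p ≤ scale root E n p := by
  refine le_trans (div_le_self (embMean_nonneg root E n hp) ?_) (embMean_le root E n hp)
  exact_mod_cast aut_pos root E

theorem scale_le_copyMean (root : κ ↪ V) (E : Finset (Sym2 V)) {n : ℕ}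
    (hn : 2 * Fintype.card V ≤ n) {p : ℝ} (hp : 0 ≤ p) :
    scale root E n p ≤ 2 ^ Fintype.card V * aut root E * copyMean root E n p := by
  rw [mul_assoc, ← embMean_eq_aut_mul]
  exact le_embMean root E hn hp

/-- A small n^v p^e bounds n p^e, hence keeps `p` polynomially small. This provides the condition pL
≤ 1 in the lower bounds for exact presence. -/
theorem le_of_scale_le {root : κ ↪ V} {E : Finset (Sym2 V)} (hv : 1 ≤ #(free root))
    (hE : 1 ≤ #E) {n : ℕ} (hn : 1 ≤ n) {p τ : ℝ} (hp : 0 ≤ p)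
    (hs : scale root E n p ≤ (n : ℝ) ^ τ)
    (h : 4 ^ #E * (n : ℝ) ^ τ ≤ (n : ℝ) ^ (1 - τ * #E)) : p ≤ (n : ℝ) ^ (-τ) / 4 := by
  by_contra hcon
  push Not at hcon
  have hN1 : (1 : ℝ) ≤ n := by exact_mod_cast hn
  have hN0 : (0 : ℝ) < n := by linarith
  have h1 := pow_lt_pow_left₀ hcon (by positivity) (by omega : #E ≠ 0)
  have h2 : (n : ℝ) ≤ (n : ℝ) ^ #(free root) := le_self_pow₀ hN1 (by omega)
  have h3 : (n : ℝ) * ((n : ℝ) ^ (-τ) / 4) ^ #E < scale root E n p := by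
    rw [scale]
    calc (n : ℝ) * ((n : ℝ) ^ (-τ) / 4) ^ #E < (n : ℝ) * p ^ #E := by gcongr
      _ ≤ _ := by gcongr
  have h4 : (n : ℝ) * ((n : ℝ) ^ (-τ) / 4) ^ #E = (n : ℝ) ^ (1 - τ * #E) / 4 ^ #E := by
    rw [div_pow, ← Real.rpow_natCast, ← Real.rpow_mul hN0.le, sub_eq_add_neg, Real.rpow_add hN0,
      Real.rpow_one, neg_mul]
    ring
  rw [h4, div_lt_iff₀ (by positivity)] at h3
  nlinarith [pow_pos (by norm_num : (0:ℝ) < 4) #E]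

/-- A lower bound for a truncated falling product. -/
theorem half_pow_le_sub_pow {M b z : ℕ} {q : ℝ} (hq : 0 ≤ q) (h : 2 * (z * b) ≤ M) :
    ((M : ℝ) * q) ^ z / 2 ≤ (((M - b : ℕ) : ℝ) * q) ^ z := by
  rcases Nat.eq_zero_or_pos z with rfl | hz
  · norm_num
  rcases Nat.eq_zero_or_pos M with rfl | hM
  · have : (0 : ℝ) ^ z = 0 := zero_pow hz.ne'
    simp [this]
  have hM0 : (0 : ℝ) < M := by exact_mod_cast hM
  have h1 : (2 : ℝ) * (z * b) ≤ M := by exact_mod_cast h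
  have hz1 : (1 : ℝ) ≤ z := by exact_mod_cast hz
  have hb0 : (0 : ℝ) ≤ b := Nat.cast_nonneg b
  have h2 : (b : ℝ) / M ≤ 1 := by
    rw [div_le_one hM0]; nlinarith
  have h3 : 1 + (z : ℝ) * (-(b / M)) ≤ (1 + -((b : ℝ) / M)) ^ z :=
    one_add_mul_le_pow (by linarith) z
  have h4 : (z : ℝ) * (b / M) ≤ 1 / 2 := by
    rw [← mul_div_assoc, div_le_iff₀ hM0]; linarith
  have h5 : (M : ℝ) * (1 + -((b : ℝ) / M)) ≤ ((M - b : ℕ) : ℝ) := by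
    have : M ≤ (M - b) + b := by omega
    have : (M : ℝ) ≤ ((M - b : ℕ) : ℝ) + b := by exact_mod_cast this
    have e : (M : ℝ) * (1 + -((b : ℝ) / M)) = M - b := by field_simp; ring
    rw [e]; linarith
  calc ((M : ℝ) * q) ^ z / 2 = ((M : ℝ) * q) ^ z * (1 / 2) := by ring
    _ ≤ ((M : ℝ) * q) ^ z * (1 + -((b : ℝ) / M)) ^ z := by
        refine mul_le_mul_of_nonneg_left ?_ (by positivity)
        linarith
    _ = ((M : ℝ) * (1 + -((b : ℝ) / M)) * q) ^ z := by rw [← mul_pow]; congr 1; ring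
    _ ≤ _ := by
        have h6 : 0 ≤ 1 + -((b : ℝ) / M) := by linarith
        gcongr

/-- For l ≥ 1 the Gaussian bound applies with (z-l)²/l ≤ 18ε²l + 2, giving N^(-18τ), and the factor
1/z costs another N^(-τ). For l < 1 the target z is at most 4, so l^z ≥ N^(-8τ). -/
theorem poisson_tail_lower_bound {N τ ε l : ℝ} (hN : 1 ≤ N) (hε0 : 0 < ε) (hε1 : ε ≤ 1)
    (hl0 : 0 < l) (hl : l ≤ N ^ τ) (hl2 : N ^ (-(2 * τ)) ≤ l)
    (hlog : ε ^ 2 * l ≤ τ * Real.log N) (hτ : 0 < τ) :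
    N ^ (-(19 * τ)) * (Real.exp (-3) / 24) ≤
      l ^ ⌈(1 + 3 * ε) * l⌉₊ / (⌈(1 + 3 * ε) * l⌉₊).factorial * Real.exp (-l) := by
  have hN0 : 0 < N := by linarith
  set z := ⌈(1 + 3 * ε) * l⌉₊ with hz
  have hz1 : (1 + 3 * ε) * l ≤ z := Nat.le_ceil _
  have hz2 : (z : ℝ) ≤ (1 + 3 * ε) * l + 1 := (Nat.ceil_lt_add_one (by positivity)).le
  have hzpos : 1 ≤ z := Nat.one_le_iff_ne_zero.2 (Nat.ceil_pos.2 (by positivity)).ne'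
  have hz0 : (0 : ℝ) < z := by exact_mod_cast hzpos
  rcases le_or_gt 1 l with h1 | h1
  · refine le_trans ?_ (poisson_lower_bound hl0 hzpos)
    have h2 : (z - l) ^ 2 / l ≤ 18 * τ * Real.log N + 2 := by
      rw [div_le_iff₀ hl0]
      have h3 : 0 ≤ (z : ℝ) - l := by nlinarith [mul_pos hε0 hl0]
      have h4 : (z : ℝ) - l ≤ 3 * ε * l + 1 := by linarith
      have h5 := pow_le_pow_left₀ h3 h4 2
      have h6 := mul_le_mul_of_nonneg_right hlog hl0.le
      nlinarith [sq_nonneg (3 * ε * l - 1)]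
    have h7 : (z : ℝ) ≤ 5 * N ^ τ := by
      have : (1 + 3 * ε) * l ≤ 4 * N ^ τ := by
        have := mul_le_mul (by linarith : 1 + 3 * ε ≤ 4) hl hl0.le (by norm_num)
        linarith
      have h8 : 1 ≤ N ^ τ := Real.one_le_rpow hN hτ.le
      linarith
    have h9 : Real.exp (-(18 * τ * Real.log N + 2) - 1) = N ^ (-(18 * τ)) * Real.exp (-3) := by
      rw [Real.rpow_def_of_pos hN0, ← Real.exp_add]; congr 1; ring
    calc N ^ (-(19 * τ)) * (Real.exp (-3) / 24)
        ≤ N ^ (-(19 * τ)) * (Real.exp (-3) / 5) := by gcongr; norm_num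
      _ = (N ^ (-(18 * τ)) * Real.exp (-3)) / (5 * N ^ τ) := by
          rw [show -(19 * τ) = -(18 * τ) - τ by ring, Real.rpow_sub hN0]
          field_simp
      _ ≤ Real.exp (-((z - l) ^ 2 / l) - 1) / z := by
          rw [← h9]
          gcongr
  · have hz4 : z ≤ 4 := by
      rw [hz, Nat.ceil_le]
      push_cast
      nlinarith
    have hfac : (z.factorial : ℝ) ≤ 24 := by
      have := Nat.factorial_le hz4
      exact_mod_cast this
    calc N ^ (-(19 * τ)) * (Real.exp (-3) / 24)
        ≤ N ^ (-(8 * τ)) * (Real.exp (-1) / 24) := by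
          gcongr
          · norm_num
          · norm_num
      _ = (N ^ (-(2 * τ))) ^ 4 / 24 * Real.exp (-1) := by
          rw [← Real.rpow_natCast (N ^ (-(2 * τ))), ← Real.rpow_mul hN0.le]
          rw [show -(2 * τ) * ((4 : ℕ) : ℝ) = -(8 * τ) by push_cast; ring]
          ring
      _ ≤ l ^ 4 / 24 * Real.exp (-1) := by gcongr
      _ ≤ l ^ z / z.factorial * Real.exp (-l) := by
          have h5 : l ^ 4 ≤ l ^ z := pow_le_pow_of_le_one hl0.le h1.le hz4
          gcongr

/-- The number of copies dominates a Poisson-type estimate up to constants, which the passage from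
N^(-19τ) to N^(-20τ) absorbs. -/
theorem eventually_le_bprob_copyCount {root : κ ↪ V} {E : Finset (Sym2 V)}
    (hE : IsExtEdges root E) (hb : StrictlyBalanced root E) {θ τ : ℝ} (hτ : 0 < τ)
    (hτθ : τ * (Fintype.card V + 1) < θ) (hτE : τ * (#E + 2) < 1) :
    ∀ᶠ n : ℕ in atTop, ∀ p : ℝ, 0 < p → OverlapBound root E n p ((n : ℝ) ^ θ) →
      (n : ℝ) ^ (-τ) ≤ scale root E n p → scale root E n p ≤ (n : ℝ) ^ τ →
      ∀ ε : ℝ, 0 < ε → ε ≤ 1 → ε ^ 2 * copyMean root E n p ≤ τ * Real.log n →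
      ∀ x : κ ↪ Fin n, (n : ℝ) ^ (-(20 * τ)) ≤ bprob p (allEdges n)
          (fun s => ⌈(1 + 3 * ε) * copyMean root E n p⌉₊ ≤ copyCount root E x s) := by
  set c := Fintype.card V with hc
  set a := aut root E with ha
  have hvpos := (hb.free_nonempty hE).card_pos
  have hEpos := hb.nonempty.card_pos
  have hτ2 : 2 * τ < 1 := by nlinarith [(Nat.cast_nonneg #E : (0:ℝ) ≤ #E)]
  have e1 := eventually_mul_rpow_le (2 ^ c * a) (a := -(2 * τ)) (b := -τ) (by linarith)
  have e2 := eventually_mul_rpow_le (2 ^ c * (5 * c + 1 : ℝ) ^ c) (a := τ * (c + 1)) hτθ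
  have e3 := eventually_mul_rpow_le (4 ^ #E) (a := τ) (b := 1 - τ * #E) (by nlinarith)
  have e4 := eventually_mul_rpow_le (50 * c ^ 2 * 2 ^ c * a) (a := 2 * τ) (b := 1) hτ2
  have e5 := eventually_mul_rpow_le (2 * (24 * Real.exp 3) * Real.exp 3) (a := -(20 * τ))
    (b := -(19 * τ)) (by linarith)
  filter_upwards [e1, e2, e3, e4, e5, eventually_ge_atTop (2 * c + 1)] with
    n h1 h2 h3 h4 h5 hn p hp0 hG hsl hsu ε hε0 hε1 hlog x
  have hn1 : 1 ≤ n := by omega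
  have hN1 : (1 : ℝ) ≤ n := by exact_mod_cast hn1
  have hN0 : (0 : ℝ) < n := by linarith
  set N : ℝ := (n : ℝ) with hN
  have hNτ : 1 ≤ N ^ τ := Real.one_le_rpow hN1 hτ.le
  set l := copyMean root E n p with hl
  have hls : l ≤ N ^ τ := (copyMean_le_scale root E n hp0.le).trans hsu
  have hsl' := hsl.trans (scale_le_copyMean root E (by omega) hp0.le)
  have ha1 : (1 : ℝ) ≤ a := by exact_mod_cast aut_pos root E
  have hl2 : N ^ (-(2 * τ)) ≤ l := by
    have := h1.trans hsl'
    exact le_of_mul_le_mul_left this (by positivity)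
  have hl0 : 0 < l := (Real.rpow_pos_of_pos hN0 _).trans_le hl2
  set z := ⌈(1 + 3 * ε) * l⌉₊ with hz
  have hz2 : (z : ℝ) ≤ (1 + 3 * ε) * l + 1 := (Nat.ceil_lt_add_one (by positivity)).le
  have hz5 : (z : ℝ) ≤ 5 * N ^ τ := by
    have := mul_le_mul (by linarith : 1 + 3 * ε ≤ 4) hls hl0.le (by norm_num)
    linarith
  have hp4 := le_of_scale_le hvpos hEpos hn1 hp0.le hsu h3
  have hNτ' : N ^ (-τ) ≤ 1 := Real.rpow_le_one_of_one_le_of_nonpos hN1 (by linarith)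
  have hcov := hb.covers hE
  have hs0 : 0 ≤ scale root E n p := by unfold scale; positivity
  have hη : 2 ^ c * ((z * c + 1 : ℕ) : ℝ) ^ c * scale root E n p / N ^ θ ≤ 1 := by
    rw [div_le_one (by positivity)]
    have h6 : ((z * c + 1 : ℕ) : ℝ) ≤ (5 * c + 1) * N ^ τ := by
      push_cast
      nlinarith [mul_le_mul_of_nonneg_right hz5 (Nat.cast_nonneg c : (0:ℝ) ≤ c)]
    calc 2 ^ c * ((z * c + 1 : ℕ) : ℝ) ^ c * scale root E n p
        ≤ 2 ^ c * ((5 * c + 1) * N ^ τ) ^ c * N ^ τ := by gcongr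
      _ = 2 ^ c * (5 * c + 1 : ℝ) ^ c * N ^ (τ * (c + 1)) := by
          rw [mul_pow, ← Real.rpow_natCast (N ^ τ), ← Real.rpow_mul hN0.le, mul_add, mul_one,
            Real.rpow_add hN0]
          ring
      _ ≤ _ := h2
  have hpL : p * (#(copies root E x) * p ^ #E + 1) ≤ 1 := by
    rw [card_copies_mul_pow hcov]
    calc p * (l + 1) ≤ N ^ (-τ) / 4 * (2 * N ^ τ) := by
          refine mul_le_mul hp4 (by linarith) (by positivity) (by positivity)
      _ = 1 / 2 := by rw [Real.rpow_neg hN0.le]; field_simp; norm_num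
      _ ≤ 1 := by norm_num
  have hmain := le_bprob_copyCount hE hb x hp0 (by linarith) (Real.rpow_pos_of_pos hN0 θ) hG z hη hpL
  refine le_trans ?_ hmain
  -- Avoiding earlier copies removes at most z c² n^(v-1) of order n^v copies at each of z steps. As
  -- z is at most of order n^τ with 2τ < 1, the product loses at most a factor 2.
  have hhalf : 2 * (z * (z * (c ^ 2 * n ^ (#(free root) - 1)))) ≤ #(copies root E x) := by
    have h6 : (a * #(copies root E x) : ℝ) = numEmbs root n := by
      exact_mod_cast card_copies_mul hcov x
    have h7 := le_numEmbs root (n := n) (by omega)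
    rw [← h6] at h7
    have h8 : (n : ℝ) ^ #(free root) = n * (n : ℝ) ^ (#(free root) - 1) := by
      rw [← pow_succ', Nat.sub_add_cancel hvpos]
    rw [h8] at h7
    have h9 : (z : ℝ) ^ 2 ≤ 25 * N ^ (2 * τ) := by
      have := pow_le_pow_left₀ (Nat.cast_nonneg z) hz5 2
      rw [mul_pow, ← Real.rpow_natCast (N ^ τ), ← Real.rpow_mul hN0.le] at this
      rw [mul_comm 2 τ]
      norm_num at this
      exact this
    rw [Real.rpow_one] at h4
    have h10 : (2 * (z * (z * (c ^ 2 * n ^ (#(free root) - 1)))) : ℝ) * (2 ^ c * a) ≤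
        #(copies root E x) * (2 ^ c * a) := by
      have hpw : (0 : ℝ) ≤ (n : ℝ) ^ (#(free root) - 1) := by positivity
      calc (2 * (z * (z * (c ^ 2 * n ^ (#(free root) - 1)))) : ℝ) * (2 ^ c * a)
          = (z : ℝ) ^ 2 * (2 * c ^ 2 * 2 ^ c * a) * (n : ℝ) ^ (#(free root) - 1) := by ring
        _ ≤ 25 * N ^ (2 * τ) * (2 * c ^ 2 * 2 ^ c * a) * (n : ℝ) ^ (#(free root) - 1) := by gcongr
        _ = 50 * c ^ 2 * 2 ^ c * a * N ^ (2 * τ) * (n : ℝ) ^ (#(free root) - 1) := by ring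
        _ ≤ N * (n : ℝ) ^ (#(free root) - 1) := by gcongr
        _ ≤ _ := h7
        _ = _ := by ring
    have h11 := le_of_mul_le_mul_right h10 (by positivity)
    exact_mod_cast h11
  have hP := half_pow_le_sub_pow (q := p ^ #E) (by positivity) hhalf
  have hpois := poisson_tail_lower_bound hN1 hε0 hε1 hl0 hls hl2 hlog hτ
  rw [← hz] at hpois
  rw [card_copies_mul_pow hcov] at hP ⊢
  have he : Real.exp (-(l + 3)) = Real.exp (-l) * Real.exp (-3) := by
    rw [← Real.exp_add]; congr 1; ring
  have h3' : Real.exp 3 * Real.exp (-3) = 1 := by rw [← Real.exp_add]; norm_num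
  calc N ^ (-(20 * τ))
      = (2 * (24 * Real.exp 3) * Real.exp 3 * N ^ (-(20 * τ))) * (Real.exp (-3) / 24) *
          (Real.exp (-3) / 2) := by
        linear_combination (-(N ^ (-(20 * τ))) * (Real.exp 3 * Real.exp (-3) + 1)) * h3'
    _ ≤ N ^ (-(19 * τ)) * (Real.exp (-3) / 24) * (Real.exp (-3) / 2) := by gcongr
    _ ≤ l ^ z / z.factorial * Real.exp (-l) * (Real.exp (-3) / 2) := by gcongr
    _ = (l ^ z / 2) / z.factorial * Real.exp (-(l + 3)) := by rw [he]; ring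
    _ ≤ _ := by gcongr

/-- Only the root `j` varies, over vertices outside a reserved initial block that holds the other
roots. Distinctness at one grounded root is all that the correlation bound needs. -/
theorem exists_tuples (κ : Type*) [Fintype κ] (j : κ) {M n : ℕ} (h : M + Fintype.card κ ≤ n) :
    ∃ X : Fin M → (κ ↪ Fin n), ∀ i i', i ≠ i' → X i' j ∉ Set.range (X i) := by
  classical
  set e := Fintype.equivFin κ with he
  have hval : ∀ (i : Fin M) (t : κ),
      (if t = j then Fintype.card κ + (i : ℕ) else (e t : ℕ)) < n := by
    intro i t
    split_ifs
    · omega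
    · have := (e t).2
      omega
  refine ⟨fun i => ⟨fun t => ⟨_, hval i t⟩, fun t t' h' => ?_⟩, ?_⟩
  · have h' := congrArg Fin.val h'
    simp only at h'
    have h1 := (e t).2
    have h2 := (e t').2
    split_ifs at h' with h3 h4 h4
    · rw [h3, h4]
    · omega
    · omega
    · exact e.injective (Fin.ext h')
  · rintro i i' hne ⟨t, ht⟩
    have ht := congrArg Fin.val ht
    change (if t = j then Fintype.card κ + (i : ℕ) else (e t : ℕ)) =
      (if j = j then Fintype.card κ + (i' : ℕ) else (e j : ℕ)) at ht
    have h1 := (e t).2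
    rw [if_pos rfl] at ht
    split_ifs at ht with h3
    · exact hne (Fin.ext (by omega))
    · omega

/-- Near the threshold, some tuple of roots has many more copies than expected. -/
theorem eventually_exists_many_copies {root : κ ↪ V} {E : Finset (Sym2 V)}
    (hE : IsExtEdges root E) (hb : StrictlyBalanced root E) {j : κ} {u : V}
    (hju : s(root j, u) ∈ E) {θ τ : ℝ} (hτ : 0 < τ)
    (hτθ : τ * (Fintype.card V + 50) < θ) (hτE : τ * (#E + 50) < 1) :
    ∀ᶠ n : ℕ in atTop, ∀ p : ℝ, 0 < p → p ≤ 1 → OverlapBound root E n p ((n : ℝ) ^ θ) →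
      (n : ℝ) ^ (-τ) ≤ scale root E n p → scale root E n p ≤ (n : ℝ) ^ τ →
      ∀ ε : ℝ, 0 < ε → ε ≤ 1 → ε ^ 2 * copyMean root E n p ≤ τ * Real.log n →
      bprob p (allEdges n) (fun s => ∀ x : κ ↪ Fin n,
          ¬⌈(1 + 3 * ε) * copyMean root E n p⌉₊ ≤ copyCount root E x s) ≤ (n : ℝ) ^ (-τ) := by
  set c := Fintype.card V with hc
  set k := Fintype.card κ with hk
  have hτ50 : 50 * τ < 1 := by nlinarith [(Nat.cast_nonneg #E : (0:ℝ) ≤ #E)]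
  have hθ50 : 50 * τ < θ := by nlinarith [(Nat.cast_nonneg c : (0:ℝ) ≤ c)]
  set A : ℝ := (2 * c : ℝ) ^ c with hA
  set B : ℝ := (c : ℝ) ^ (c + 1) with hB
  have hA0 : 0 ≤ A := by positivity
  have hB0 : 0 ≤ B := by positivity
  have e1 := eventually_mul_rpow_le (2 + k : ℝ) (a := 22 * τ) (b := 1) (by linarith)
  have e2 := eventually_mul_rpow_le (1 + A + B) (a := -(2 * τ)) (b := -τ) (by linarith)
  filter_upwards [e1, e2, eventually_le_bprob_copyCount hE hb (θ := θ) hτ (by linarith) (by linarith),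
    eventually_ge_atTop 1] with n h1 h2 hlow hn1 p hp0 hp1 hG hsl hsu ε hε0 hε1 hlog
  have hN1 : (1 : ℝ) ≤ n := by exact_mod_cast hn1
  have hN0 : (0 : ℝ) < n := by linarith
  have hlow := hlow p hp0 hG hsl hsu ε hε0 hε1 hlog
  set N : ℝ := (n : ℝ) with hN
  set z := ⌈(1 + 3 * ε) * copyMean root E n p⌉₊ with hz
  -- Against a success probability of at least n^(-20τ), this gives at least n^(2τ) expected
  -- successes. The correlation error is divided by q² = n^(-40τ), so it must beat n^(42τ); the
  -- slack 50τ in the hypotheses ensures this.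
  set M := ⌈N ^ (22 * τ)⌉₊ with hM
  have hN22 : 1 ≤ N ^ (22 * τ) := Real.one_le_rpow hN1 (by linarith)
  have hM1 : N ^ (22 * τ) ≤ M := Nat.le_ceil _
  have hM2 : (M : ℝ) ≤ N ^ (22 * τ) + 1 := (Nat.ceil_lt_add_one (by positivity)).le
  have hMk : M + k ≤ n := by
    have : (M : ℝ) + k ≤ N := by
      rw [Real.rpow_one] at h1
      have : (k : ℝ) ≤ k * N ^ (22 * τ) := le_mul_of_one_le_right (Nat.cast_nonneg k) hN22
      linarith
    rw [hN] at this
    exact_mod_cast this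
  have hMpos : 0 < M := by
    have : (0 : ℝ) < M := by linarith
    exact_mod_cast this
  obtain ⟨X, hX⟩ := exists_tuples κ j hMk
  set q := N ^ (-(20 * τ)) with hq
  have hq0 : 0 < q := Real.rpow_pos_of_pos hN0 _
  set s₀ := scale root E n p with hs₀
  have hs0 : 0 ≤ s₀ := by rw [hs₀, scale]; positivity
  set err := A * s₀ ^ 2 / N ^ θ + B * s₀ / N with herr
  have herr0 : 0 ≤ err := by rw [herr]; positivity
  have hcheb := bprob_forall_not_le hp0.le hp1 (T := allEdges n) (univ : Finset (Fin M))
    (fun i s => z ≤ copyCount root E (X i) s) hq0 herr0 (by simpa using hMpos)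
    (fun i _ => hlow (X i)) fun i _ i' _ hne =>
      bprob_two_copyCounts_le hE hb (X i) (X i') hp0 hp1 (Real.rpow_pos_of_pos hN0 θ) hG hju
        (hX i i' hne) z
  refine (bprob_mono hp0.le hp1 fun s _ hs i _ => hs (X i)).trans (hcheb.trans ?_)
  rw [card_univ, Fintype.card_fin]
  have hbound1 : 1 / (M * q) ≤ N ^ (-(2 * τ)) := by
    rw [div_le_iff₀ (by positivity)]
    calc (1 : ℝ) = N ^ (-(2 * τ)) * (N ^ (22 * τ) * q) := by
          rw [hq, ← Real.rpow_add hN0, ← Real.rpow_add hN0]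
          rw [show -(2 * τ) + (22 * τ + -(20 * τ)) = 0 by ring, Real.rpow_zero]
      _ ≤ _ := by gcongr
  have hq2 : q ^ 2 = N ^ (-(40 * τ)) := by
    rw [hq, ← Real.rpow_natCast, ← Real.rpow_mul hN0.le]; congr 1; push_cast; ring
  have hbound2 : err / q ^ 2 ≤ (A + B) * N ^ (-(2 * τ)) := by
    rw [div_le_iff₀ (by positivity), hq2, mul_assoc, ← Real.rpow_add hN0, add_mul]
    have hs2 : s₀ ^ 2 ≤ N ^ (2 * τ) := by
      calc s₀ ^ 2 ≤ (N ^ τ) ^ 2 := pow_le_pow_left₀ hs0 hsu 2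
        _ = _ := by rw [← Real.rpow_natCast, ← Real.rpow_mul hN0.le]; congr 1; push_cast; ring
    refine add_le_add ?_ ?_
    · calc A * s₀ ^ 2 / N ^ θ ≤ A * N ^ (2 * τ) / N ^ θ := by gcongr
        _ = A * N ^ (2 * τ - θ) := by rw [Real.rpow_sub hN0, mul_div_assoc]
        _ ≤ _ := by
            gcongr
            linarith
    · calc B * s₀ / N ≤ B * N ^ τ / N := by gcongr
        _ = B * N ^ (τ - 1) := by rw [Real.rpow_sub hN0, Real.rpow_one, mul_div_assoc]
        _ ≤ _ := by
            gcongr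
            linarith
  calc 1 / (M * q) + err / q ^ 2 ≤ N ^ (-(2 * τ)) + (A + B) * N ^ (-(2 * τ)) :=
        add_le_add hbound1 hbound2
    _ = (1 + A + B) * N ^ (-(2 * τ)) := by ring
    _ ≤ _ := h2

end RootedExtension
-- Factorisation of embeddings through a core
namespace RootedExtension

open Finset BernoulliSubset

variable {κ V W : Type*} [Fintype κ] [Fintype V] [Fintype W] {n : ℕ}

/-- The edges inside an embedded set of vertices. -/
noncomputable def coreEdges (i : W ↪ V) (E : Finset (Sym2 V)) : Finset (Sym2 W) := by
  classical exact univ.filter fun e => e.map i ∈ E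

/-- The edges that are not inside an embedded set of vertices. -/
noncomputable def restEdges (i : W ↪ V) (E : Finset (Sym2 V)) : Finset (Sym2 V) := by
  classical exact E.filter fun e => ¬∀ v ∈ e, v ∈ Set.range i

theorem mem_coreEdges {i : W ↪ V} {E : Finset (Sym2 V)} {e : Sym2 W} :
    e ∈ coreEdges i E ↔ e.map i ∈ E := by simp [coreEdges]

theorem mem_restEdges {i : W ↪ V} {E : Finset (Sym2 V)} {e : Sym2 V} :
    e ∈ restEdges i E ↔ e ∈ E ∧ ¬∀ v ∈ e, v ∈ Set.range i := by simp [restEdges]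

theorem exists_map_eq {i : W ↪ V} {e : Sym2 V} (h : ∀ v ∈ e, v ∈ Set.range i) :
    ∃ d : Sym2 W, d.map i = e := by
  induction e with
  | h a b =>
    obtain ⟨a', rfl⟩ := h a (Sym2.mem_mk_left _ _)
    obtain ⟨b', rfl⟩ := h b (Sym2.mem_mk_right _ _)
    exact ⟨s(a', b'), rfl⟩

theorem map_coreEdges [DecidableEq V] (i : W ↪ V) (E : Finset (Sym2 V)) :
    (coreEdges i E).map i.sym2Map ∪ restEdges i E = E := by
  ext e
  simp only [mem_union, Finset.mem_map, mem_coreEdges, mem_restEdges]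
  constructor
  · rintro (⟨d, hd, rfl⟩ | ⟨h, -⟩)
    · exact hd
    · exact h
  · intro he
    by_cases h : ∀ v ∈ e, v ∈ Set.range i
    · obtain ⟨d, rfl⟩ := exists_map_eq h
      exact Or.inl ⟨d, he, rfl⟩
    · exact Or.inr ⟨he, h⟩

theorem disjoint_map_coreEdges (i : W ↪ V) (E : Finset (Sym2 V)) :
    Disjoint ((coreEdges i E).map i.sym2Map) (restEdges i E) := by
  rw [disjoint_left]
  intro e he he'
  obtain ⟨d, -, rfl⟩ := Finset.mem_map.1 he
  refine (mem_restEdges.1 he').2 fun v hv => ?_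
  obtain ⟨w, -, rfl⟩ := Sym2.mem_map.1 hv
  exact ⟨w, rfl⟩

theorem card_coreEdges_add (i : W ↪ V) (E : Finset (Sym2 V)) :
    #(coreEdges i E) + #(restEdges i E) = #E := by
  classical
  conv_rhs => rw [← map_coreEdges i E, card_union_of_disjoint (disjoint_map_coreEdges i E),
    card_map]

theorem isExtEdges_coreEdges {root : κ ↪ V} {E : Finset (Sym2 V)} (hE : IsExtEdges root E)
    {i : W ↪ V} {root₁ : κ ↪ W} (hi : ∀ j, i (root₁ j) = root j) :
    IsExtEdges root₁ (coreEdges i E) := by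
  refine ⟨fun e he hd => ?_, fun e he => ?_⟩
  · exact hE.not_isDiag _ (mem_coreEdges.1 he) ((Sym2.isDiag_map i.injective).2 hd)
  · obtain ⟨v, hv, hvr⟩ := hE.exists_free _ (mem_coreEdges.1 he)
    obtain ⟨w, hw, rfl⟩ := Sym2.mem_map.1 hv
    refine ⟨w, hw, ?_⟩
    rintro ⟨j, rfl⟩
    exact hvr ⟨j, (hi j).symm⟩

theorem isExtEdges_restEdges {root : κ ↪ V} {E : Finset (Sym2 V)} (hE : IsExtEdges root E)
    (i : W ↪ V) : IsExtEdges i (restEdges i E) := by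
  refine ⟨fun e he => hE.not_isDiag _ (mem_restEdges.1 he).1, fun e he => ?_⟩
  have := (mem_restEdges.1 he).2
  push Not at this
  exact this

theorem edgesIn_coreEdges {root : κ ↪ V} (E : Finset (Sym2 V)) {i : W ↪ V} {root₁ : κ ↪ W}
    (hi : ∀ j, i (root₁ j) = root j) (B : Finset W) :
    edgesIn root₁ (coreEdges i E) B = edgesIn root E (B.map i) := by
  classical
  have hmem : ∀ w, i w ∈ B.map i ∨ i w ∈ Set.range root ↔ w ∈ B ∨ w ∈ Set.range root₁ := by
    intro w
    refine or_congr (by simp) ⟨?_, ?_⟩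
    · rintro ⟨j, hj⟩; exact ⟨j, i.injective (by rw [hi, hj])⟩
    · rintro ⟨j, rfl⟩; exact ⟨j, (hi j).symm⟩
  rw [edgesIn, edgesIn, ← card_map i.sym2Map]
  congr 1
  ext e
  simp only [Finset.mem_map, mem_filter, mem_coreEdges]
  constructor
  · rintro ⟨d, ⟨hd, h⟩, rfl⟩
    refine ⟨hd, fun v hv => ?_⟩
    obtain ⟨w, hw, rfl⟩ := Sym2.mem_map.1 hv
    have := (hmem w).2 (h w hw)
    simpa using this
  · rintro ⟨he, h⟩
    obtain ⟨d, rfl⟩ : ∃ d : Sym2 W, d.map i = e := exists_map_eq fun v hv => by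
      rcases h v hv with h | ⟨j, rfl⟩
      · obtain ⟨w, -, rfl⟩ := h; exact ⟨w, rfl⟩
      · exact ⟨root₁ j, hi j⟩
    refine ⟨d, ⟨he, fun w hw => (hmem w).1 ?_⟩, rfl⟩
    have := h (i w) (Sym2.mem_map.2 ⟨w, hw, rfl⟩)
    simpa using this

theorem mem_map_free_or {root : κ ↪ V} {i : W ↪ V} {root₁ : κ ↪ W}
    (hi : ∀ j, i (root₁ j) = root j) (v : V) :
    v ∈ (free root₁).map i ∨ v ∈ Set.range root ↔ v ∈ Set.range i := by
  constructor
  · rintro (h | ⟨j, rfl⟩)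
    · obtain ⟨w, -, rfl⟩ := Finset.mem_map.1 h; exact ⟨w, rfl⟩
    · exact ⟨root₁ j, hi j⟩
  · rintro ⟨w, rfl⟩
    by_cases hw : w ∈ free root₁
    · exact Or.inl (Finset.mem_map.2 ⟨w, hw, rfl⟩)
    · obtain ⟨j, rfl⟩ : w ∈ Set.range root₁ := by simpa [mem_free] using hw
      exact Or.inr ⟨j, (hi j).symm⟩

/-- The core edges and the edges that `B` adds over the core are disjoint, and both lie within `C`
and the roots. -/
theorem edgesIn_restEdges_add_le {root : κ ↪ V} (E : Finset (Sym2 V)) {i : W ↪ V}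
    {root₁ : κ ↪ W} (hi : ∀ j, i (root₁ j) = root j) {B C : Finset V}
    (hmap : (free root₁).map i ⊆ C) (hB : B ⊆ C) :
    #(coreEdges i E) + edgesIn i (restEdges i E) B ≤ edgesIn root E C := by
  classical
  rw [← card_map i.sym2Map, edgesIn, ← card_union_of_disjoint
    ((disjoint_map_coreEdges i E).mono_right (filter_subset _ _)), edgesIn]
  refine card_le_card fun e he => ?_
  have key := mem_map_free_or hi
  rw [mem_filter]
  rcases mem_union.1 he with h | h
  · obtain ⟨d, hd, rfl⟩ := Finset.mem_map.1 h
    refine ⟨mem_coreEdges.1 hd, fun v hv => ?_⟩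
    obtain ⟨w, -, rfl⟩ := Sym2.mem_map.1 hv
    rcases (key (i w)).2 ⟨w, rfl⟩ with h | h
    · exact Or.inl (hmap h)
    · exact Or.inr h
  · obtain ⟨h1, h2⟩ := mem_filter.1 h
    refine ⟨(mem_restEdges.1 h1).1, fun v hv => ?_⟩
    rcases h2 v hv with h | h
    · exact Or.inl (hB h)
    · rcases (key v).2 h with h | h
      · exact Or.inl (hmap h)
      · exact Or.inr h

theorem card_free_add {root : κ ↪ V} (i : W ↪ V) (root₁ : κ ↪ W) :
    #(free root) = #(free root₁) + #(free i) := by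
  have h1 := card_free root
  have h2 := card_free root₁
  have h3 := card_free i
  omega

theorem numEmbs_mul {root : κ ↪ V} (i : W ↪ V) (root₁ : κ ↪ W) (n : ℕ) :
    numEmbs root n = numEmbs root₁ n * numEmbs i n := by
  have h2 := card_free root₁
  rw [numEmbs, numEmbs, numEmbs, card_free_add i root₁, ← h2,
    ← Nat.descFactorial_mul_descFactorial (Nat.le_add_right #(free root₁) #(free i)),
    Nat.add_sub_cancel_left, mul_comm, Nat.sub_sub, add_comm (Fintype.card κ)]

theorem embMean_mul {root : κ ↪ V} (E : Finset (Sym2 V)) (i : W ↪ V) (root₁ : κ ↪ W) (n : ℕ)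
    (p : ℝ) : embMean root E n p =
      embMean root₁ (coreEdges i E) n p * embMean i (restEdges i E) n p := by
  rw [embMean, embMean, embMean, numEmbs_mul i root₁, ← card_coreEdges_add i E, pow_add]
  push_cast
  ring

/-- Sort the embeddings by their restriction to the core; the fibre over ψ consists of the
embeddings for which the whole core is the root set, placed at ψ. -/
theorem embCount_eq_sum {root : κ ↪ V} (E : Finset (Sym2 V)) {i : W ↪ V} {root₁ : κ ↪ W}
    (hi : ∀ j, i (root₁ j) = root j) (x : κ ↪ Fin n) (s : Finset (Sym2 (Fin n))) :
    embCount root E x s = ∑ ψ ∈ embs root₁ x,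
      ind (im ψ (coreEdges i E) ⊆ s) * embCount i (restEdges i E) ψ s := by
  classical
  have hmaps : ∀ φ ∈ embs root x, i.trans φ ∈ embs root₁ x := fun φ hφ =>
    mem_embs.2 fun j => by
      change φ (i (root₁ j)) = x j
      rw [hi, mem_embs.1 hφ]
  rw [embCount, ← sum_fiberwise_of_maps_to hmaps]
  refine sum_congr rfl fun ψ hψ => ?_
  have hfib : (embs root x).filter (fun φ => i.trans φ = ψ) = embs i ψ := by
    ext φ
    rw [mem_filter, mem_embs, mem_embs]
    constructor
    · rintro ⟨-, rfl⟩ w; rfl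
    · intro h
      refine ⟨fun j => ?_, ?_⟩
      · rw [← hi, h, mem_embs.1 hψ]
      · ext w; exact congrArg Fin.val (h w)
  rw [hfib, embCount, mul_sum]
  refine sum_congr rfl fun φ hφ => ?_
  rw [← ind_and]
  refine ind_congr ?_
  have h1 : im ψ (coreEdges i E) = im φ ((coreEdges i E).map i.sym2Map) := by
    have h2 : i.trans φ = ψ := by
      ext w; exact congrArg Fin.val (mem_embs.1 hφ w)
    ext e
    simp only [mem_im, Finset.mem_map]
    constructor
    · rintro ⟨d, hd, rfl⟩
      refine ⟨_, ⟨d, hd, rfl⟩, ?_⟩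
      change Sym2.map φ (Sym2.map i d) = _
      rw [Sym2.map_map, ← h2]; rfl
    · rintro ⟨_, ⟨d, hd, rfl⟩, rfl⟩
      refine ⟨d, hd, ?_⟩
      change _ = Sym2.map φ (Sym2.map i d)
      rw [Sym2.map_map, ← h2]; rfl
  rw [h1]
  conv_lhs => rw [← map_coreEdges i E]
  rw [im, map_union, union_subset_iff]
  rfl

/-! ### The unique primal core and its polynomial gap -/

/-- The embedded set of vertices spans the unique densest rooted subgraph. -/
structure IsUniquePrimal (root : κ ↪ V) (E : Finset (Sym2 V)) (i : W ↪ V) (root₁ : κ ↪ W) :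
    Prop where
  apply_root : ∀ j, i (root₁ j) = root j
  nonempty : (coreEdges i E).Nonempty
  lt : ∀ A ⊆ free root, A.Nonempty → A ≠ (free root₁).map i →
    #(free root₁) * edgesIn root E A < #(coreEdges i E) * #A

section primal

variable {root : κ ↪ V} {E : Finset (Sym2 V)} {i : W ↪ V} {root₁ : κ ↪ W}

theorem IsUniquePrimal.map_subset_free (h : IsUniquePrimal root E i root₁) {B : Finset W}
    (hB : B ⊆ free root₁) : B.map i ⊆ free root := by
  intro v hv
  obtain ⟨w, hw, rfl⟩ := Finset.mem_map.1 hv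
  refine mem_free.2 ?_
  rintro ⟨j, hj⟩
  rw [← h.apply_root] at hj
  exact mem_free.1 (hB hw) ⟨j, i.injective hj⟩

theorem IsUniquePrimal.strictlyBalanced (h : IsUniquePrimal root E i root₁) :
    StrictlyBalanced root₁ (coreEdges i E) := by
  refine ⟨h.nonempty, fun B hB hne hBf => ?_⟩
  have := h.lt (B.map i) (h.map_subset_free hB) (by simpa using hne) fun h' =>
    hBf (map_injective i h')
  rwa [← edgesIn_coreEdges E h.apply_root, card_map] at this

theorem IsUniquePrimal.edgesIn_eq (h : IsUniquePrimal root E i root₁) :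
    edgesIn root E ((free root₁).map i) = #(coreEdges i E) := by
  rw [← edgesIn_coreEdges E h.apply_root, edgesIn_free]

/-- The core together with `B` is strictly less dense than the core. Subtracting the core shows that
what `B` adds is also strictly less dense, so all partial extensions beyond the core will be
abundant. -/
theorem IsUniquePrimal.lt_rest (h : IsUniquePrimal root E i root₁) {B : Finset V}
    (hB : B ⊆ free i) (hne : B.Nonempty) :
    #(free root₁) * edgesIn i (restEdges i E) B < #(coreEdges i E) * #B := by
  classical
  have hdis : Disjoint ((free root₁).map i) B := by
    rw [disjoint_left]
    intro v hv hvB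
    obtain ⟨w, -, rfl⟩ := Finset.mem_map.1 hv
    exact mem_free.1 (hB hvB) ⟨w, rfl⟩
  have hsub : (free root₁).map i ∪ B ⊆ free root := by
    refine union_subset (h.map_subset_free Subset.rfl) fun v hv => mem_free.2 ?_
    rintro ⟨j, rfl⟩
    exact mem_free.1 (hB hv) ⟨root₁ j, h.apply_root j⟩
  have h1 := h.lt _ hsub (hne.mono subset_union_right) fun h' => by
    obtain ⟨v, hv⟩ := hne
    have hv' := h' ▸ mem_union_right ((free root₁).map i) hv
    exact disjoint_left.1 hdis hv' hv
  rw [card_union_of_disjoint hdis, card_map] at h1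
  have h2 := Nat.mul_le_mul_left #(free root₁) (edgesIn_restEdges_add_le E h.apply_root
    (B := B) subset_union_left subset_union_right)
  rw [mul_add] at h1 h2
  rw [mul_comm #(coreEdges i E) #(free root₁)] at h1
  omega

theorem rpow_le_of_scale {N p s : ℝ} {a₀ e₀ : ℕ} (hN : 1 ≤ N) (he₀ : 0 < e₀) (hp : 0 ≤ p)
    (h : N ^ (-s) ≤ N ^ a₀ * p ^ e₀) : N ^ (-((a₀ : ℝ) / e₀) - s / e₀) ≤ p := by
  have hN0 : 0 < N := by linarith
  have he : (0 : ℝ) < e₀ := by exact_mod_cast he₀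
  refine le_of_pow_le_pow_left₀ he₀.ne' hp ?_
  rw [← Real.rpow_natCast (N ^ _), ← Real.rpow_mul hN0.le,
    show (-((a₀ : ℝ) / e₀) - s / e₀) * (e₀ : ℝ) = -s - a₀ by field_simp; ring, Real.rpow_sub hN0,
    Real.rpow_natCast, div_le_iff₀ (by positivity)]
  linarith

/-- Strict inequality between integers yields a - a₀f/e₀ ≥ 1/e₀. Half of this exponent pays for the
deviation δ of `p` from the threshold, the other half remains. -/
theorem le_pow_mul_pow {N p δ : ℝ} {a₀ e₀ a f : ℕ} (hN : 1 ≤ N) (he₀ : 0 < e₀)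
    (h : a₀ * f < e₀ * a) (hp : N ^ (-((a₀ : ℝ) / e₀) - δ) ≤ p) (hδ : f * δ ≤ 1 / (2 * e₀)) :
    N ^ (1 / (2 * (e₀ : ℝ))) ≤ N ^ a * p ^ f := by
  have hN0 : 0 < N := by linarith
  have he : (0 : ℝ) < e₀ := by exact_mod_cast he₀
  have h' : (a₀ : ℝ) * f + 1 ≤ e₀ * a := by exact_mod_cast h
  calc N ^ (1 / (2 * (e₀ : ℝ))) ≤ N ^ ((a : ℝ) + (-((a₀ : ℝ) / e₀) - δ) * f) := by
        refine Real.rpow_le_rpow_of_exponent_le hN ?_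
        have h1 : 1 / (e₀ : ℝ) ≤ a - a₀ * f / e₀ := by
          rw [div_le_iff₀ he, sub_mul, div_mul_cancel₀ _ he.ne']
          linarith
        have h2 : 1 / (e₀ : ℝ) = 1 / (2 * e₀) + 1 / (2 * e₀) := by field_simp; norm_num
        have h3 : (a : ℝ) + (-((a₀ : ℝ) / e₀) - δ) * f = (a - a₀ * f / e₀) - f * δ := by ring
        rw [h3]; linarith
    _ = N ^ a * (N ^ (-((a₀ : ℝ) / e₀) - δ)) ^ f := by
        rw [Real.rpow_add hN0, Real.rpow_natCast, Real.rpow_mul hN0.le, Real.rpow_natCast]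
    _ ≤ _ := by gcongr

/-- The exponent gap between the primal subgraph and all others. -/
noncomputable def gap (i : W ↪ V) (E : Finset (Sym2 V)) : ℝ := 1 / (2 * (#(coreEdges i E) : ℝ))

theorem IsUniquePrimal.gap_pos (h : IsUniquePrimal root E i root₁) : 0 < gap i E := by
  have : (0 : ℝ) < #(coreEdges i E) := by exact_mod_cast h.nonempty.card_pos
  unfold gap; positivity

theorem mul_div_le_gap {τ : ℝ} (hτ : 0 < τ) (hτE : τ * #E ≤ 1 / 2) {f : ℕ} (hf : f ≤ #E)
    (he : 0 < #(coreEdges i E)) :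
    f * (τ / #(coreEdges i E)) ≤ 1 / (2 * (#(coreEdges i E) : ℝ)) := by
  have he' : (0 : ℝ) < #(coreEdges i E) := by exact_mod_cast he
  have hf' : (f : ℝ) ≤ #E := by exact_mod_cast hf
  rw [mul_div_assoc', div_le_div_iff₀ he' (by positivity)]
  nlinarith [mul_le_mul_of_nonneg_left hf' hτ.le]

theorem IsUniquePrimal.rpow_gap_le (h : IsUniquePrimal root E i root₁) {τ p : ℝ} (hτ : 0 < τ)
    (hτE : τ * #E ≤ 1 / 2) (hn : 1 ≤ n) (hp : 0 ≤ p)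
    (hs : (n : ℝ) ^ (-τ) ≤ scale root₁ (coreEdges i E) n p) {a f : ℕ} (hf : f ≤ #E)
    (hlt : #(free root₁) * f < #(coreEdges i E) * a) :
    (n : ℝ) ^ gap i E ≤ (n : ℝ) ^ a * p ^ f := by
  have hN1 : (1 : ℝ) ≤ n := by exact_mod_cast hn
  have he := h.nonempty.card_pos
  exact le_pow_mul_pow hN1 he hlt (rpow_le_of_scale hN1 he hp hs) (mul_div_le_gap hτ hτE hf he)

theorem IsUniquePrimal.overlapBound (h : IsUniquePrimal root E i root₁) {τ p : ℝ} (hτ : 0 < τ)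
    (hτE : τ * #E ≤ 1 / 2) (hn : 1 ≤ n) (hp : 0 ≤ p)
    (hs : (n : ℝ) ^ (-τ) ≤ scale root₁ (coreEdges i E) n p) :
    OverlapBound root₁ (coreEdges i E) n p ((n : ℝ) ^ gap i E) := by
  intro A hA hne f hf hfE
  have hEle : #(coreEdges i E) ≤ #E := by have := card_coreEdges_add i E; omega
  refine h.rpow_gap_le hτ hτE hn hp hs (hfE.le.trans hEle) ?_
  -- When all core vertices are hit, the missing edge f < e gives the strict inequality; otherwise
  -- strict balance does.
  by_cases hAf : A = free root₁
  · rw [hAf, mul_comm]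
    exact Nat.mul_lt_mul_of_pos_right hfE (by rw [← hAf]; exact hne.card_pos)
  · exact (Nat.mul_le_mul_left _ hf).trans_lt (h.strictlyBalanced.lt A hA hne hAf)

theorem IsUniquePrimal.rpow_gap_le_rest (h : IsUniquePrimal root E i root₁) {τ p : ℝ} (hτ : 0 < τ)
    (hτE : τ * #E ≤ 1 / 2) (hn : 1 ≤ n) (hp : 0 ≤ p)
    (hs : (n : ℝ) ^ (-τ) ≤ scale root₁ (coreEdges i E) n p) :
    ∀ B ⊆ free i, B.Nonempty →
      (n : ℝ) ^ gap i E ≤ (n : ℝ) ^ #B * p ^ edgesIn i (restEdges i E) B := by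
  intro B hB hne
  refine h.rpow_gap_le hτ hτE hn hp hs ((edgesIn_le _ _ _).trans ?_) (h.lt_rest hB hne)
  have := card_coreEdges_add i E; omega

theorem bprob_exists_tuple_le {c : ℕ} {ι : Type*} [Fintype ι] (hι : Fintype.card ι ≤ c) (hn : 1 ≤ n)
    {p B : ℝ} (hp0 : 0 ≤ p) (hp1 : p ≤ 1) (P : (ι ↪ Fin n) → Finset (Sym2 (Fin n)) → Prop)
    (hB : 0 ≤ B) (h : ∀ x, bprob p (allEdges n) (P x) ≤ B * (n : ℝ) ^ (-((c : ℝ) + 1))) :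
    bprob p (allEdges n) (fun s => ∃ x, P x s) ≤ B * (n : ℝ) ^ (-1 : ℝ) := by
  classical
  have hN1 : (1 : ℝ) ≤ n := by exact_mod_cast hn
  have hN0 : (0 : ℝ) < n := by linarith
  have h1 := bprob_exists_le_card_mul (T := allEdges n) hp0 hp1 (univ : Finset (ι ↪ Fin n)) P
    fun x _ => h x
  have hcard : (#(univ : Finset (ι ↪ Fin n)) : ℝ) ≤ (n : ℝ) ^ c := by
    have h2 : #(univ : Finset (ι ↪ Fin n)) ≤ n ^ c := by
      rw [card_univ, Fintype.card_embedding_eq, Fintype.card_fin]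
      exact (Nat.descFactorial_le_pow _ _).trans (Nat.pow_le_pow_right hn hι)
    exact_mod_cast h2
  simp only [mem_univ, true_and] at h1
  refine h1.trans ?_
  calc _ ≤ (n : ℝ) ^ c * (B * (n : ℝ) ^ (-((c : ℝ) + 1))) := by gcongr
    _ = B * ((n : ℝ) ^ (c : ℝ) * (n : ℝ) ^ (-((c : ℝ) + 1))) := by rw [Real.rpow_natCast]; ring
    _ = _ := by rw [← Real.rpow_add hN0]; congr 2; ring

theorem embCount_le_of_forall_le (E : Finset (Sym2 V))
    (hi : ∀ j, i (root₁ j) = root j) (hc : Covers root₁ (coreEdges i E)) (x : κ ↪ Fin n)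
    (s : Finset (Sym2 (Fin n))) {b : ℝ} (hb : ∀ ψ, embCount i (restEdges i E) ψ s ≤ b) :
    embCount root E x s ≤
      aut root₁ (coreEdges i E) * copyCount root₁ (coreEdges i E) x s * b := by
  rw [← embCount_eq hc, embCount_eq_sum E hi, embCount, sum_mul]
  exact sum_le_sum fun ψ _ => mul_le_mul_of_nonneg_left (hb ψ) (ind_nonneg _)

theorem le_embCount_of_forall_le (E : Finset (Sym2 V))
    (hi : ∀ j, i (root₁ j) = root j) (hc : Covers root₁ (coreEdges i E)) (x : κ ↪ Fin n)
    (s : Finset (Sym2 (Fin n))) {b : ℝ} (hb : ∀ ψ, b ≤ embCount i (restEdges i E) ψ s) :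
    aut root₁ (coreEdges i E) * copyCount root₁ (coreEdges i E) x s * b ≤
      embCount root E x s := by
  rw [← embCount_eq hc, embCount_eq_sum E hi, embCount, sum_mul]
  exact sum_le_sum fun ψ _ => mul_le_mul_of_nonneg_left (hb ψ) (ind_nonneg _)

theorem embMean_eq_mul (E : Finset (Sym2 V)) (i : W ↪ V) (root₁ : κ ↪ W) (n : ℕ) (p : ℝ) :
    embMean root E n p = aut root₁ (coreEdges i E) * copyMean root₁ (coreEdges i E) n p *
      embMean i (restEdges i E) n p := by
  rw [embMean_mul E i root₁, embMean_eq_aut_mul root₁]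

end primal

end RootedExtension
-- Concentration and its failure for embedding counts
namespace RootedExtension

open Finset BernoulliSubset

variable {κ V W : Type*} [Fintype κ] [Fintype V] [Fintype W] {n : ℕ}
variable {root : κ ↪ V} {E : Finset (Sym2 V)} {i : W ↪ V} {root₁ : κ ↪ W}

/-- The constant in the exponent of the lower tail estimate. -/
noncomputable def tailConst (c : ℕ) : ℝ := 12 * (2 ^ c * (c : ℝ) ^ c * 4 ^ c)

theorem tailConst_pos (c : ℕ) : 0 < tailConst c := by
  have : (0 : ℝ) < (c : ℝ) ^ c := by exact_mod_cast Nat.pow_self_pos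
  unfold tailConst; positivity

theorem embMean_pos (root : κ ↪ V) (E : Finset (Sym2 V)) (hn : 2 * Fintype.card V ≤ n) (hn1 : 1 ≤ n)
    {p : ℝ} (hp : 0 < p) : 0 < embMean root E n p := by
  have h := le_embMean root E hn hp.le
  have hN : (0 : ℝ) < n := by exact_mod_cast hn1
  have h2 : 0 < (n : ℝ) ^ #(free root) * p ^ #E := by positivity
  exact pos_of_mul_pos_right (h2.trans_le h) (by positivity)

theorem bprob_exists_lower_tail_le (hE : IsExtEdges root E) (hn : 2 * Fintype.card V ≤ n)
    (hn1 : 2 ≤ n) {p ε C : ℝ} (hp0 : 0 < p) (hp1 : p ≤ 1) (hε0 : 0 < ε) (hε1 : ε ≤ 1)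
    (hC : C = tailConst (Fintype.card V) * (Fintype.card κ + 1))
    (h : ∀ A ⊆ free root, 0 < edgesIn root E A →
      C * Real.log n ≤ ε ^ 2 * ((n : ℝ) ^ #A * p ^ edgesIn root E A)) :
    bprob p (allEdges n) (fun s => ∃ x, embCount root E x s ≤ (1 - ε) * embMean root E n p) ≤
      1 * (n : ℝ) ^ (-1 : ℝ) := by
  have hD := tailConst_pos (Fintype.card V)
  have hN1 : (1 : ℝ) < n := by exact_mod_cast hn1
  have hlog : 0 < Real.log n := Real.log_pos hN1
  have hCpos : 0 < C := by rw [hC]; positivity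
  refine bprob_exists_tuple_le (c := Fintype.card κ) le_rfl (by omega) hp0.le hp1
    (fun x s => embCount root E x s ≤ (1 - ε) * embMean root E n p) zero_le_one fun x => ?_
  -- This makes the exponent exactly (|κ|+1) log n, which beats the at most n^|κ| tuples by a factor
  -- n.
  refine (lower_tail hE x hp0 hp1 (g := C * Real.log n / ε ^ 2) (by positivity) hn
    (fun A hA hA' => ?_) hε0 hε1).trans ?_
  · rw [div_le_iff₀ (by positivity)]
    exact (h A hA hA').trans_eq (by ring)
  · rw [one_mul, Real.rpow_def_of_pos (by linarith)]
    refine Real.exp_le_exp.2 (le_of_eq ?_)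
    change -(ε ^ 2 * _ / tailConst _) = _
    rw [hC]
    field_simp

theorem eventually_exists_upper_tail_le (hE : IsExtEdges root E) {α β : ℝ} (hα : 0 < α)
    (hαβ : α * (2 * Fintype.card V + 1) < β) :
    ∀ᶠ n : ℕ in atTop, ∀ p : ℝ, 0 < p → p ≤ 1 →
      (∀ A ⊆ free root, A.Nonempty → (n : ℝ) ^ β ≤ (n : ℝ) ^ #A * p ^ edgesIn root E A) →
      ∀ ε : ℝ, (n : ℝ) ^ (-α) ≤ ε → ε ≤ 1 →
        bprob p (allEdges n)
          (fun s => ∃ x, (1 + ε) * embMean root E n p ≤ embCount root E x s) ≤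
          1 * (n : ℝ) ^ (-1 : ℝ) := by
  filter_upwards [eventually_upper_tail hE hα hαβ, eventually_ge_atTop 1,
    eventually_pow_mul_exp_le ((Fintype.card κ : ℝ) + 1) (C := 1 / 4) (by norm_num) hα]
    with n h1 hn h2 p hp0 hp1 hA ε hε0 hε1
  refine bprob_exists_tuple_le (c := Fintype.card κ) le_rfl hn hp0.le hp1
    (fun x s => (1 + ε) * embMean root E n p ≤ embCount root E x s) zero_le_one fun x => ?_
  rw [one_mul]
  exact (h1 p hp0 hp1 hA ε hε0 hε1 x).trans h2

theorem eventually_exists_lower_tail_le (hE : IsExtEdges root E) {α β : ℝ}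
    (hαβ : 2 * α < β) :
    ∀ᶠ n : ℕ in atTop, ∀ p : ℝ, 0 < p → p ≤ 1 →
      (∀ A ⊆ free root, A.Nonempty → (n : ℝ) ^ β ≤ (n : ℝ) ^ #A * p ^ edgesIn root E A) →
      ∀ ε : ℝ, (n : ℝ) ^ (-α) ≤ ε → ε ≤ 1 →
        bprob p (allEdges n)
          (fun s => ∃ x, embCount root E x s ≤ (1 - ε) * embMean root E n p) ≤
          1 * (n : ℝ) ^ (-1 : ℝ) := by
  filter_upwards [eventually_ge_atTop 2, eventually_ge_atTop (2 * Fintype.card V),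
    eventually_mul_log_le (tailConst (Fintype.card V) * (Fintype.card κ + 1))
      (sub_pos.2 hαβ)]
    with n hn hn2 h2 p hp0 hp1 hA ε hε0 hε1
  have hN0 : (0 : ℝ) < n := by exact_mod_cast (by omega : 0 < n)
  have hε : 0 < ε := (Real.rpow_pos_of_pos hN0 _).trans_le hε0
  refine bprob_exists_lower_tail_le hE hn2 hn hp0 hp1 hε hε1 rfl fun A hAf hA0 => ?_
  have hne : A.Nonempty := by
    rw [nonempty_iff_ne_empty]
    rintro rfl
    rw [edgesIn_empty hE] at hA0
    exact absurd hA0 (lt_irrefl _)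
  refine h2.trans ?_
  calc (n : ℝ) ^ (β - 2 * α) = ((n : ℝ) ^ (-α)) ^ 2 * (n : ℝ) ^ β := by
        rw [← Real.rpow_natCast, ← Real.rpow_mul hN0.le, ← Real.rpow_add hN0]
        congr 1; push_cast; ring
    _ ≤ _ := by
        have := hA A hAf hne
        gcongr

/-- Admissible exponents for the concentration statements. -/
structure Exponents (i : W ↪ V) (E : Finset (Sym2 V)) (τ α : ℝ) : Prop where
  pos : 0 < τ
  pos' : 0 < α
  gap : τ * (Fintype.card V + 50) < gap i E
  edges : τ * (#E + 50) < 1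
  edges' : τ * #E ≤ 1 / 2
  lt : 2 * α * (2 * Fintype.card V + 1) < τ

theorem IsUniquePrimal.exists_exponents (h : IsUniquePrimal root E i root₁) :
    ∃ τ α, Exponents i E τ α := by
  have hθ := h.gap_pos
  set θ := RootedExtension.gap i E
  set c : ℝ := (Fintype.card V : ℝ)
  set e : ℝ := (#E : ℝ)
  have hc : 0 ≤ c := Nat.cast_nonneg _
  have he : 0 ≤ e := Nat.cast_nonneg _
  set τ := min (θ / (2 * (c + 50))) (1 / (2 * (e + 50)))
  have hτ : 0 < τ := lt_min (by positivity) (by positivity)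
  have h1 : τ * (2 * (c + 50)) ≤ θ := (le_div_iff₀ (by positivity)).1 (min_le_left _ _)
  have h2 : τ * (2 * (e + 50)) ≤ 1 := (le_div_iff₀ (by positivity)).1 (min_le_right _ _)
  refine ⟨τ, τ / (8 * (c + 1)), hτ, by positivity, ?_, ?_, ?_, ?_⟩
  · change τ * (c + 50) < θ
    nlinarith
  · change τ * (e + 50) < 1
    nlinarith
  · change τ * e ≤ 1 / 2
    nlinarith
  · change 2 * (τ / (8 * (c + 1))) * (2 * c + 1) < τ
    have : 2 * (τ / (8 * (c + 1))) * (2 * c + 1) = τ * ((4 * c + 2) / (8 * (c + 1))) := by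
      field_simp; ring
    rw [this]
    refine mul_lt_of_lt_one_right hτ ?_
    rw [div_lt_one (by positivity)]
    linarith

theorem Exponents.two_mul_lt {τ α : ℝ} (h : Exponents i E τ α) : 2 * α < τ := by
  have h1 := h.lt
  have h2 : 0 ≤ α * Fintype.card V := mul_nonneg h.pos'.le (Nat.cast_nonneg _)
  nlinarith

theorem Exponents.lt_gap {τ α : ℝ} (h : Exponents i E τ α) : 50 * τ < RootedExtension.gap i E := by
  have h1 := h.gap
  have h2 : 0 ≤ τ * Fintype.card V := mul_nonneg h.pos.le (Nat.cast_nonneg _)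
  linarith

/-- The lower tail is uniform in all cases. The upper tail splits according to whether every partial
extension is polynomially abundant or the core alone is near its threshold. -/
theorem IsUniquePrimal.eventually_concentrated (h : IsUniquePrimal root E i root₁)
    (hE : IsExtEdges root E) {τ α : ℝ} (hx : Exponents i E τ α) :
    ∃ C : ℝ, 0 < C ∧ ∀ᶠ n : ℕ in atTop, ∀ p : ℝ, 0 ≤ p → p ≤ 1 →
      ∀ ε : ℝ, (n : ℝ) ^ (-α) ≤ ε → ε ≤ 1 →
      (∀ A ⊆ free root, 0 < edgesIn root E A →
        C * Real.log n ≤ ε ^ 2 * ((n : ℝ) ^ #A * p ^ edgesIn root E A)) →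
      bprob p (allEdges n) (fun s => ∃ x,
        ε * embMean root E n p ≤ |embCount root E x s - embMean root E n p|) ≤
        4 * (n : ℝ) ^ (-1 : ℝ) := by
  have hθ := h.gap_pos
  have hτ := hx.pos
  have hα := hx.pos'
  have hlg := hx.lt_gap
  have h2α := hx.two_mul_lt
  set θ := RootedExtension.gap i E with hθdef
  have hE₁ := isExtEdges_coreEdges hE h.apply_root
  have hE₂ := isExtEdges_restEdges hE i
  have hb := h.strictlyBalanced
  have hc := hb.covers hE₁
  set C₁ := tailConst (Fintype.card V) * ((Fintype.card κ : ℝ) + 1) with hC₁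
  have hC₁pos : 0 < C₁ := by have := tailConst_pos (Fintype.card V); positivity
  set C₂ : ℝ := 16 * (32 * ((Fintype.card κ + 1 : ℕ) + 1)) *
    (2 ^ Fintype.card W * aut root₁ (coreEdges i E)) with hC₂
  have hautpos : (0 : ℝ) < aut root₁ (coreEdges i E) := by exact_mod_cast aut_pos _ _
  have hC₂pos : 0 < C₂ := by positivity
  have hWV : Fintype.card W ≤ Fintype.card V := Fintype.card_le_of_embedding i
  have hltθ : 2 * α * (2 * Fintype.card V + 1) < θ := by linarith [hx.lt]
  have hltτ : α * (2 * Fintype.card V + 1) < τ := by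
    have h1 := hx.lt
    have h2 : 0 < α * (2 * Fintype.card V + 1) := by positivity
    linarith
  refine ⟨C₁ + C₂ + 1, by positivity, ?_⟩
  filter_upwards [eventually_ge_atTop 2, eventually_ge_atTop (2 * Fintype.card V),
    eventually_le_log 1, eventually_exists_upper_tail_le hE hα hltτ,
    eventually_exists_upper_tail_le hE₂ (by positivity : 0 < 2 * α) hltθ,
    eventually_upper_tail_copies hE₁ hb hθ (Fintype.card κ + 1),
    eventually_mul_rpow_le 4 (show -(2 * α) < -α by linarith)]
    with n hn2 hnV hlog hU1 hU2 hU3 h4 p hp0 hp1 ε hεα hε1 hA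
  have hN2 : (2 : ℝ) ≤ n := by exact_mod_cast hn2
  have hN0 : (0 : ℝ) < n := by linarith
  have hε0 : 0 < ε := (Real.rpow_pos_of_pos hN0 _).trans_le hεα
  have hn1 : (0 : ℝ) ≤ (n : ℝ) ^ (-1 : ℝ) := by positivity
  have hCC : ∀ {C : ℝ}, C ≤ C₁ + C₂ + 1 → C * Real.log n ≤ (C₁ + C₂ + 1) * Real.log n :=
    fun hC => mul_le_mul_of_nonneg_right hC (by linarith)
  have hscale : (C₁ + C₂ + 1) * Real.log n ≤ ε ^ 2 * scale root₁ (coreEdges i E) n p := by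
    have := hA ((free root₁).map i) (h.map_subset_free Subset.rfl)
      (by rw [h.edgesIn_eq]; exact h.nonempty.card_pos)
    rwa [h.edgesIn_eq, card_map] at this
  have hs0 : 0 ≤ scale root₁ (coreEdges i E) n p := by unfold scale; positivity
  have hs1 : 1 ≤ scale root₁ (coreEdges i E) n p := by
    have h1 : 1 * Real.log n ≤ _ := hCC (by linarith : (1 : ℝ) ≤ C₁ + C₂ + 1)
    have h2 : ε ^ 2 * scale root₁ (coreEdges i E) n p ≤ 1 * scale root₁ (coreEdges i E) n p := by
      gcongr; exact pow_le_one₀ hε0.le hε1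
    linarith
  have hp : 0 < p := by
    refine lt_of_le_of_ne hp0 fun h0 => ?_
    rw [← h0, scale, zero_pow h.nonempty.card_pos.ne'] at hs1
    linarith
  have hμ := embMean_pos root E hnV (by omega) hp
  have hsτ : (n : ℝ) ^ (-τ) ≤ scale root₁ (coreEdges i E) n p :=
    (Real.rpow_le_one_of_one_le_of_nonpos (by linarith) (by linarith)).trans hs1
  have hL := bprob_exists_lower_tail_le hE hnV hn2 hp hp1 hε0 hε1 hC₁
    fun A hAf hA0 => (hCC (by linarith)).trans (hA A hAf hA0)
  have hU : bprob p (allEdges n)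
      (fun s => ∃ x, (1 + ε) * embMean root E n p ≤ embCount root E x s) ≤
      3 * (n : ℝ) ^ (-1 : ℝ) := by
    by_cases hab : ∀ A ⊆ free root, A.Nonempty →
        (n : ℝ) ^ τ ≤ (n : ℝ) ^ #A * p ^ edgesIn root E A
    · exact (hU1 p hp hp1 hab ε hεα hε1).trans (by linarith)
    push Not at hab
    obtain ⟨A, hAf, hne, hAlt⟩ := hab
    have hτθ : (n : ℝ) ^ τ ≤ (n : ℝ) ^ θ :=
      Real.rpow_le_rpow_of_exponent_le (by linarith) (by linarith)
    -- A partial extension below n^τ contradicts the gap unless it is the core. So the core is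
    -- sparse enough for the copy estimate, and the extensions over it are abundant.
    have hAeq : A = (free root₁).map i := by
      by_contra hAne
      have := h.rpow_gap_le hτ hx.edges' (by omega) hp0 hsτ (edgesIn_le root E A)
        (h.lt A hAf hne hAne)
      linarith
    rw [hAeq, h.edgesIn_eq, card_map] at hAlt
    have hsle : scale root₁ (coreEdges i E) n p ≤ (n : ℝ) ^ (θ / 4) :=
      hAlt.le.trans (Real.rpow_le_rpow_of_exponent_le (by linarith) (by linarith))
    have hov := h.overlapBound hτ hx.edges' (by omega) hp0 hsτ
    have hε4 : ε / 4 ≤ 1 := by linarith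
    have hε4' : 0 < ε / 4 := by linarith
    have hlogc : 32 * (((Fintype.card κ + 1 : ℕ) : ℝ) + 1) * Real.log n ≤
        (ε / 4) ^ 2 * copyMean root₁ (coreEdges i E) n p := by
      have h1 := scale_le_copyMean root₁ (coreEdges i E) (by omega : 2 * Fintype.card W ≤ n) hp0
      have h2 : C₂ * Real.log n ≤ ε ^ 2 * (2 ^ Fintype.card W * aut root₁ (coreEdges i E) *
          copyMean root₁ (coreEdges i E) n p) :=
        (hCC (by linarith)).trans (hscale.trans (by gcongr))
      have hpos : (0 : ℝ) < 2 ^ Fintype.card W * aut root₁ (coreEdges i E) := by positivity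
      rw [hC₂] at h2
      refine le_of_mul_le_mul_left ?_ hpos
      linarith
    have hcop := bprob_exists_tuple_le (n := n) (c := Fintype.card κ) (ι := κ) le_rfl (by omega)
      hp0 hp1
      (fun x s => (1 + ε / 4) * copyMean root₁ (coreEdges i E) n p ≤
        copyCount root₁ (coreEdges i E) x s) zero_le_two fun x => by
        have := hU3 p hp hp1 hov hsle (ε / 4) hε4' hε4 x
          (by rw [card_copies_mul_pow hc]; exact hlogc)
        rw [card_copies_mul_pow hc] at this
        push_cast at this
        exact this
    -- The core and the rest each get error ε/4, since (1+ε/4)² < 1+ε. The exponent 2α in `hU2`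
    -- makes ε/4 admissible, as 4n^(-2α) ≤ n^(-α).
    have hrest := hU2 p hp hp1 (h.rpow_gap_le_rest hτ hx.edges' (by omega) hp0 hsτ) (ε / 4)
      (by linarith) hε4
    refine ((bprob_mono hp0 hp1 fun s _ hs => ?_).trans (bprob_or_le hp0 hp1 _ _)).trans
      ((add_le_add hcop hrest).trans (by linarith))
    by_contra hcon
    push Not at hcon
    obtain ⟨h1, h2⟩ := hcon
    obtain ⟨x, hxs⟩ := hs
    have h3 := embCount_le_of_forall_le E h.apply_root hc x s fun ψ => (h2 ψ).le
    have h4 := (h1 x).le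
    have hm := embMean_eq_mul (root := root) E i root₁ n p
    have hr := (embMean_pos i (restEdges i E) hnV (by omega) hp).le
    have h5 : embCount root E x s ≤ (1 + ε / 4) ^ 2 * embMean root E n p := by
      calc _ ≤ _ := h3
        _ ≤ aut root₁ (coreEdges i E) * ((1 + ε / 4) * copyMean root₁ (coreEdges i E) n p) *
            ((1 + ε / 4) * embMean i (restEdges i E) n p) := by gcongr
        _ = _ := by rw [hm]; ring
    have h6 : (1 + ε / 4) ^ 2 < 1 + ε := by nlinarith
    have := mul_lt_mul_of_pos_right h6 hμ
    linarith
  refine ((bprob_mono hp0 hp1 fun s _ hs => ?_).trans (bprob_or_le hp0 hp1 _ _)).trans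
    ((add_le_add hL hU).trans (by linarith))
  obtain ⟨x, hxs⟩ := hs
  rcases le_abs.1 hxs with h1 | h1
  · exact Or.inr ⟨x, by linarith⟩
  · exact Or.inl ⟨x, by linarith⟩

/-- Since ε ≤ 1, a zero count is never concentrated. Concentration therefore forces a copy of the
core at one fixed tuple, which the first moment bounds. -/
theorem bprob_forall_concentrated_le_scale
    (hE : IsExtEdges root E) (hi : ∀ j, i (root₁ j) = root j)
    (hn : Fintype.card κ ≤ n) {p ε : ℝ} (hp0 : 0 ≤ p) (hp1 : p ≤ 1) (hε1 : ε ≤ 1) :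
    bprob p (allEdges n) (fun s => ∀ x,
        |embCount root E x s - embMean root E n p| < ε * embMean root E n p) ≤
      scale root₁ (coreEdges i E) n p := by
  classical
  obtain ⟨x⟩ : Nonempty (κ ↪ Fin n) :=
    Function.Embedding.nonempty_of_card_le (by simpa using hn)
  have hE₁ := isExtEdges_coreEdges hE hi
  have hμ := embMean_nonneg root E n hp0
  calc _ ≤ bprob p (allEdges n)
        (fun s => ∃ ψ, ψ ∈ embs root₁ x ∧ im ψ (coreEdges i E) ⊆ s) := by
        refine bprob_mono hp0 hp1 fun s _ hs => ?_
        by_contra hcon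
        push Not at hcon
        have h0 : embCount root E x s = 0 := by
          rw [embCount_eq_sum E hi]
          exact sum_eq_zero fun ψ hψ => by rw [ind_of_not (hcon ψ hψ), zero_mul]
        have := hs x
        rw [h0, zero_sub, abs_neg, abs_of_nonneg hμ] at this
        nlinarith
    _ ≤ #(embs root₁ x) * p ^ #(coreEdges i E) :=
        bprob_exists_le_card_mul hp0 hp1 _ (fun ψ s => im ψ (coreEdges i E) ⊆ s) fun ψ _ => by
          rw [bprob_subset (im_subset_allEdges hE₁ ψ), card_im]
    _ ≤ _ := by
        rw [card_embs, scale]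
        gcongr
        exact numEmbs_le _ _

/-- A rare core leaves some tuple without a copy. A core near its threshold gives some tuple too
many copies, and the lower tail over the core turns these into too many embeddings of the whole
graph. -/
theorem IsUniquePrimal.eventually_not_concentrated (h : IsUniquePrimal root E i root₁)
    (hE : IsExtEdges root E) {j : κ} {u : W} (hju : s(root₁ j, u) ∈ coreEdges i E)
    {τ α : ℝ} (hx : Exponents i E τ α) :
    ∀ᶠ n : ℕ in atTop, ∀ p : ℝ, 0 ≤ p → p ≤ 1 →
      ∀ ε : ℝ, (n : ℝ) ^ (-α) ≤ ε → ε ≤ 1 →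
      (∃ A ⊆ free root, ∃ f, 0 < f ∧ f ≤ edgesIn root E A ∧
        ε ^ 2 * ((n : ℝ) ^ #A * p ^ f) ≤ τ * Real.log n) →
      bprob p (allEdges n) (fun s => ∀ x,
        |embCount root E x s - embMean root E n p| < ε * embMean root E n p) ≤
        (n : ℝ) ^ (-τ) + (n : ℝ) ^ (-1 : ℝ) := by
  have hθ := h.gap_pos
  have hτ := hx.pos
  have hα := hx.pos'
  have hlg := hx.lt_gap
  have h2α := hx.two_mul_lt
  have hgap := hx.gap
  set θ := RootedExtension.gap i E with hθdef
  have hE₁ := isExtEdges_coreEdges hE h.apply_root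
  have hE₂ := isExtEdges_restEdges hE i
  have hb := h.strictlyBalanced
  have hc := hb.covers hE₁
  have hWV : Fintype.card W ≤ Fintype.card V := Fintype.card_le_of_embedding i
  have hWV' : (Fintype.card W : ℝ) ≤ Fintype.card V := by exact_mod_cast hWV
  have hκV : Fintype.card κ ≤ Fintype.card V := Fintype.card_le_of_embedding root
  have hEle : (#(coreEdges i E) : ℝ) ≤ #E := by
    have := card_coreEdges_add i E
    exact_mod_cast (by omega : #(coreEdges i E) ≤ #E)
  have hτθ : τ * (Fintype.card W + 50) < θ :=
    lt_of_le_of_lt (by gcongr) hgap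
  have hτE : τ * (#(coreEdges i E) + 50) < 1 := lt_of_le_of_lt (by gcongr) hx.edges
  filter_upwards [eventually_ge_atTop 2, eventually_ge_atTop (2 * Fintype.card V),
    eventually_le_log 1, eventually_exists_many_copies hE₁ hb hju hτ hτθ hτE,
    eventually_exists_lower_tail_le (α := 2 * α) (β := θ) hE₂ (by linarith),
    eventually_mul_rpow_le 4 (show -(2 * α) < -α by linarith),
    eventually_mul_log_le (τ + 1) (show 0 < τ - 2 * α by linarith)]
    with n hn2 hnV hlog hZ hL h4 hlogτ p hp0 hp1 ε hεα hε1 hA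
  have hN2 : (2 : ℝ) ≤ n := by exact_mod_cast hn2
  have hN0 : (0 : ℝ) < n := by linarith
  have hε0 : 0 < ε := (Real.rpow_pos_of_pos hN0 _).trans_le hεα
  have hn1 : (0 : ℝ) ≤ (n : ℝ) ^ (-1 : ℝ) := by positivity
  by_cases hsτ : (n : ℝ) ^ (-τ) ≤ scale root₁ (coreEdges i E) n p
  swap
  · refine (bprob_forall_concentrated_le_scale hE h.apply_root (by omega) hp0 hp1 hε1).trans ?_
    push Not at hsτ
    linarith
  -- As ε² ≥ n^(-2α) and 2α < τ, the critical window log n / ε² lies below n^τ. This is why ε may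
  -- only be polynomially small.
  have hsmall : ∀ t : ℝ, ε ^ 2 * t ≤ τ * Real.log n → t < (n : ℝ) ^ τ := by
    intro t ht
    have h1 : (n : ℝ) ^ (-(2 * α)) ≤ ε ^ 2 := by
      calc (n : ℝ) ^ (-(2 * α)) = ((n : ℝ) ^ (-α)) ^ 2 := by
            rw [← Real.rpow_natCast, ← Real.rpow_mul hN0.le]
            congr 1; push_cast; ring
        _ ≤ _ := by gcongr
    by_contra hcon
    push Not at hcon
    have h2 : (n : ℝ) ^ (τ - 2 * α) ≤ ε ^ 2 * t := by
      calc (n : ℝ) ^ (τ - 2 * α) = (n : ℝ) ^ (-(2 * α)) * (n : ℝ) ^ τ := by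
            rw [← Real.rpow_add hN0]; congr 1; ring
        _ ≤ _ := by gcongr
    linarith
  have hp : 0 < p := by
    refine lt_of_le_of_ne hp0 fun h0 => ?_
    rw [← h0, scale, zero_pow h.nonempty.card_pos.ne', mul_zero] at hsτ
    exact absurd hsτ (not_le.2 (Real.rpow_pos_of_pos hN0 _))
  obtain ⟨A, hAf, f, hf0, hfA, hAle⟩ := hA
  have hτθ' : (n : ℝ) ^ τ ≤ (n : ℝ) ^ θ :=
    Real.rpow_le_rpow_of_exponent_le (by linarith) (by linarith)
  have hne : A.Nonempty := by
    rw [nonempty_iff_ne_empty]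
    rintro rfl
    rw [edgesIn_empty hE] at hfA
    omega
  have hAeq : A = (free root₁).map i := by
    by_contra hAne
    have := h.rpow_gap_le hτ hx.edges' (by omega) hp0 hsτ (hfA.trans (edgesIn_le root E A))
      ((Nat.mul_le_mul_left _ hfA).trans_lt (h.lt A hAf hne hAne))
    linarith [hsmall _ hAle]
  rw [hAeq, h.edgesIn_eq] at hfA
  rw [hAeq, card_map] at hAle
  -- The given `f` may be less than the number of core edges, because a minimiser of Φ need not be
  -- induced; putting in the missing edges only decreases the mean scale.
  have hsle : scale root₁ (coreEdges i E) n p ≤ (n : ℝ) ^ #(free root₁) * p ^ f := by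
    unfold scale
    gcongr ?_ * ?_
    exact pow_le_pow_of_le_one hp0 hp1 hfA
  have hZ' := hZ p hp hp1 (h.overlapBound hτ hx.edges' (by omega) hp0 hsτ) hsτ
    (hsle.trans (hsmall _ hAle).le) ε hε0 hε1 (by
      refine le_trans ?_ hAle
      gcongr
      exact (copyMean_le_scale _ _ _ hp0).trans hsle)
  have hL' := hL p hp hp1 (h.rpow_gap_le_rest hτ hx.edges' (by omega) hp0 hsτ) (ε / 4)
      (by linarith) (by linarith)
  rw [one_mul] at hL'
  refine ((bprob_mono hp0 hp1 fun s _ hs => ?_).trans (bprob_or_le hp0 hp1 _ _)).trans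
    (add_le_add hZ' hL')
  by_contra hcon
  push Not at hcon
  obtain ⟨⟨x, h1⟩, h2⟩ := hcon
  have h3 := le_embCount_of_forall_le E h.apply_root hc x s fun ψ => (h2 ψ).le
  have h4 : (1 + 3 * ε) * copyMean root₁ (coreEdges i E) n p ≤
      copyCount root₁ (coreEdges i E) x s := (Nat.le_ceil _).trans (by exact_mod_cast h1)
  have hm := embMean_eq_mul (root := root) E i root₁ n p
  have hr := (embMean_pos i (restEdges i E) hnV (by omega) hp).le
  have hμ := (embMean_pos root E hnV (by omega) hp).le
  have h5 : (1 + 3 * ε) * (1 - ε / 4) * embMean root E n p ≤ embCount root E x s := by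
    have h0 : 0 ≤ (1 - ε / 4) * embMean i (restEdges i E) n p := mul_nonneg (by linarith) hr
    calc _ = aut root₁ (coreEdges i E) * ((1 + 3 * ε) * copyMean root₁ (coreEdges i E) n p) *
            ((1 - ε / 4) * embMean i (restEdges i E) n p) := by rw [hm]; ring
      _ ≤ aut root₁ (coreEdges i E) * copyCount root₁ (coreEdges i E) x s *
            ((1 - ε / 4) * embMean i (restEdges i E) n p) := by gcongr
      _ ≤ _ := h3
  have h6 : 1 + ε ≤ (1 + 3 * ε) * (1 - ε / 4) := by nlinarith
  have h7 := mul_le_mul_of_nonneg_right h6 hμ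
  have h8 := (abs_lt.1 (hs x)).2
  linarith

end RootedExtension
-- The binomial random graph as a Bernoulli subset of edges
namespace RootedExtension

open Finset BernoulliSubset

theorem card_allEdges (n : ℕ) : #(allEdges n) = n.choose 2 := by
  have h := Sym2.card_diagSet_compl (α := Fin n)
  rw [Fintype.card_fin, ← Nat.card_eq_fintype_card, Nat.card_coe_set_eq] at h
  rw [← h, ← Set.ncard_coe_finset]
  congr 1
  ext e
  simp [allEdges]

theorem measurableSingletonClass_simpleGraph (n : ℕ) :
    MeasurableSingletonClass (SimpleGraph (Fin n)) :=
  ⟨fun Γ => by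
    have h := SimpleGraph.measurable_edgeSet (measurableSet_singleton Γ.edgeSet)
    rwa [show SimpleGraph.edgeSet ⁻¹' {Γ.edgeSet} = {Γ} by ext; simp] at h⟩

theorem edgeSet_fromEdgeSet_coe {n : ℕ} {s : Finset (Sym2 (Fin n))} (hs : s ⊆ allEdges n) :
    (SimpleGraph.fromEdgeSet (s : Set (Sym2 (Fin n)))).edgeSet = s := by
  rw [SimpleGraph.edgeSet_fromEdgeSet]
  ext e
  simp only [Set.mem_sdiff, mem_coe, Sym2.mem_diagSet, and_iff_left_iff_imp]
  intro he
  simpa [allEdges] using hs he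

theorem integral_binomialRandom {n : ℕ} (p : unitInterval) (f : SimpleGraph (Fin n) → ℝ) :
    ∫ Γ, f Γ ∂(SimpleGraph.binomialRandom (Fin n) p) =
      bexp (p : ℝ) (allEdges n)
        fun s => f (SimpleGraph.fromEdgeSet (s : Set (Sym2 (Fin n)))) := by
  classical
  have hms := measurableSingletonClass_simpleGraph n
  rw [integral_fintype .of_finite, bexp]
  symm
  refine sum_bij (fun s _ => SimpleGraph.fromEdgeSet (s : Set (Sym2 (Fin n))))
    (fun s _ => mem_univ _) ?_ ?_ ?_
  · intro s hs t ht h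
    have := congrArg SimpleGraph.edgeSet h
    rw [edgeSet_fromEdgeSet_coe (mem_powerset.1 hs), edgeSet_fromEdgeSet_coe (mem_powerset.1 ht)]
      at this
    exact_mod_cast this
  · intro Γ _
    refine ⟨Γ.edgeFinset, mem_powerset.2 fun e he => ?_, ?_⟩
    · rw [allEdges, mem_filter]
      exact ⟨mem_univ _, Γ.not_isDiag_of_mem_edgeFinset he⟩
    · simp
  · intro s hs
    rw [measureReal_def, SimpleGraph.binomialRandom_singleton,
      edgeSet_fromEdgeSet_coe (mem_powerset.1 hs), Set.ncard_coe_finset, card_allEdges,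
      Nat.card_eq_fintype_card, Fintype.card_fin, smul_eq_mul]
    congr 1

theorem binomialRandom_real_setOf {n : ℕ} (p : unitInterval) (Q : SimpleGraph (Fin n) → Prop) :
    (SimpleGraph.binomialRandom (Fin n) p).real {Γ | Q Γ} =
      bprob (p : ℝ) (allEdges n)
        fun s => Q (SimpleGraph.fromEdgeSet (s : Set (Sym2 (Fin n)))) := by
  have hms := measurableSingletonClass_simpleGraph n
  have hm : MeasurableSet {Γ : SimpleGraph (Fin n) | Q Γ} := (Set.toFinite _).measurableSet
  rw [bprob, ← integral_binomialRandom p fun Γ => ind (Q Γ), ← integral_indicator_one hm]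
  refine integral_congr_ae (.of_forall fun Γ => ?_)
  change _ = ind (Q Γ)
  by_cases h : Q Γ
  · rw [ind_of h, Set.indicator_of_mem (show Γ ∈ {Γ | Q Γ} from h)]; rfl
  · rw [ind_of_not h, Set.indicator_of_notMem (show Γ ∉ {Γ | Q Γ} from h)]

end RootedExtension

/-! ### Extension counts of rooted graphs as embedding counts -/

namespace RootedGraph

open Finset BernoulliSubset RootedExtension

variable {k n : ℕ}

noncomputable instance (R : RootedGraph.{u} k) : Fintype R.V := Fintype.ofFinite _

/-- The edges of `H` that are not edges of `G`. -/
noncomputable def extEdges (R : RootedGraph.{u} k) : Finset (Sym2 R.V) :=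
  (Set.toFinite R.extGraph.edgeSet).toFinset

theorem mem_extEdges {R : RootedGraph.{u} k} {e : Sym2 R.V} :
    e ∈ R.extEdges ↔ e ∈ R.extGraph.edgeSet := by simp [extEdges]

theorem mem_extEdges' {R : RootedGraph.{u} k} {e : Sym2 R.V} :
    e ∈ R.extEdges ↔ e ∈ R.graph.edgeSet ∧ ¬∀ v ∈ e, v ∈ Set.range R.root := by
  rw [mem_extEdges, extGraph, SimpleGraph.edgeSet_deleteEdges, Set.mem_sdiff]
  refine and_congr_right fun he => not_congr ?_
  induction e with
  | h a b =>
    have hab : R.graph.Adj a b := he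
    rw [SimpleGraph.Subgraph.mem_edgeSet, rootGraph, SimpleGraph.Subgraph.induce_adj]
    simp [hab]

theorem isExtEdges_extEdges (R : RootedGraph.{u} k) : IsExtEdges R.root R.extEdges := by
  refine ⟨fun e he => ?_, fun e he => ?_⟩
  · exact R.graph.not_isDiag_of_mem_edgeSet (mem_extEdges'.1 he).1
  · have := (mem_extEdges'.1 he).2
    push Not at this
    exact this

/-- The image of `H_G` under an embedding of the vertices, as a subgraph. -/
def imageSubgraph (R : RootedGraph.{u} k) (Γ : SimpleGraph (Fin n)) (φ : R.V ↪ Fin n) :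
    Γ.Subgraph where
  verts := Set.range φ
  Adj a b := s(a, b) ∈ im φ R.extEdges ∧ Γ.Adj a b
  adj_sub h := h.2
  edge_vert := by
    rintro a b ⟨h, -⟩
    obtain ⟨d, -, hd⟩ := mem_im.1 h
    have ha : a ∈ d.map φ := hd ▸ Sym2.mem_mk_left a b
    obtain ⟨v, -, rfl⟩ := Sym2.mem_map.1 ha
    exact ⟨v, rfl⟩
  symm := ⟨fun a b h => ⟨Sym2.eq_swap ▸ h.1, h.2.symm⟩⟩

theorem mem_edgeSet_imageSubgraph {R : RootedGraph.{u} k} {s : Finset (Sym2 (Fin n))}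
    (hs : s ⊆ allEdges n) {φ : R.V ↪ Fin n} (hφ : im φ R.extEdges ⊆ s) {e : Sym2 (Fin n)} :
    e ∈ (R.imageSubgraph (SimpleGraph.fromEdgeSet (s : Set (Sym2 (Fin n)))) φ).edgeSet ↔
      e ∈ im φ R.extEdges := by
  induction e with
  | h a b =>
    refine ⟨fun h => h.1, fun h => ⟨h, ?_⟩⟩
    rw [← SimpleGraph.mem_edgeSet, edgeSet_fromEdgeSet_coe hs]
    exact hφ h

/-- An isomorphism onto a subgraph, composed with the inclusion of its vertices, is an embedding;
conversely an embedding with all edges in `s` is an isomorphism onto its image. -/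
theorem exists_iso_iff {R : RootedGraph.{u} k} {s : Finset (Sym2 (Fin n))}
    (hs : s ⊆ allEdges n) (x : Fin k ↪ Fin n)
    (S : (SimpleGraph.fromEdgeSet (s : Set (Sym2 (Fin n)))).Subgraph) :
    (∃ φ : R.extGraph ≃g S.coe, ∀ j : Fin k, (φ (R.root j) : Fin n) = x j) ↔
      ∃ φ ∈ embs R.root x, im φ R.extEdges ⊆ s ∧ R.imageSubgraph _ φ = S := by
  constructor
  · rintro ⟨ψ, hψ⟩
    let φ : R.V ↪ Fin n := ⟨fun v => ψ v, fun v w h => ψ.injective (Subtype.ext h)⟩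
    have hadj : ∀ a b, R.extGraph.Adj a b → S.Adj (φ a) (φ b) := fun a b h => ψ.map_rel_iff.2 h
    have him : ∀ e ∈ im φ R.extEdges, e ∈ S.edgeSet := by
      intro e he
      obtain ⟨d, hd, rfl⟩ := mem_im.1 he
      induction d with
      | h a b => exact hadj a b (mem_extEdges.1 hd)
    refine ⟨φ, mem_embs.2 hψ, fun e he => ?_, ?_⟩
    · have := S.edgeSet_subset (him e he)
      rw [edgeSet_fromEdgeSet_coe hs] at this
      exact this
    · ext a b
      · change a ∈ Set.range φ ↔ _
        constructor
        · rintro ⟨v, rfl⟩; exact (ψ v).2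
        · intro ha
          obtain ⟨v, hv⟩ := ψ.surjective ⟨a, ha⟩
          exact ⟨v, congrArg Subtype.val hv⟩
      · constructor
        · rintro ⟨h, -⟩
          exact him _ h
        · intro h
          refine ⟨?_, h.adj_sub⟩
          obtain ⟨v, hv⟩ := ψ.surjective ⟨a, h.fst_mem⟩
          obtain ⟨w, hw⟩ := ψ.surjective ⟨b, h.snd_mem⟩
          have h1 : S.coe.Adj (ψ v) (ψ w) := by rw [hv, hw]; exact h
          refine mem_im.2 ⟨s(v, w), mem_extEdges.2 (ψ.map_rel_iff.1 h1), ?_⟩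
          change s((ψ v : Fin n), (ψ w : Fin n)) = _
          rw [hv, hw]
  · rintro ⟨φ, hφ, him, rfl⟩
    refine ⟨⟨Equiv.ofInjective φ φ.injective, ?_⟩, fun j => mem_embs.1 hφ j⟩
    intro a b
    change s(φ a, φ b) ∈ im φ R.extEdges ∧ _ ↔ _
    have h1 : s(φ a, φ b) ∈ im φ R.extEdges ↔ s(a, b) ∈ R.extEdges :=
      Finset.mem_map' φ.sym2Map (a := s(a, b))
    rw [h1, mem_extEdges, SimpleGraph.mem_edgeSet, and_iff_left_iff_imp]
    intro h
    have h2 := him (h1.2 (mem_extEdges.2 h))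
    rw [← SimpleGraph.mem_edgeSet, edgeSet_fromEdgeSet_coe hs]
    exact h2

/-- `H` may have isolated non-roots, so a subgraph records its vertices as well as its edges. The
fibres of the map to subgraphs are the automorphism classes of `card_fiber`, all of the same size.
-/
theorem aut_mul_extCount (R : RootedGraph.{u} k) {s : Finset (Sym2 (Fin n))}
    (hs : s ⊆ allEdges n) (x : Fin k ↪ Fin n) :
    (aut R.root R.extEdges : ℝ) *
      R.extCount x (SimpleGraph.fromEdgeSet (s : Set (Sym2 (Fin n)))) =
        embCount R.root R.extEdges x s := by
  classical
  set Γ := SimpleGraph.fromEdgeSet (s : Set (Sym2 (Fin n))) with hΓ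
  set Q := (embs R.root x).filter fun φ => im φ R.extEdges ⊆ s
  have hset : {S : Γ.Subgraph |
      ∃ φ : R.extGraph ≃g S.coe, ∀ j : Fin k, (φ (R.root j) : Fin n) = x j} =
        ((Q.image (R.imageSubgraph Γ) : Finset Γ.Subgraph) : Set Γ.Subgraph) := by
    ext S
    rw [Set.mem_ofPred_eq, exists_iso_iff hs, coe_image, Set.mem_image]
    simp only [Q, coe_filter, Set.mem_ofPred_eq, and_assoc]
    rfl
  have hfib : ∀ S ∈ Q.image (R.imageSubgraph Γ),
      #(Q.filter fun φ => R.imageSubgraph Γ φ = S) = aut R.root R.extEdges := by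
    intro S hS
    obtain ⟨φ₀, hφ₀, rfl⟩ := mem_image.1 hS
    obtain ⟨h₀, h₀s⟩ := mem_filter.1 hφ₀
    rw [filter_filter]
    refine card_fiber R.root R.extEdges x h₀ _ fun φ hφ => ?_
    constructor
    · rintro ⟨h1, h2⟩
      constructor
      · ext a
        have := congrArg (fun S : Γ.Subgraph => a ∈ S.verts) h2
        change (a ∈ Set.range φ) = (a ∈ Set.range φ₀) at this
        simpa [RootedExtension.range] using this
      · ext e
        rw [← mem_edgeSet_imageSubgraph hs h1, ← mem_edgeSet_imageSubgraph hs h₀s, ← hΓ, h2]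
    · rintro ⟨h1, h2⟩
      refine ⟨h2 ▸ h₀s, ?_⟩
      ext a b
      · change a ∈ Set.range φ ↔ a ∈ Set.range φ₀
        have := congrArg (fun S : Finset (Fin n) => a ∈ S) h1
        simpa [RootedExtension.range] using this
      · change _ ∧ _ ↔ _ ∧ _
        rw [h2]
  have hcard := card_eq_sum_card_image (R.imageSubgraph Γ) Q
  rw [sum_congr rfl hfib, sum_const, smul_eq_mul] at hcard
  rw [embCount, sum_ind, extCount, hset, Set.ncard_coe_finset]
  change _ = ((#Q : ℕ) : ℝ)
  rw [hcard, mul_comm]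
  push_cast
  rfl

theorem aut_mul_mean (R : RootedGraph.{u} k) (hk : k ≤ n) (p : unitInterval) :
    (aut R.root R.extEdges : ℝ) * R.mean n p = embMean R.root R.extEdges n p := by
  rw [mean, dif_pos hk, integral_binomialRandom, ← bexp_const_mul,
    bexp_congr fun s hs => R.aut_mul_extCount hs _,
    ← sum_pow_card_im R.root R.extEdges (Fin.castLEEmb hk)]
  simp only [embCount]
  rw [bexp_sum]
  refine sum_congr rfl fun φ _ => ?_
  exact bprob_subset (im_subset_allEdges R.isExtEdges_extEdges φ)

theorem concProb_eq (R : RootedGraph.{u} k) (hk : k ≤ n) (p : unitInterval) (ε : ℝ) :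
    R.concProb n p ε = bprob (p : ℝ) (allEdges n) fun s => ∀ x,
      |embCount R.root R.extEdges x s - embMean R.root R.extEdges n p| <
        ε * embMean R.root R.extEdges n p := by
  rw [concProb, binomialRandom_real_setOf]
  refine bexp_congr fun s hs => ind_congr (forall_congr' fun x => ?_)
  have ha : (0 : ℝ) < aut R.root R.extEdges := by exact_mod_cast aut_pos _ _
  rw [← R.aut_mul_extCount hs x, ← R.aut_mul_mean hk, ← mul_sub, abs_mul, abs_of_pos ha,
    mul_left_comm, mul_lt_mul_iff_right₀ ha]

end RootedGraph
-- Densities, primal subgraphs and the minimal mean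
namespace RootedGraph

open Finset BernoulliSubset RootedExtension

variable {k n : ℕ}

/-- The inclusion of the vertices of a subgraph. -/
def incl (R : RootedGraph.{u} k) (J : R.graph.Subgraph) (hJ : R.rootGraph ≤ J) :
    (R.sub J hJ).V ↪ R.V := Function.Embedding.subtype _

section sub

variable {R : RootedGraph.{u} k} {J : R.graph.Subgraph} {hJ : R.rootGraph ≤ J}

theorem incl_root (j : Fin k) : R.incl J hJ ((R.sub J hJ).root j) = R.root j := rfl

theorem incl_mem_range_root {w : (R.sub J hJ).V} :
    R.incl J hJ w ∈ Set.range R.root ↔ w ∈ Set.range (R.sub J hJ).root := by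
  constructor
  · rintro ⟨j, hj⟩; exact ⟨j, (R.incl J hJ).injective hj⟩
  · rintro ⟨j, rfl⟩; exact ⟨j, rfl⟩

theorem mem_range_incl {v : R.V} : v ∈ Set.range (R.incl J hJ) ↔ v ∈ J.verts := by
  change v ∈ Set.range (Subtype.val : J.verts → R.V) ↔ _
  rw [Subtype.range_coe]

theorem mem_extEdges_sub {e : Sym2 (R.sub J hJ).V} :
    e ∈ (R.sub J hJ).extEdges ↔
      e.map (R.incl J hJ) ∈ J.edgeSet ∧ ¬∀ v ∈ e.map (R.incl J hJ), v ∈ Set.range R.root := by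
  rw [mem_extEdges']
  refine and_congr ?_ (not_congr ?_)
  · induction e with
    | h a b => exact Iff.rfl
  · simp only [Sym2.mem_map, forall_exists_index, and_imp, forall_apply_eq_imp_iff₂,
      incl_mem_range_root]

theorem extEdges_sub_subset : (R.sub J hJ).extEdges ⊆ coreEdges (R.incl J hJ) R.extEdges := by
  intro e he
  obtain ⟨h1, h2⟩ := mem_extEdges_sub.1 he
  exact mem_coreEdges.2 (mem_extEdges'.2 ⟨J.edgeSet_subset h1, h2⟩)

theorem extEdges_sub_eq (hind : J.IsInduced) :
    (R.sub J hJ).extEdges = coreEdges (R.incl J hJ) R.extEdges := by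
  refine extEdges_sub_subset.antisymm fun e he => ?_
  obtain ⟨h1, h2⟩ := mem_extEdges'.1 (mem_coreEdges.1 he)
  refine mem_extEdges_sub.2 ⟨?_, h2⟩
  induction e with
  | h a b => exact hind a.2 b.2 h1

theorem mem_rootGraph_edgeSet {e : Sym2 R.V} :
    e ∈ R.rootGraph.edgeSet ↔ e ∈ R.graph.edgeSet ∧ ∀ v ∈ e, v ∈ Set.range R.root := by
  induction e with
  | h a b =>
    rw [SimpleGraph.Subgraph.mem_edgeSet, rootGraph, SimpleGraph.Subgraph.induce_adj]
    simp
    tauto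

theorem card_extEdges_sub :
    #(R.sub J hJ).extEdges + R.rootGraph.edgeSet.ncard = J.edgeSet.ncard := by
  rw [← Set.ncard_sdiff_add_ncard_of_subset (SimpleGraph.Subgraph.edgeSet_mono hJ)
    (Set.toFinite _), ← card_map (R.incl J hJ).sym2Map, ← Set.ncard_coe_finset]
  congr 2
  ext e
  simp only [coe_map, Set.mem_image, mem_coe, Set.mem_sdiff, mem_rootGraph_edgeSet]
  constructor
  · rintro ⟨d, hd, rfl⟩
    obtain ⟨h1, h2⟩ := mem_extEdges_sub.1 hd
    exact ⟨h1, fun h => h2 h.2⟩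
  · rintro ⟨h1, h2⟩
    obtain ⟨d, rfl⟩ : ∃ d : Sym2 (R.sub J hJ).V, d.map (R.incl J hJ) = e :=
      exists_map_eq fun v hv => mem_range_incl.2 (J.mem_verts_of_mem_edge h1 hv)
    exact ⟨d, mem_extEdges_sub.2 ⟨h1, fun h => h2 ⟨J.edgeSet_subset h1, h⟩⟩, rfl⟩

theorem card_free_sub :
    #(free (R.sub J hJ).root) + R.rootGraph.verts.ncard = J.verts.ncard := by
  have h1 := card_free (R.sub J hJ).root
  have h2 : R.rootGraph.verts.ncard = Fintype.card (Fin k) := by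
    change (Set.range R.root).ncard = _
    rw [← Set.image_univ, Set.ncard_image_of_injective _ R.root.injective, Set.ncard_univ,
      Nat.card_eq_fintype_card]
  have h3 : J.verts.ncard = Fintype.card (R.sub J hJ).V := by
    rw [← Nat.card_coe_set_eq, ← Nat.card_eq_fintype_card]
    rfl
  omega

theorem density_eq (hJ : R.rootGraph ≤ J) :
    R.density J = #(R.sub J hJ).extEdges / #(free (R.sub J hJ).root) := by
  rw [density, ← card_extEdges_sub (hJ := hJ), ← card_free_sub (hJ := hJ)]
  push_cast
  rw [add_sub_cancel_right, add_sub_cancel_right]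

theorem map_free_sub_subset : (free (R.sub J hJ).root).map (R.incl J hJ) ⊆ free R.root := by
  intro v hv
  obtain ⟨w, hw, rfl⟩ := Finset.mem_map.1 hv
  exact mem_free.2 fun h => mem_free.1 hw (incl_mem_range_root.1 h)

theorem map_free_sub (hJ : R.rootGraph ≤ J) :
    ∀ v, v ∈ (free (R.sub J hJ).root).map (R.incl J hJ) ↔ v ∈ J.verts ∧ v ∉ Set.range R.root := by
  intro v
  rw [Finset.mem_map]
  constructor
  · rintro ⟨w, hw, rfl⟩
    exact ⟨w.2, fun h => mem_free.1 hw (incl_mem_range_root.1 h)⟩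
  · rintro ⟨h1, h2⟩
    exact ⟨⟨v, h1⟩, mem_free.2 fun h => h2 (incl_mem_range_root.2 h), rfl⟩

theorem edgesIn_map_free_sub :
    edgesIn R.root R.extEdges ((free (R.sub J hJ).root).map (R.incl J hJ)) =
      #(coreEdges (R.incl J hJ) R.extEdges) := by
  rw [← edgesIn_coreEdges R.extEdges (incl_root (J := J) (hJ := hJ)), edgesIn_free]

end sub

/-- The subgraph of `H` induced by the roots and a set of further vertices. -/
def span (R : RootedGraph.{u} k) (A : Finset R.V) : R.graph.Subgraph :=
  (⊤ : R.graph.Subgraph).induce (↑A ∪ Set.range R.root)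

theorem rootGraph_le_span (R : RootedGraph.{u} k) (A : Finset R.V) : R.rootGraph ≤ R.span A :=
  SimpleGraph.Subgraph.induce_mono_right Set.subset_union_right

theorem isInduced_induce_top (R : RootedGraph.{u} k) (S : Set R.V) :
    ((⊤ : R.graph.Subgraph).induce S).IsInduced := fun _ ha _ hb h => ⟨ha, hb, h⟩

theorem map_free_span {R : RootedGraph.{u} k} {A : Finset R.V} (hA : A ⊆ free R.root) :
    (free (R.sub (R.span A) (R.rootGraph_le_span A)).root).map
      (R.incl (R.span A) (R.rootGraph_le_span A)) = A := by
  ext v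
  rw [map_free_sub]
  change v ∈ (↑A ∪ Set.range R.root : Set R.V) ∧ _ ↔ _
  constructor
  · rintro ⟨h | h, h'⟩
    · exact h
    · exact absurd h h'
  · exact fun h => ⟨Or.inl h, mem_free.1 (hA h)⟩

theorem card_free_span {R : RootedGraph.{u} k} {A : Finset R.V} (hA : A ⊆ free R.root) :
    #(free (R.sub (R.span A) (R.rootGraph_le_span A)).root) = #A := by
  conv_rhs => rw [← map_free_span hA, card_map]

theorem card_extEdges_span {R : RootedGraph.{u} k} {A : Finset R.V} (hA : A ⊆ free R.root) :
    #(R.sub (R.span A) (R.rootGraph_le_span A)).extEdges = edgesIn R.root R.extEdges A := by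
  conv_rhs => rw [← map_free_span hA, edgesIn_map_free_sub]
  rw [extEdges_sub_eq (J := R.span A) (R.isInduced_induce_top _)]

theorem density_le_maxDensity {R : RootedGraph.{u} k} {J : R.graph.Subgraph}
    (hJ : R.rootGraph < J) : R.density J ≤ R.maxDensity := by
  refine le_csSup (Set.Finite.bddAbove ?_) ⟨J, hJ, rfl⟩
  refine (Set.finite_range R.density).subset ?_
  rintro d ⟨J, -, rfl⟩
  exact ⟨J, rfl⟩

/-- Adding all edges among the vertices of `J` cannot lower the density, so the induced subgraph is
primal too, and uniqueness identifies the two. -/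
theorem IsPrimal.isInduced {R : RootedGraph.{u} k} {J : R.graph.Subgraph} (hJ : R.IsPrimal J)
    (hunique : ∀ J' : R.graph.Subgraph, R.IsPrimal J' → J' = J) : J.IsInduced := by
  set J' := (⊤ : R.graph.Subgraph).induce J.verts
  have hle : J ≤ J' := SimpleGraph.Subgraph.le_induce_top_verts
  have hlt : R.rootGraph < J' := hJ.1.trans_le hle
  have hd : R.density J ≤ R.density J' := by
    have h1 : (J.edgeSet.ncard : ℝ) ≤ J'.edgeSet.ncard := by
      exact_mod_cast Set.ncard_le_ncard (SimpleGraph.Subgraph.edgeSet_mono hle) (Set.toFinite _)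
    have h2 : (R.rootGraph.verts.ncard : ℝ) ≤ J.verts.ncard := by
      exact_mod_cast Set.ncard_le_ncard hJ.1.le.1 (Set.toFinite _)
    refine div_le_div_of_nonneg_right (by linarith) ?_
    change (0 : ℝ) ≤ J.verts.ncard - R.rootGraph.verts.ncard
    linarith
  have hp : R.IsPrimal J' := ⟨hlt, (density_le_maxDensity hlt).antisymm (hJ.2 ▸ hd)⟩
  rw [← hunique J' hp]
  exact R.isInduced_induce_top _

theorem Grounded.exists_mem_extEdges {R : RootedGraph.{u} k} (h : R.Grounded) :
    ∃ (j : Fin k) (w : R.V), w ∈ free R.root ∧ s(R.root j, w) ∈ R.extEdges := by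
  obtain ⟨j, w, hw, hadj⟩ := h
  exact ⟨j, w, mem_free.2 hw, mem_extEdges'.2 ⟨hadj, fun h => hw (h w (Sym2.mem_mk_right _ _))⟩⟩

/-- For a nonempty set A other than the non-roots of `J`, the subgraph spanned by A and the roots
differs from `J`; uniqueness makes its density strictly smaller, and clearing denominators gives the
integer inequality. -/
theorem IsPrimal.isUniquePrimal {R : RootedGraph.{u} k} {J : R.graph.Subgraph}
    (hJ : R.IsPrimal J) (hunique : ∀ J' : R.graph.Subgraph, R.IsPrimal J' → J' = J)
    (hgr : (R.sub J hJ.1.le).Grounded) :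
    IsUniquePrimal R.root R.extEdges (R.incl J hJ.1.le) (R.sub J hJ.1.le).root := by
  have hcore := extEdges_sub_eq (hJ := hJ.1.le) (hJ.isInduced hunique)
  obtain ⟨j, w, hw, hjw⟩ := hgr.exists_mem_extEdges
  refine ⟨fun j => incl_root j, ⟨_, hcore ▸ hjw⟩, fun A hA hne hAJ => ?_⟩
  have hlt : R.rootGraph < R.span A := by
    refine lt_of_le_of_ne (R.rootGraph_le_span A) fun h => ?_
    obtain ⟨v, hv⟩ := hne
    have h1 : v ∈ (R.span A).verts := Or.inl hv
    rw [← h] at h1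
    exact mem_free.1 (hA hv) h1
  have hJA : R.span A ≠ J := by
    rintro rfl
    exact hAJ (map_free_span hA).symm
  have hd : R.density (R.span A) < R.density J := by
    refine lt_of_le_of_ne ((density_le_maxDensity hlt).trans_eq hJ.2.symm) fun h => ?_
    exact hJA (hunique _ ⟨hlt, h.trans hJ.2⟩)
  rw [density_eq (R.rootGraph_le_span A), density_eq hJ.1.le, card_free_span hA,
    card_extEdges_span hA, hcore] at hd
  have h1 : (0 : ℝ) < #A := by exact_mod_cast hne.card_pos
  have h2 : (0 : ℝ) < #(free (R.sub J hJ.1.le).root) := by exact_mod_cast card_pos.2 ⟨w, hw⟩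
  rw [div_lt_div_iff₀ h1 h2] at hd
  have h3 : edgesIn R.root R.extEdges A * #(free (R.sub J hJ.1.le).root) <
    #(coreEdges (R.incl J hJ.1.le) R.extEdges) * #A := by exact_mod_cast hd
  rwa [mul_comm] at h3

theorem finite_means (R : RootedGraph.{u} k) (n : ℕ) (p : unitInterval) :
    {m : ℝ | ∃ (J : R.graph.Subgraph) (hJ : R.rootGraph ≤ J),
      R.rootGraph.edgeSet.ncard < J.edgeSet.ncard ∧ m = (R.sub J hJ).mean n p}.Finite := by
  refine (Set.finite_range fun J : {J : R.graph.Subgraph // R.rootGraph ≤ J} =>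
    (R.sub J.1 J.2).mean n p).subset ?_
  rintro m ⟨J, hJ, -, rfl⟩
  exact ⟨⟨J, hJ⟩, rfl⟩

/-- Take the subgraph spanned by A and the roots as a competitor for the minimum; dividing by its
number of automorphisms only decreases the mean. -/
theorem minMean_le {R : RootedGraph.{u} k} {A : Finset R.V} (hA : A ⊆ free R.root)
    (h0 : 0 < edgesIn R.root R.extEdges A) (hk : k ≤ n) (p : unitInterval) :
    R.minMean n p ≤ (n : ℝ) ^ #A * (p : ℝ) ^ edgesIn R.root R.extEdges A := by
  have hJ := R.rootGraph_le_span A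
  have he := card_extEdges_sub (hJ := hJ)
  rw [card_extEdges_span hA] at he
  refine (csInf_le (R.finite_means n p).bddBelow ⟨R.span A, hJ, by omega, rfl⟩).trans ?_
  have h1 := (R.sub (R.span A) hJ).aut_mul_mean hk p
  have h2 := embMean_le (R.sub (R.span A) hJ).root (R.sub (R.span A) hJ).extEdges n p.2.1
  have h3 : (1 : ℝ) ≤ aut (R.sub (R.span A) hJ).root (R.sub (R.span A) hJ).extEdges := by
    exact_mod_cast aut_pos _ _
  rw [← h1, card_free_span hA, card_extEdges_span hA] at h2
  by_cases hm : 0 ≤ (R.sub (R.span A) hJ).mean n p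
  · nlinarith
  · have : (0 : ℝ) ≤ (n : ℝ) ^ #A * (p : ℝ) ^ edgesIn R.root R.extEdges A := by
      have := p.2.1
      positivity
    linarith

/-- The minimum over the finite set is attained, and `hne` rules out the default value 0 of an empty
infimum. The constant covers the falling factorial and the automorphisms of the minimiser. -/
theorem exists_le_minMean {R : RootedGraph.{u} k}
    (hne : ∃ J, R.rootGraph ≤ J ∧ R.rootGraph.edgeSet.ncard < J.edgeSet.ncard)
    (hk : k ≤ n) (hn : 2 * Fintype.card R.V ≤ n) (p : unitInterval) :
    ∃ A ⊆ free R.root, ∃ f, 0 < f ∧ f ≤ edgesIn R.root R.extEdges A ∧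
      (n : ℝ) ^ #A * (p : ℝ) ^ f ≤
        2 ^ Fintype.card R.V * (Fintype.card R.V).factorial * R.minMean n p := by
  obtain ⟨J₀, hJ₀, hJ₀e⟩ := hne
  obtain ⟨J, hJ, hJe, hmin⟩ := Set.Nonempty.csInf_mem
    (s := {m : ℝ | ∃ (J : R.graph.Subgraph) (hJ : R.rootGraph ≤ J),
      R.rootGraph.edgeSet.ncard < J.edgeSet.ncard ∧ m = (R.sub J hJ).mean n p})
    ⟨_, J₀, hJ₀, hJ₀e, rfl⟩ (R.finite_means n p)
  change R.minMean n p = _ at hmin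
  have he := card_extEdges_sub (hJ := hJ)
  have hcard : Fintype.card (R.sub J hJ).V ≤ Fintype.card R.V :=
    Fintype.card_le_of_embedding (R.incl J hJ)
  refine ⟨_, map_free_sub_subset (hJ := hJ), #(R.sub J hJ).extEdges, by omega, ?_, ?_⟩
  · rw [edgesIn_map_free_sub]
    exact card_le_card extEdges_sub_subset
  · rw [card_map, hmin]
    have h1 := (R.sub J hJ).aut_mul_mean hk p
    have h2 := le_embMean (R.sub J hJ).root (R.sub J hJ).extEdges (by omega : _ ≤ n) p.2.1
    have h3 : (0 : ℝ) < aut (R.sub J hJ).root (R.sub J hJ).extEdges := by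
      exact_mod_cast aut_pos _ _
    have h4 : (aut (R.sub J hJ).root (R.sub J hJ).extEdges : ℝ) ≤
        (Fintype.card R.V).factorial := by
      exact_mod_cast (aut_le _ _).trans (Nat.factorial_le hcard)
    have h5 : (0 : ℝ) ≤ (R.sub J hJ).mean n p := by
      have := embMean_nonneg (R.sub J hJ).root (R.sub J hJ).extEdges n p.2.1
      rw [← h1] at this
      exact nonneg_of_mul_nonneg_right this h3
    rw [← h1] at h2
    refine h2.trans ?_
    rw [mul_assoc]
    gcongr
    norm_num

end RootedGraph

/-! ### Both limits -/

theorem theorem2 {k : ℕ} (R : RootedGraph.{u} k) (J : R.graph.Subgraph)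
    (hJ : R.IsPrimal J) (hunique : ∀ J' : R.graph.Subgraph, R.IsPrimal J' → J' = J)
    (hgrounded : (R.sub J hJ.1.le).Grounded) :
    ∃ c C α : ℝ, 0 < c ∧ 0 < C ∧ 0 < α ∧
      ∀ (p : ℕ → unitInterval) (ε : ℕ → ℝ),
        (∀ᶠ n : ℕ in atTop, (n : ℝ) ^ (-α) ≤ ε n ∧ ε n ≤ 1) →
        ((∀ᶠ n : ℕ in atTop, ε n ^ 2 * R.minMean n (p n) ≤ c * Real.log n) →
          Tendsto (fun n : ℕ => R.concProb n (p n) (ε n)) atTop (𝓝 0)) ∧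
        ((∀ᶠ n : ℕ in atTop, C * Real.log n ≤ ε n ^ 2 * R.minMean n (p n)) →
          Tendsto (fun n : ℕ => R.concProb n (p n) (ε n)) atTop (𝓝 1)) := by
  have h := hJ.isUniquePrimal hunique hgrounded
  have hE := R.isExtEdges_extEdges
  obtain ⟨j, w, -, hjw⟩ := hgrounded.exists_mem_extEdges
  -- The grounded edge lies in `J` but not in `G`, so the minimum defining Φ is over a nonempty set.
  have hne : ∃ J, R.rootGraph ≤ J ∧ R.rootGraph.edgeSet.ncard < J.edgeSet.ncard :=
    ⟨J, hJ.1.le, by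
      have h1 := RootedGraph.card_extEdges_sub (hJ := hJ.1.le)
      have h2 := Finset.card_pos.2 ⟨_, hjw⟩
      omega⟩
  rw [RootedGraph.extEdges_sub_eq (hJ.isInduced hunique)] at hjw
  obtain ⟨τ, α, hx⟩ := h.exists_exponents
  obtain ⟨C, hC, hconc⟩ := h.eventually_concentrated hE hx
  have hnot := h.eventually_not_concentrated hE hjw hx
  have hτ := hx.pos
  set M : ℝ := 2 ^ Fintype.card R.V * (Fintype.card R.V).factorial with hM
  have hMpos : 0 < M := by positivity
  have hlim : ∀ {t : ℝ}, 0 < t → Tendsto (fun n : ℕ => (n : ℝ) ^ (-t)) atTop (𝓝 0) :=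
    fun ht => (tendsto_rpow_neg_atTop ht).comp tendsto_natCast_atTop_atTop
  -- The factor `M` is the loss in passing from Φ to n^|A| p^f. The other direction needs no loss,
  -- so `C` is unchanged.
  refine ⟨τ / M, C, α, by positivity, hC, hx.pos', fun p ε hε => ⟨fun hsmall => ?_,
    fun hlarge => ?_⟩⟩
  · have hlim0 := (hlim hτ).add (hlim one_pos)
    rw [add_zero] at hlim0
    refine squeeze_zero' (.of_forall fun n => measureReal_nonneg) ?_ hlim0
    filter_upwards [hε, hsmall, hnot, eventually_ge_atTop k,
      eventually_ge_atTop (2 * Fintype.card R.V)] with n hεn hs hnot hk hn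
    rw [R.concProb_eq hk]
    refine hnot (p n) (p n).2.1 (p n).2.2 (ε n) hεn.1 hεn.2 ?_
    obtain ⟨A, hA, f, hf0, hf, hle⟩ := RootedGraph.exists_le_minMean hne hk hn (p n)
    refine ⟨A, hA, f, hf0, hf, ?_⟩
    calc ε n ^ 2 * ((n : ℝ) ^ A.card * (p n : ℝ) ^ f)
        ≤ ε n ^ 2 * (M * R.minMean n (p n)) := by gcongr
      _ = M * (ε n ^ 2 * R.minMean n (p n)) := by ring
      _ ≤ M * (τ / M * Real.log n) := by gcongr
      _ = _ := by field_simp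
  · have hlim1 := ((hlim one_pos).const_mul 4).const_sub 1
    rw [mul_zero, sub_zero] at hlim1
    refine tendsto_of_tendsto_of_tendsto_of_le_of_le' hlim1 tendsto_const_nhds ?_
      (.of_forall fun n => measureReal_le_one)
    filter_upwards [hε, hlarge, hconc, eventually_ge_atTop k] with n hεn hl hconc hk
    rw [R.concProb_eq hk]
    have h1 := hconc (p n) (p n).2.1 (p n).2.2 (ε n) hεn.1 hεn.2 fun A hA hA0 =>
      hl.trans (by gcongr; exact RootedGraph.minMean_le hA hA0 hk (p n))
    have h2 := BernoulliSubset.bprob_not (p := (p n : ℝ)) (T := RootedExtension.allEdges n)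
      (fun s => ∀ x, |RootedExtension.embCount R.root R.extEdges x s -
        RootedExtension.embMean R.root R.extEdges n (p n)| <
          ε n * RootedExtension.embMean R.root R.extEdges n (p n))
    simp only [not_forall, not_lt] at h2
    linarith
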